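/- Let $n\ge 0$, let $M=C^\infty(S^1,\mathbb{R}^n)$ with $S^1=\mathbb{R}/\mathbb{Z}$, and let $P_0=g^{ab}\frac{d}{dx}$ where $(g^{ab})$ is a constant, symmetric, invertible real $n\times n$ matrix. Call a polynomial in the derivatives $u^a_i=\partial_x^i u^a$ ($i\ge 1$), whose coefficients are arbitrary $C^\infty$ functions of $u\in\mathbb{R}^n$, homogeneous of degree $d$ if each of its monomials has degree $d$, where $u^a_i$ has degree $i$ and functions of $u$ have degree $0$. Write $\langle v,w\rangle=\int_{S^1}\sum_a v^a w_a\,dx$, write $F'_u(v)=\frac{d}{ds}F(u+sv)|_{s=0}$, and let $^*$ denote the adjoint with respect to $\langle\cdot,\cdot\rangle$. For an operator $P_u$ depending on $u$, let $P'_u(\alpha;v)$ be the derivative of $u\mapsto P_u\alpha$ along $v$, and let $P'^{*}_u(\alpha;\beta)$ be defined by $\langle P'_u(\alpha;v),\beta\rangle=\langle v,P'^{*}_u(\alpha;\beta)\rangle$ for all $v$. The Schouten bracket of two skewsymmetric operators is $$2[P,Q](\alpha,\beta)=P'_u(\alpha;Q_u\beta)-P'_u(\beta;Q_u\alpha)+Q_uP'^{*}_u(\alpha;\beta)+Q'_u(\alpha;P_u\beta)-Q'_u(\beta;P_u\alpha)+P_uQ'^{*}_u(\alpha;\beta).$$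 A homogeneous formal deformation of $P_0$ is a formal series $P_\epsilon=P_0+\epsilon P_1+\epsilon^2P_2+\cdots$ in which, for each $k\ge1$, $$P_k=A_0(u)\frac{d^{k+1}}{dx^{k+1}}+A_1(u;u_x)\frac{d^{k}}{dx^{k}}+\cdots+A_{k+1}(u;u_x,\dots,u_{k+1})$$ is a skewsymmetric ($P_k^*=-P_k$) matrix differential operator, the entries of each $A_l$ being homogeneous of degree $l$, and such that $[P_\epsilon,P_\epsilon]=0$, that is, $\sum_{i+j=l}[P_i,P_j]=0$ for all $l\ge0$. **Theorem (Dubrovin's conjecture).** Every homogeneous formal deformation $P_\epsilon$ of $P_0$ is trivial, with a homogeneous trivializing map. That is, there are vector fields $X_k$ ($k\ge1$) on $M$ whose components are homogeneous differential polynomials of degree $k$ such that the ordered product of their formal flows $$\phi_\epsilon=\lim_{k\to\infty}\phi^{[X_k]}_{\epsilon^k}\circ\cdots\circ\phi^{[X_2]}_{\epsilon^2}\circ\phi^{[X_1]}_{\epsilon}$$ satisfies $P_\epsilon=(\phi_\epsilon)_*(P_0)$. Here the formal flow $\phi^{[X]}_t=\mathrm{id}+t\phi_1+t^2\phi_2+\cdots$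 is the formal solution of $\frac{d}{dt}\phi_t=X\circ\phi_t$. The limit is coefficientwise: the product of the first $k$ flows agrees with $\phi_\epsilon$ up to and including order $\epsilon^k$. The last equation means that $$(P_\epsilon)_{\phi_\epsilon(u)}=\phi'_{\epsilon,u}\circ P_0\circ\phi'^{*}_{\epsilon,u}$$ as formal series in $\epsilon$, for all $u\in M$. Moreover $\phi_\epsilon=\mathrm{id}+\epsilon\phi_1+\epsilon^2\phi_2+\cdots$, and the components of each $\phi_m$ are homogeneous differential polynomials of degree $m$. -/

import Mathlib

open scoped ContDiff

noncomputable section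

namespace HydroPoisson

/-- The manifold `M` of smooth maps `S¹ → ℝⁿ`, where `S¹ = ℝ / ℤ`: smooth `1`-periodic functions
`ℝ → ℝⁿ`. Being a vector space, `M` is also the space of tangent vectors at each of its points;
`1`-forms at a point are loops too, through the pairing `pairing` below. -/
def Loop (n : ℕ) : Submodule ℝ (ℝ → Fin n → ℝ) where
  carrier := {u | ContDiff ℝ ∞ u ∧ Function.Periodic u 1}
  add_mem' := fun hu hv => ⟨hu.1.add hv.1, hu.2.add hv.2⟩
  zero_mem' := ⟨contDiff_const, fun _ => rfl⟩
  smul_mem' := fun c _ hu => ⟨contDiff_const.smul hu.1, fun x => by simp [hu.2 x]⟩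

/-- Infinite jets: `z i a` stands for the `i`-th derivative `u^a_i` of the field function `u^a`. -/
abbrev Jet (n : ℕ) : Type := ℕ → Fin n → ℝ

/-- The jet of the loop `u` at the point `x`. -/
def jet {n : ℕ} (u : Loop n) (x : ℝ) : Jet n :=
  fun i a => iteratedDeriv i (fun y => u.1 y a) x

/-- Homogeneous polynomials of degree `d` in the derivatives `u^a_i`, `i ≥ 1`, whose coefficients
are arbitrary smooth functions of `u ∈ ℝⁿ`; here `u^a_i` has degree `i` and functions of `u` have
degree `0`. The exponent of `u^a_{i+1}` in a monomial `c` is `c (a, i)`. -/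
def homDiffPoly (n d : ℕ) : Submodule ℝ (Jet n → ℝ) :=
  Submodule.span ℝ {F | ∃ (f : (Fin n → ℝ) → ℝ) (c : Fin n × ℕ →₀ ℕ), ContDiff ℝ ∞ f ∧
    (c.sum fun p e => e * (p.2 + 1)) = d ∧
    F = fun z => f (z 0) * c.prod fun p e => z (p.2 + 1) p.1 ^ e}

/-- A map `X : M → M` (for instance a vector field `u̇ = X(u, u_x, u_xx, …)` on `M`) whose
components are homogeneous differential polynomials of degree `d`. -/
def IsHomogeneousField {n : ℕ} (d : ℕ) (X : Loop n → Loop n) : Prop :=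
  ∃ F : Fin n → Jet n → ℝ, (∀ a, F a ∈ homDiffPoly n d) ∧
    ∀ u x a, (X u).1 x a = F a (jet u x)

/-- A homogeneous matrix differential operator of degree `d`,
`P_u = A_0(u) ∂^d + A_1(u; u_x) ∂^(d-1) + ⋯ + A_d(u; u_x, …, u_d)`, the entries of `A_l` being
homogeneous differential polynomials of degree `l`. -/
def IsHomogeneousOperator {n : ℕ} (d : ℕ) (P : Loop n → Loop n → Loop n) : Prop :=
  ∃ A : ℕ → Fin n → Fin n → Jet n → ℝ, (∀ l a b, A l a b ∈ homDiffPoly n l) ∧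
    ∀ u α x a, (P u α).1 x a =
      ∑ l ∈ Finset.range (d + 1), ∑ b, A l a b (jet u x) * jet α x (d - l) b

/-- The pairing `∫_{S¹} ∑_a v^a(x) w_a(x) dx` of vector fields and `1`-forms along the loop. -/
def pairing {n : ℕ} (v w : ℝ → Fin n → ℝ) : ℝ :=
  ∫ x in (0 : ℝ)..1, ∑ a, v x a * w x a

/-- The derivative `F'_u(v) = d/ds F(u + s v) |_{s = 0}`. -/
def frechet {n : ℕ} (F : Loop n → Loop n) (u v : Loop n) : ℝ → Fin n → ℝ :=
  fun x a => deriv (fun s : ℝ => (F (u + s • v)).1 x a) 0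

/-- The value `T* β` of the formal adjoint of `T`: the loop with `⟨T v, β⟩ = ⟨v, T* β⟩` for all
`v`. It is unique, and exists when `T` is a linear differential operator. -/
def adjoint {n : ℕ} (T : Loop n → ℝ → Fin n → ℝ) (β : Loop n) : Loop n :=
  Classical.epsilon fun γ : Loop n => ∀ v : Loop n, pairing (T v) β.1 = pairing v.1 γ.1

/-- `P_u* = - P_u` for all `u`. -/
def IsSkew {n : ℕ} (P : Loop n → Loop n → Loop n) : Prop :=
  ∀ u α β, pairing (P u α).1 β.1 = - pairing α.1 (P u β).1

/-- `P'_u(α; v)`, the derivative of `u ↦ P_u α` along `v`. -/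
def opDeriv {n : ℕ} (P : Loop n → Loop n → Loop n) (u α v : Loop n) : ℝ → Fin n → ℝ :=
  frechet (fun w => P w α) u v

/-- `P'_u*(α; β)`, the adjoint of `v ↦ P'_u(α; v)` applied to `β`. -/
def opDerivAdj {n : ℕ} (P : Loop n → Loop n → Loop n) (u α β : Loop n) : Loop n :=
  adjoint (opDeriv P u α) β

/-- The operator form of (twice) the Schouten bracket of two bivectors:
`2[P,Q](α,β) = P'_u(α; Q_u β) - P'_u(β; Q_u α) + Q_u P'_u*(α; β)`
`           + Q'_u(α; P_u β) - Q'_u(β; P_u α) + P_u Q'_u*(α; β)`. -/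
def twoSchouten {n : ℕ} (P Q : Loop n → Loop n → Loop n) (u α β : Loop n) : ℝ → Fin n → ℝ :=
  opDeriv P u α (Q u β) - opDeriv P u β (Q u α) + (Q u (opDerivAdj P u α β)).1 +
  (opDeriv Q u α (P u β) - opDeriv Q u β (P u α) + (P u (opDerivAdj Q u α β)).1)

/-- The bivector of hydrodynamic type `P_0 = g^{ab} d/dx` in flat coordinates. -/
def hydro {n : ℕ} (g : Matrix (Fin n) (Fin n) ℝ) (_u α : Loop n) : Loop n :=
  ⟨fun x a => ∑ b, g a b * deriv (fun y => α.1 y b) x, by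
    have hα := α.2
    refine ⟨contDiff_pi.2 fun a => ContDiff.sum fun b _ => contDiff_const.mul ?_, fun x => ?_⟩
    · exact (contDiff_infty_iff_deriv.1 (contDiff_pi.1 hα.1 b)).2
    · funext a
      refine Finset.sum_congr rfl fun b _ => ?_
      rw [← deriv_comp_add_const (fun y => α.1 y b) 1 x]
      simp only [hα.2 _]⟩

/-- A homogeneous formal deformation `P_ε = P_0 + ε P_1 + ε² P_2 + ⋯` of `P_0 = g^{ab} d/dx`:
`P_k` is a skewsymmetric homogeneous operator of degree `k + 1`, and `[P_ε, P_ε] = 0` as a formal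
series in `ε`. -/
structure IsHomogeneousDeformation {n : ℕ} (g : Matrix (Fin n) (Fin n) ℝ)
    (P : ℕ → Loop n → Loop n → Loop n) : Prop where
  zero : P 0 = hydro g
  homogeneous : ∀ k, 1 ≤ k → IsHomogeneousOperator (k + 1) (P k)
  skew : ∀ k, 1 ≤ k → IsSkew (P k)
  jacobi : ∀ l u α β,
    ∑ p ∈ Finset.HasAntidiagonal.antidiagonal l, twoSchouten (P p.1) (P p.2) u α β = 0

/-- A formal series `φ_t = φ_0 + t φ_1 + t² φ_2 + ⋯` of maps `M → M`. -/
abbrev FormalMap (n : ℕ) : Type := ℕ → Loop n → Loop n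

/-- The identity map as a formal series. -/
def FormalMap.ident (n : ℕ) : FormalMap n :=
  fun k u => if k = 0 then u else 0

/-- The coefficient of `t^k` in the Taylor expansion of `t ↦ F(φ_t(u))` at `t = 0`. The terms
`t^j φ_j` with `j > k` do not affect it. -/
def taylorCoeff {n : ℕ} (F : Loop n → Loop n) (φ : FormalMap n) (k : ℕ) (u : Loop n) :
    ℝ → Fin n → ℝ :=
  fun x a => iteratedDeriv k
    (fun t : ℝ => (F (∑ j ∈ Finset.range (k + 1), t ^ j • φ j u)).1 x a) 0 / (k.factorial : ℝ)

/-- `χ = ψ ∘ φ`, that is `χ_t = ψ_t ∘ φ_t` as formal series in `t`. -/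
def IsComposition {n : ℕ} (χ ψ φ : FormalMap n) : Prop :=
  ∀ k u, (χ k u).1 = ∑ p ∈ Finset.HasAntidiagonal.antidiagonal k, taylorCoeff (ψ p.1) φ p.2 u

/-- `φ_t` is the flow `φ^{[X]}_t` of the vector field `X` as a formal series in the time `t`:
`φ_0 = id` and `d/dt φ_t = X ∘ φ_t`. These equations determine `φ`. -/
def IsFormalFlow {n : ℕ} (X : Loop n → Loop n) (φ : FormalMap n) : Prop :=
  (∀ u, φ 0 u = u) ∧ ∀ k u, ((k + 1 : ℕ) : ℝ) • (φ (k + 1) u).1 = taylorCoeff X φ k u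

/-- The formal series in `ε` obtained from `φ_t` by the substitution `t = ε^k`, for `k ≥ 1`. -/
def FormalMap.atPower {n : ℕ} (φ : FormalMap n) (k : ℕ) : FormalMap n :=
  fun m u => if k ∣ m then φ (m / k) u else 0

/-- `φ_ε = lim_k φ^{[X_k]}_{ε^k} ∘ ⋯ ∘ φ^{[X_2]}_{ε^2} ∘ φ^{[X_1]}_ε`, where the `X_k`, `k ≥ 1`,
are vector fields on `M`: `Φ k` is the flow of `X_k`, `Ψ k` is the product of the first `k` flows,
and `φ_ε` agrees with `Ψ k` up to the order `ε^k`. -/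
def IsOrderedProductOfFlows {n : ℕ} (X : ℕ → Loop n → Loop n) (φ : FormalMap n) : Prop :=
  ∃ Φ Ψ : ℕ → FormalMap n,
    (∀ k, 1 ≤ k → IsFormalFlow (X k) (Φ k)) ∧
    Ψ 0 = FormalMap.ident n ∧
    (∀ k, IsComposition (Ψ (k + 1)) ((Φ (k + 1)).atPower (k + 1)) (Ψ k)) ∧
    ∀ m k, m ≤ k → φ m = Ψ k m

/-- `P_ε = (φ_ε)_* (P_0)` as formal series in `ε`, by the transformation law of bivectors
`(P_ε)_{φ_ε(u)} = φ'_{ε,u} ∘ (P_0)_u ∘ φ'_{ε,u}*`. When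
`φ_0 = id`, the series `φ_ε` is formally invertible, and this determines `P_ε`. -/
def IsPushforward {n : ℕ} (φ : FormalMap n) (P₀ : Loop n → Loop n → Loop n)
    (P : ℕ → Loop n → Loop n → Loop n) : Prop :=
  ∀ k u α,
    ∑ p ∈ Finset.HasAntidiagonal.antidiagonal k, taylorCoeff (fun w => P p.1 w α) φ p.2 u =
    ∑ p ∈ Finset.HasAntidiagonal.antidiagonal k,
      frechet (φ p.1) u (P₀ u (adjoint (frechet (φ p.2) u) α))

end HydroPoisson

end

open Filter Topology MeasureTheory

namespace HydroPoisson

/-! ### Calculus with parameters -/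

section Calculus

variable {E F : Type} [NormedAddCommGroup E] [NormedSpace ℝ E] [NormedAddCommGroup F]
  [NormedSpace ℝ F]

/-! The deformation is removed order by order. Suppose that a homogeneous formal map Ψ carries P_0
to P_ε up to order k. The error Q at order k+1 is a skewsymmetric homogeneous operator of degree
k+2, and the Jacobi identities for P_ε and for the push-forward of P_0 force [P_0, Q] = 0
(`isSkew_defect`, `isCocycle_defect`). If Q = X'∘P_0 + P_0∘X'* for a field X of degree k+1, then
composing Ψ with the flow of X at time ε^(k+1) keeps all orders up to k and subtracts exactly Q at
order k+1 (`pushDefect_succ`). Each coefficient is eventually constant in this process, and the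
limit is read off on the diagonal.

The heart is therefore the vanishing of cohomology, `IsCocycle.exists_coboundary`. Put a constant
one-form c into the cocycle condition. Since P_0 kills constants and its image is the space of loops
of mean zero, ⟨Q_u c, c'⟩ does not change when u moves to its mean, where it vanishes by
homogeneity. So Q_u c has mean zero, and Q_u c = P_0 Y(u) with Y a differential polynomial. The
cocycle condition with one constant entry says that Y' is selfadjoint, so Y is the variational
derivative of a functional with density F_c. The densities for the basis covectors are the
components of a field X whose coboundary agrees with Q on constants. After subtracting it, Q kills
constants; being skewsymmetric, it factors as P_0∘S∘P_0 with S skewsymmetric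
(`IsSkew.exists_factor`). The cocycle condition then says that S is a closed local two-form
(`closed_of_isCocycle`), so S = θ' - θ'* by the Poincaré lemma (`IsOp.exists_primitive`), and
P_0∘S∘P_0 is the coboundary of P_0 θ.

Two devices recur. First, testing on the image of P_0 only gives identities among loops of mean
zero. `eq_zero_of_local` removes this restriction: the expression is then a constant loop, and the
arguments can be cut off so that they vanish near the antipode of a given point without changing
near that point. Second, primitives are averages along the rays τu, and these stay inside
homogeneous differential polynomials because the average of a monomial only changes its coefficient
function (`DiffPoly.radialAverage`).

The obstruction is computed with honest maps depending on a real parameter t. A partial sum Ψ_t of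
the formal map gives an operator Ψ_t'∘P_0∘Ψ_t'* that satisfies a transformed Jacobi identity exactly
(`jacobi_transform`). It differs from P_t at Ψ_t(u) by t^N times a smooth remainder, by Hadamard's
lemma. Inserting this, dividing by t^N and letting t tend to 0 leaves the cocycle identity for Q. -/

theorem hasFDerivAt_parametric_integral [FiniteDimensional ℝ E] {f : E × ℝ → F}
    (hf : ContDiff ℝ 1 f) (e : E) :
    HasFDerivAt (fun e => ∫ t in (0 : ℝ)..1, f (e, t))
      (∫ t in (0 : ℝ)..1, (fderiv ℝ f (e, t)).comp (ContinuousLinearMap.inl ℝ E ℝ)) e := by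
  have hc : Continuous fun p : E × ℝ => (fderiv ℝ f p).comp (ContinuousLinearMap.inl ℝ E ℝ) :=
    (hf.continuous_fderiv one_ne_zero).clm_comp continuous_const
  obtain ⟨C, hC⟩ := ((isCompact_closedBall e 1).prod
    (isCompact_Icc (a := (0 : ℝ)) (b := 1))).exists_bound_of_continuousOn hc.continuousOn
  refine intervalIntegral.hasFDerivAt_integral_of_dominated_of_fderiv_le
    (F' := fun e t => (fderiv ℝ f (e, t)).comp (ContinuousLinearMap.inl ℝ E ℝ))
    (bound := fun _ => C)
    (Metric.closedBall_mem_nhds e one_pos) ?_ ?_ ?_ ?_ ?_ ?_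
  · refine Eventually.of_forall fun e' => Continuous.aestronglyMeasurable ?_
    exact hf.continuous.comp (by fun_prop)
  · exact (hf.continuous.comp (by fun_prop : Continuous fun t : ℝ => (e, t))).intervalIntegrable _ _
  · exact (hc.comp (by fun_prop : Continuous fun t : ℝ => (e, t))).aestronglyMeasurable
  · refine Eventually.of_forall fun t ht e' he' => hC (e', t) ⟨he', ?_⟩
    rw [Set.uIoc_of_le zero_le_one] at ht
    exact ⟨ht.1.le, ht.2⟩
  · exact intervalIntegrable_const
  · refine Eventually.of_forall fun t _ e' _ => ?_
    have h1 : HasFDerivAt f (fderiv ℝ f (e', t)) (e', t) :=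
      (hf.differentiable one_ne_zero _).hasFDerivAt
    exact h1.comp e' (hasFDerivAt_prodMk_left e' t)

theorem contDiff_parametric_integral [FiniteDimensional ℝ E] {f : E × ℝ → F}
    (hf : ContDiff ℝ ∞ f) : ContDiff ℝ ∞ fun e => ∫ t in (0 : ℝ)..1, f (e, t) := by
  rw [contDiff_infty]
  intro k
  -- The codomain varies in the induction: the derivative of the integral is again a parametric
  -- integral, with values in `E →L[ℝ] F`.
  induction k generalizing F with
  | zero =>
    refine contDiff_zero.2 (continuous_iff_continuousAt.2 fun e => ?_)
    exact (hasFDerivAt_parametric_integral (hf.of_le (by simp)) e).continuousAt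
  | succ k ih =>
    have hd := hasFDerivAt_parametric_integral (E := E) (hf.of_le (by simp))
    push_cast
    rw [contDiff_succ_iff_fderiv]
    refine ⟨fun e => (hd e).differentiableAt, by simp, ?_⟩
    have : fderiv ℝ (fun e => ∫ t in (0 : ℝ)..1, f (e, t)) =
        fun e => ∫ t in (0 : ℝ)..1, (fderiv ℝ f (e, t)).comp (ContinuousLinearMap.inl ℝ E ℝ) :=
      funext fun e => (hd e).fderiv
    rw [this]
    exact ih (f := fun p => (fderiv ℝ f p).comp (ContinuousLinearMap.inl ℝ E ℝ))
      ((contDiff_infty_iff_fderiv.1 hf).2.clm_comp contDiff_const)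

theorem hasDerivAt_parametric_integral {f : ℝ × ℝ → ℝ} (hf : ContDiff ℝ ∞ f) (s : ℝ) :
    HasDerivAt (fun s => ∫ t in (0 : ℝ)..1, f (s, t))
      (∫ t in (0 : ℝ)..1, deriv (fun s => f (s, t)) s) s := by
  have h := (hasFDerivAt_parametric_integral (E := ℝ) (F := ℝ) (f := f)
    (hf.of_le (by simp)) s).hasDerivAt
  have hi : IntervalIntegrable (fun t => (fderiv ℝ f (s, t)).comp
      (ContinuousLinearMap.inl ℝ ℝ ℝ)) volume 0 1 := by
    have hc : Continuous fun t : ℝ => fderiv ℝ f (s, t) :=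
      (hf.continuous_fderiv (by simp)).comp (by fun_prop)
    exact (hc.clm_comp continuous_const).intervalIntegrable _ _
  rw [ContinuousLinearMap.intervalIntegral_apply hi] at h
  refine h.congr_deriv (intervalIntegral.integral_congr fun t _ => ?_)
  have h1 : HasFDerivAt f (fderiv ℝ f (s, t)) (s, t) :=
    (hf.differentiable (by simp) _).hasFDerivAt
  exact (h1.comp s (hasFDerivAt_prodMk_left s t)).hasDerivAt.deriv.symm

/-- The derivative of a smooth function along a line, as a smooth function of the base point. -/
theorem contDiff_lineDeriv {f : E → F} (hf : ContDiff ℝ ∞ f) (v : E) :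
    ContDiff ℝ ∞ fun e => fderiv ℝ f e v :=
  (contDiff_infty_iff_fderiv.1 hf).2.clm_apply contDiff_const

theorem hasDerivAt_snd {f : E × ℝ → F} (hf : ContDiff ℝ ∞ f) (e : E) (x : ℝ) :
    HasDerivAt (fun y => f (e, y)) (fderiv ℝ f (e, x) (0, 1)) x := by
  have h1 : HasFDerivAt f (fderiv ℝ f (e, x)) (e, x) :=
    (hf.differentiable (by simp) _).hasFDerivAt
  exact (h1.comp x (hasFDerivAt_prodMk_right e x)).hasDerivAt

theorem contDiff_deriv_snd {f : E × ℝ → F} (hf : ContDiff ℝ ∞ f) :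
    ContDiff ℝ ∞ fun p : E × ℝ => deriv (fun y => f (p.1, y)) p.2 := by
  have : (fun p : E × ℝ => deriv (fun y => f (p.1, y)) p.2) =
      fun p => fderiv ℝ f p (0, 1) := funext fun p => (hasDerivAt_snd hf p.1 p.2).deriv
  rw [this]
  exact contDiff_lineDeriv hf _

theorem contDiff_deriv_fst {f : ℝ × E → F} (hf : ContDiff ℝ ∞ f) :
    ContDiff ℝ ∞ fun p : ℝ × E => deriv (fun y => f (y, p.2)) p.1 := by
  have h := contDiff_deriv_snd (f := fun p : E × ℝ => f (p.2, p.1)) (hf.comp (by fun_prop))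
  exact h.comp (f := fun p : ℝ × E => (p.2, p.1)) (by fun_prop)

theorem deriv_deriv_comm {f : ℝ × ℝ → F} (hf : ContDiff ℝ ∞ f) (s x : ℝ) :
    HasDerivAt (fun s => deriv (fun y => f (s, y)) x)
      (deriv (fun y => deriv (fun s => f (s, y)) s) x) s := by
  have h1 : ∀ s x, deriv (fun y => f (s, y)) x = fderiv ℝ f (s, x) (0, 1) := fun s x =>
    (hasDerivAt_snd hf s x).deriv
  have hf' : ContDiff ℝ ∞ fun p : ℝ × ℝ => f (p.2, p.1) := hf.comp (by fun_prop)
  have h2 : ∀ s x, deriv (fun s => f (s, x)) s = fderiv ℝ f (s, x) (1, 0) := fun s x => by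
    have h1 : HasFDerivAt f (fderiv ℝ f (s, x)) (s, x) :=
      (hf.differentiable (by simp) _).hasFDerivAt
    exact (h1.comp s (hasFDerivAt_prodMk_left s x)).hasDerivAt.deriv
  simp only [h1, h2]
  have hF : HasFDerivAt (fderiv ℝ f) (fderiv ℝ (fderiv ℝ f) (s, x)) (s, x) :=
    ((contDiff_infty_iff_fderiv.1 hf).2.differentiable (by simp) _).hasFDerivAt
  have h3 : HasDerivAt (fun s => fderiv ℝ f (s, x) (0, 1))
      (fderiv ℝ (fderiv ℝ f) (s, x) (1, 0) (0, 1)) s :=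
    (((hF.comp s (hasFDerivAt_prodMk_left s x)).clm_apply
      (hasFDerivAt_const (0, 1) s)).hasDerivAt).congr_deriv (by simp)
  have h4 : HasDerivAt (fun x => fderiv ℝ f (s, x) (1, 0))
      (fderiv ℝ (fderiv ℝ f) (s, x) (0, 1) (1, 0)) x :=
    (((hF.comp x (hasFDerivAt_prodMk_right s x)).clm_apply
      (hasFDerivAt_const (1, 0) x)).hasDerivAt).congr_deriv (by simp)
  rw [h4.deriv]
  convert h3 using 1
  exact (hf.contDiffAt.isSymmSndFDerivAt (by
    rw [minSmoothness_of_isRCLikeNormedField]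
    exact WithTop.coe_le_coe.2 le_top)) _ _

end Calculus

/-! ### Jets of loops -/

section Jets

variable {n : ℕ}

/-- Smooth `1`-periodic real functions. -/
def SmoothPeriodic (f : ℝ → ℝ) : Prop := ContDiff ℝ ∞ f ∧ Function.Periodic f 1

namespace SmoothPeriodic

variable {f g : ℝ → ℝ}

theorem const (c : ℝ) : SmoothPeriodic fun _ => c := ⟨contDiff_const, fun _ => rfl⟩

theorem add (hf : SmoothPeriodic f) (hg : SmoothPeriodic g) : SmoothPeriodic fun x => f x + g x :=
  ⟨hf.1.add hg.1, hf.2.add hg.2⟩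

theorem mul (hf : SmoothPeriodic f) (hg : SmoothPeriodic g) : SmoothPeriodic fun x => f x * g x :=
  ⟨hf.1.mul hg.1, hf.2.mul hg.2⟩

theorem sum {ι : Type*} {s : Finset ι} {F : ι → ℝ → ℝ} (h : ∀ i ∈ s, SmoothPeriodic (F i)) :
    SmoothPeriodic fun x => ∑ i ∈ s, F i x :=
  ⟨ContDiff.sum fun i hi => (h i hi).1, fun x => Finset.sum_congr rfl fun i hi => (h i hi).2 x⟩

theorem deriv (hf : SmoothPeriodic f) : SmoothPeriodic (deriv f) := by
  refine ⟨(contDiff_infty_iff_deriv.1 hf.1).2, fun x => ?_⟩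
  rw [← deriv_comp_add_const f 1 x]
  simp only [hf.2 _]

theorem iteratedDeriv (hf : SmoothPeriodic f) (i : ℕ) : SmoothPeriodic (iteratedDeriv i f) := by
  induction i with
  | zero => simpa using hf
  | succ i ih => rw [iteratedDeriv_succ]; exact ih.deriv

theorem continuous (hf : SmoothPeriodic f) : Continuous f := hf.1.continuous

theorem differentiable (hf : SmoothPeriodic f) : Differentiable ℝ f :=
  hf.1.differentiable (by simp)

theorem hasDerivAt (hf : SmoothPeriodic f) (x : ℝ) : HasDerivAt f (_root_.deriv f x) x :=
  (hf.differentiable x).hasDerivAt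

end SmoothPeriodic

theorem mem_loop_iff {u : ℝ → Fin n → ℝ} :
    u ∈ Loop n ↔ ∀ a, SmoothPeriodic fun x => u x a := by
  constructor
  · rintro ⟨h1, h2⟩ a
    exact ⟨contDiff_pi.1 h1 a, fun x => congrFun (h2 x) a⟩
  · intro h
    exact ⟨contDiff_pi.2 fun a => (h a).1, fun x => funext fun a => (h a).2 x⟩

theorem Loop.smoothPeriodic (u : Loop n) (a : Fin n) : SmoothPeriodic fun x => u.1 x a :=
  mem_loop_iff.1 u.2 a

theorem Loop.ext_apply {u v : Loop n} (h : ∀ x a, u.1 x a = v.1 x a) : u = v :=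
  Subtype.ext (funext fun x => funext fun a => h x a)

@[simp] theorem Loop.add_apply (u v : Loop n) (x : ℝ) (a : Fin n) :
    (u + v).1 x a = u.1 x a + v.1 x a := rfl

@[simp] theorem Loop.sub_apply (u v : Loop n) (x : ℝ) (a : Fin n) :
    (u - v).1 x a = u.1 x a - v.1 x a := rfl

@[simp] theorem Loop.neg_apply (u : Loop n) (x : ℝ) (a : Fin n) :
    (-u).1 x a = -u.1 x a := rfl

@[simp] theorem Loop.smul_apply (c : ℝ) (u : Loop n) (x : ℝ) (a : Fin n) :
    (c • u).1 x a = c * u.1 x a := rfl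

@[simp] theorem Loop.zero_apply (x : ℝ) (a : Fin n) : (0 : Loop n).1 x a = 0 := rfl

@[simp] theorem Loop.sum_apply {ι : Type*} (s : Finset ι) (U : ι → Loop n) (x : ℝ) (a : Fin n) :
    (∑ i ∈ s, U i).1 x a = ∑ i ∈ s, (U i).1 x a := by
  rw [Submodule.coe_sum, Finset.sum_apply, Finset.sum_apply]

theorem jet_zero (u : Loop n) (x : ℝ) (a : Fin n) : jet u x 0 a = u.1 x a := by
  simp [jet]

theorem smoothPeriodic_jet (u : Loop n) (i : ℕ) (a : Fin n) :
    SmoothPeriodic fun x => jet u x i a := (Loop.smoothPeriodic u a).iteratedDeriv i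

theorem deriv_jet (u : Loop n) (x : ℝ) (i : ℕ) (a : Fin n) :
    deriv (fun y => jet u y i a) x = jet u x (i + 1) a := by
  simp only [jet, iteratedDeriv_succ]

theorem hasDerivAt_jet (u : Loop n) (x : ℝ) (i : ℕ) (a : Fin n) :
    HasDerivAt (fun y => jet u y i a) (jet u x (i + 1) a) x := by
  rw [← deriv_jet]
  exact (smoothPeriodic_jet u i a).hasDerivAt x

@[simp] theorem jet_add (u v : Loop n) (x : ℝ) (i : ℕ) (a : Fin n) :
    jet (u + v) x i a = jet u x i a + jet v x i a :=
  iteratedDeriv_add ((Loop.smoothPeriodic u a).1.of_le (mod_cast le_top)).contDiffAt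
    ((Loop.smoothPeriodic v a).1.of_le (mod_cast le_top)).contDiffAt

@[simp] theorem jet_smul (c : ℝ) (u : Loop n) (x : ℝ) (i : ℕ) (a : Fin n) :
    jet (c • u) x i a = c * jet u x i a :=
  iteratedDeriv_const_mul c ((Loop.smoothPeriodic u a).1.of_le (mod_cast le_top)).contDiffAt

/-- The jets of loops as linear maps. -/
noncomputable def jetLinear (n : ℕ) (x : ℝ) : Loop n →ₗ[ℝ] Jet n where
  toFun u := jet u x
  map_add' u v := by ext i a; simp
  map_smul' c u := by ext i a; simp

@[simp] theorem jet_zero_loop (x : ℝ) (i : ℕ) (a : Fin n) : jet (0 : Loop n) x i a = 0 :=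
  congrFun (congrFun (map_zero (jetLinear n x)) i) a

@[simp] theorem jet_sum {ι : Type*} (s : Finset ι) (U : ι → Loop n) (x : ℝ) (i : ℕ) (a : Fin n) :
    jet (∑ j ∈ s, U j) x i a = ∑ j ∈ s, jet (U j) x i a := by
  have := congrFun (congrFun (map_sum (jetLinear n x) U s) i) a
  rw [Finset.sum_apply, Finset.sum_apply] at this
  exact this

theorem jet_congr {u v : Loop n} {x : ℝ} (h : u.1 =ᶠ[𝓝 x] v.1) : jet u x = jet v x := by
  funext i a
  exact Filter.EventuallyEq.iteratedDeriv_eq i (h.mono fun y hy => congrFun hy a)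

theorem eventually_jet_congr {u v : Loop n} {x : ℝ} (h : u.1 =ᶠ[𝓝 x] v.1) :
    ∀ᶠ y in 𝓝 x, jet u y = jet v y :=
  (eventually_eventually_nhds.2 h).mono fun _ hy => jet_congr hy

/-- Smooth families of loops, parametrized by `E`. -/
def SmoothFamily {E : Type} [NormedAddCommGroup E] [NormedSpace ℝ E] (U : E → Loop n) : Prop :=
  ∀ a, ContDiff ℝ ∞ fun p : E × ℝ => (U p.1).1 p.2 a

section Family

variable {E E' : Type} [NormedAddCommGroup E] [NormedSpace ℝ E] [NormedAddCommGroup E']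
  [NormedSpace ℝ E']

theorem SmoothFamily.contDiff_jet {U : E → Loop n} (hU : SmoothFamily U) (i : ℕ) (a : Fin n) :
    ContDiff ℝ ∞ fun p : E × ℝ => jet (U p.1) p.2 i a := by
  induction i with
  | zero => simpa only [jet_zero] using hU a
  | succ i ih =>
    simp only [← deriv_jet]
    exact contDiff_deriv_snd ih

theorem SmoothFamily.const (u : Loop n) : SmoothFamily fun _ : E => u := fun a =>
  (Loop.smoothPeriodic u a).1.comp contDiff_snd

theorem SmoothFamily.add {U V : E → Loop n} (hU : SmoothFamily U) (hV : SmoothFamily V) :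
    SmoothFamily fun e => U e + V e := fun a => (hU a).add (hV a)

theorem SmoothFamily.sub {U V : E → Loop n} (hU : SmoothFamily U) (hV : SmoothFamily V) :
    SmoothFamily fun e => U e - V e := fun a => (hU a).sub (hV a)

theorem SmoothFamily.smul {c : E → ℝ} {U : E → Loop n} (hc : ContDiff ℝ ∞ c)
    (hU : SmoothFamily U) : SmoothFamily fun e => c e • U e := fun a =>
  (hc.comp contDiff_fst).mul (hU a)

theorem SmoothFamily.sum {ι : Type*} {s : Finset ι} {U : ι → E → Loop n}
    (hU : ∀ i ∈ s, SmoothFamily (U i)) : SmoothFamily fun e => ∑ i ∈ s, U i e := fun a => by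
  simp only [Loop.sum_apply]
  exact ContDiff.sum fun i hi => hU i hi a

theorem SmoothFamily.comp {U : E → Loop n} (hU : SmoothFamily U) {g : E' → E}
    (hg : ContDiff ℝ ∞ g) : SmoothFamily fun e => U (g e) := fun a =>
  (hU a).comp (f := fun p : E' × ℝ => (g p.1, p.2)) (by fun_prop)

theorem SmoothFamily.line (u v : Loop n) : SmoothFamily fun s : ℝ => u + s • v :=
  (SmoothFamily.const u).add (.smul contDiff_id (.const v))

theorem SmoothFamily.hasDerivAt_aux {U : ℝ → Loop n} (hU : SmoothFamily U) (s x : ℝ)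
    (a : Fin n) : HasDerivAt (fun s => (U s).1 x a) (deriv (fun s => (U s).1 x a) s) s := by
  refine DifferentiableAt.hasDerivAt ?_
  have h : ContDiff ℝ ∞ fun s => (U s).1 x a :=
    (hU a).comp (f := fun s : ℝ => (s, x)) (by fun_prop)
  exact h.differentiable (by simp) s

/-- The derivative of a smooth family of loops. -/
noncomputable def velocity (U : ℝ → Loop n) (hU : SmoothFamily U) (s : ℝ) : Loop n :=
  ⟨fun x a => deriv (fun s => (U s).1 x a) s, mem_loop_iff.2 fun a => by
    refine ⟨?_, fun x => ?_⟩
    · exact (contDiff_deriv_fst (hU a)).comp (f := fun x : ℝ => (s, x)) (by fun_prop)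
    · exact congrArg (deriv · s) (funext fun s => (Loop.smoothPeriodic (U s) a).2 x)⟩

theorem SmoothFamily.hasDerivAt {U : ℝ → Loop n} (hU : SmoothFamily U) (s x : ℝ) (a : Fin n) :
    HasDerivAt (fun s => (U s).1 x a) ((velocity U hU s).1 x a) s := hU.hasDerivAt_aux s x a

theorem velocity_eq {U : ℝ → Loop n} (hU : SmoothFamily U) {s : ℝ} {v : Loop n}
    (h : ∀ x a, HasDerivAt (fun s => (U s).1 x a) (v.1 x a) s) : velocity U hU s = v :=
  Loop.ext_apply fun x a => (h x a).deriv

theorem velocity_line (u v : Loop n) (s : ℝ) : velocity _ (SmoothFamily.line u v) s = v := by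
  refine velocity_eq _ fun x a => ?_
  have := ((hasDerivAt_id s).mul_const (v.1 x a)).const_add (u.1 x a)
  simpa using this

/-- Mixed partial derivatives commute, so the parameter derivative passes through all x-derivatives.
-/
theorem SmoothFamily.hasDerivAt_jet {U : ℝ → Loop n} (hU : SmoothFamily U) (s x : ℝ) (i : ℕ)
    (a : Fin n) : HasDerivAt (fun s => jet (U s) x i a) (jet (velocity U hU s) x i a) s := by
  induction i generalizing s x with
  | zero => simpa only [jet_zero] using hU.hasDerivAt s x a
  | succ i ih =>
    have h := deriv_deriv_comm (hU.contDiff_jet i a) s x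
    simp only [deriv_jet] at h
    refine h.congr_deriv ?_
    rw [← deriv_jet]
    congr 1
    exact funext fun y => (ih s y).deriv

/-- Differentiation along a parameter of a smooth family that depends on further parameters. -/
theorem SmoothFamily.velocity_param {U : E → ℝ → Loop n}
    (hU : SmoothFamily fun p : E × ℝ => U p.1 p.2) (s : ℝ) (hU' : ∀ e, SmoothFamily (U e)) :
    SmoothFamily fun e => velocity (U e) (hU' e) s := fun a => by
  have h : ContDiff ℝ ∞ fun p : (E × ℝ) × ℝ => (U p.1.1 p.2).1 p.1.2 a :=
    (hU a).comp (f := fun p : (E × ℝ) × ℝ => ((p.1.1, p.2), p.1.2)) (by fun_prop)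
  exact (contDiff_deriv_snd h).comp (f := fun p : E × ℝ => (p, s)) (by fun_prop)

end Family

end Jets

/-! ### Differential polynomials -/

/-- Differential polynomials of degree `d`, where `u^a_i` has degree `w * i`. For `w = 1` these are
the homogeneous differential polynomials; for `w = 0` every differential polynomial has degree
`0`. -/
inductive DiffPoly {n : ℕ} (w : ℤ) : ℤ → (Jet n → ℝ) → Prop
  | zero (d : ℤ) : DiffPoly w d fun _ => 0
  | coeff (f : (Fin n → ℝ) → ℝ) (hf : ContDiff ℝ ∞ f) : DiffPoly w 0 fun z => f (z 0)
  | var (i : ℕ) (a : Fin n) : DiffPoly w (w * i) fun z => z i a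
  | add {d : ℤ} {F G : Jet n → ℝ} (hF : DiffPoly w d F) (hG : DiffPoly w d G) :
      DiffPoly w d fun z => F z + G z
  | mul {d e : ℤ} {F G : Jet n → ℝ} (hF : DiffPoly w d F) (hG : DiffPoly w e G) :
      DiffPoly w (d + e) fun z => F z * G z

namespace DiffPoly

variable {n : ℕ} {w d e : ℤ} {F G : Jet n → ℝ}

theorem cast (h : DiffPoly w d F) (hd : d = e) : DiffPoly w e F := hd ▸ h

theorem congr (h : DiffPoly w d F) (hd : F = G) : DiffPoly w d G := hd ▸ h

theorem mul' {k : ℤ} (hF : DiffPoly w d F) (hG : DiffPoly w e G) (h : d + e = k) :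
    DiffPoly w k fun z => F z * G z := (hF.mul hG).cast h

theorem const (c : ℝ) : DiffPoly w 0 fun _ : Jet n => c := coeff (fun _ => c) contDiff_const

theorem const_mul (c : ℝ) (h : DiffPoly w d F) : DiffPoly w d fun z => c * F z :=
  (const c).mul' h (zero_add d)

theorem neg (h : DiffPoly w d F) : DiffPoly w d fun z => -F z := by
  simpa using h.const_mul (-1)

theorem sum {ι : Type*} {s : Finset ι} {F : ι → Jet n → ℝ} (h : ∀ i ∈ s, DiffPoly w d (F i)) :
    DiffPoly w d fun z => ∑ i ∈ s, F i z := by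
  classical
  induction s using Finset.induction_on with
  | empty => simpa using zero d
  | insert i s hi ih =>
    simp only [Finset.sum_insert hi]
    exact (h i (by simp)).add (ih fun j hj => h j (by simp [hj]))

theorem pow (h : DiffPoly w d F) (k : ℕ) : DiffPoly w (k * d) fun z => F z ^ k := by
  induction k with
  | zero => simpa using const 1
  | succ k ih =>
    simp only [pow_succ]
    exact ih.mul' h (by push_cast; ring)

/-- Forgets the grading. Partial sums in powers of t mix degrees, so they are handled with weight 0.
-/
theorem zero_weight (h : DiffPoly w d F) : DiffPoly 0 0 F := by
  induction h with
  | zero => exact zero 0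
  | coeff f hf => exact coeff f hf
  | var i a => simpa using var (w := 0) i a
  | add _ _ hF hG => exact hF.add hG
  | mul _ _ hF hG => simpa using hF.mul hG

theorem contDiff_comp {E : Type} [NormedAddCommGroup E] [NormedSpace ℝ E] (h : DiffPoly w d F)
    {z : E → Jet n} (hz : ∀ i a, ContDiff ℝ ∞ fun e => z e i a) :
    ContDiff ℝ ∞ fun e => F (z e) := by
  induction h with
  | zero => exact contDiff_const
  | coeff f hf => exact hf.comp (contDiff_pi.2 fun a => hz 0 a)
  | var i a => exact hz i a
  | add _ _ hF hG => exact hF.add hG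
  | mul _ _ hF hG => exact hF.mul hG

/-- Degrees are integers so that the partial derivative by a variable of degree i may lower them by
i unconditionally; nothing is lost, as negative degrees are empty. -/
theorem eq_zero_of_neg (h : DiffPoly 1 d F) (hd : d < 0) : F = fun _ => 0 := by
  induction h with
  | zero => rfl
  | coeff f hf => exact absurd hd (lt_irrefl 0)
  | var i a => omega
  | add _ _ hF hG => simp [hF hd, hG hd]
  | @mul d e F G _ _ hF hG =>
    rcases lt_or_ge d 0 with h | h
    · simp [hF h]
    · simp [hG (by omega)]

/-- A monomial of positive degree contains some derivative of positive order. This is how positivity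
of the degree enters the cohomology computation. -/
theorem eq_zero_of_const (h : DiffPoly 1 d F) (hd : 1 ≤ d) {z : Jet n}
    (hz : ∀ i a, 1 ≤ i → z i a = 0) : F z = 0 := by
  induction h with
  | zero => rfl
  | coeff f hf => omega
  | var i a => exact hz i a (by omega)
  | add _ _ hF hG => simp [hF hd, hG hd]
  | @mul d e F G _ _ hF hG =>
    rcases lt_or_ge d 1 with h | h
    · simp [hG (by omega)]
    · simp [hF h]

/-- `p i a` is the partial derivative of `F` with respect to `z i a`. -/
structure IsGrad (w d : ℤ) (F : Jet n → ℝ) (N : ℕ) (p : ℕ → Fin n → Jet n → ℝ) : Prop where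
  diffPoly : ∀ (i : ℕ) (a : Fin n), DiffPoly w (d - w * i) (p i a)
  eq_zero : ∀ i a z, N ≤ i → p i a z = 0
  hasDerivAt : ∀ (z : ℝ → Jet n) (z' : Jet n) (s : ℝ),
    (∀ i a, HasDerivAt (fun t => z t i a) (z' i a) s) →
    HasDerivAt (fun t => F (z t)) (∑ i ∈ Finset.range N, ∑ a, p i a (z s) * z' i a) s

theorem IsGrad.mono {N M : ℕ} {p : ℕ → Fin n → Jet n → ℝ} (h : IsGrad w d F N p) (hM : N ≤ M) :
    IsGrad w d F M p where
  diffPoly := h.diffPoly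
  eq_zero i a z hi := h.eq_zero i a z (hM.trans hi)
  hasDerivAt z z' s hz := by
    convert h.hasDerivAt z z' s hz using 1
    refine (Finset.sum_subset (Finset.range_mono hM) fun i _ hi => ?_).symm
    exact Finset.sum_eq_zero fun a _ => by
      rw [h.eq_zero i a _ (by simpa using hi), zero_mul]

/-- The jet space carries no norm, so differentiability is expressed as the chain rule along
coordinatewise differentiable curves. Only finitely many coordinates occur, and the product rule
gives the induction. -/
theorem exists_isGrad (h : DiffPoly w d F) : ∃ N p, IsGrad w d F N p := by
  induction h with
  | zero d =>
    exact ⟨0, fun _ _ _ => 0, fun _ _ => zero _, fun _ _ _ _ => rfl, fun z z' s hz => by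
      simpa using hasDerivAt_const s (0 : ℝ)⟩
  | coeff f hf =>
    classical
    refine ⟨1, fun i a z => if i = 0 then fderiv ℝ f (z 0) (Pi.single a 1) else 0,
      fun i a => ?_, fun i a z hi => if_neg (by omega), fun z z' s hz => ?_⟩
    · by_cases hi : i = 0
      · refine ((coeff (fun y => fderiv ℝ f y (Pi.single a 1)) ?_).cast (by simp [hi])).congr
          (by simp [hi])
        exact contDiff_lineDeriv hf _
      · exact (zero _).congr (by simp [hi])
    · have h0 : HasDerivAt (fun t => z t 0) (z' 0) s := hasDerivAt_pi.2 fun a => hz 0 a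
      have h1 := ((hf.differentiable (by simp) (z s 0)).hasFDerivAt).comp_hasDerivAt s h0
      refine h1.congr_deriv ?_
      rw [Finset.sum_range_one]
      simp only [if_true]
      conv_lhs => rw [pi_eq_sum_univ' (z' 0), map_sum]
      refine Finset.sum_congr rfl fun a _ => ?_
      rw [map_smul, smul_eq_mul, mul_comm]
  | var i a =>
    classical
    refine ⟨i + 1, fun j b _ => if j = i ∧ b = a then 1 else 0, fun j b => ?_, fun j b z hj =>
      if_neg (by omega), fun z z' s hz => ?_⟩
    · by_cases hj : j = i ∧ b = a
      · exact ((const 1).cast (by simp [hj])).congr (by simp [hj])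
      · exact (zero _).congr (by simp [hj])
    · refine (hz i a).congr_deriv ?_
      rw [Finset.sum_eq_single i, Finset.sum_eq_single a] <;> simp +contextual
  | @add d F G _ _ hF hG =>
    obtain ⟨N, p, hp⟩ := hF
    obtain ⟨M, q, hq⟩ := hG
    replace hp := hp.mono (le_max_left N M)
    replace hq := hq.mono (le_max_right N M)
    refine ⟨max N M, fun i a z => p i a z + q i a z, fun i a => (hp.diffPoly i a).add
      (hq.diffPoly i a), fun i a z hi => by rw [hp.eq_zero i a z hi, hq.eq_zero i a z hi, add_zero],
      fun z z' s hz => ?_⟩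
    refine ((hp.hasDerivAt z z' s hz).add (hq.hasDerivAt z z' s hz)).congr_deriv ?_
    simp only [add_mul, Finset.sum_add_distrib]
  | @mul d e F G hF' hG' hF hG =>
    obtain ⟨N, p, hp⟩ := hF
    obtain ⟨M, q, hq⟩ := hG
    replace hp := hp.mono (le_max_left N M)
    replace hq := hq.mono (le_max_right N M)
    refine ⟨max N M, fun i a z => p i a z * G z + F z * q i a z, fun i a => ?_, fun i a z hi => by
      rw [hp.eq_zero i a z hi, hq.eq_zero i a z hi]; simp, fun z z' s hz => ?_⟩
    · exact ((hp.diffPoly i a).mul' hG' (by ring)).add (hF'.mul' (hq.diffPoly i a) (by ring))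
    · refine ((hp.hasDerivAt z z' s hz).mul (hq.hasDerivAt z z' s hz)).congr_deriv ?_
      simp only [add_mul, Finset.sum_add_distrib, Finset.sum_mul, Finset.mul_sum]
      congr 1 <;> exact Finset.sum_congr rfl fun i _ => Finset.sum_congr rfl fun a _ => by ring

theorem smooth_family {E : Type} [NormedAddCommGroup E] [NormedSpace ℝ E] (h : DiffPoly w d F)
    {U : E → Loop n} (hU : SmoothFamily U) :
    ContDiff ℝ ∞ fun p : E × ℝ => F (jet (U p.1) p.2) :=
  h.contDiff_comp fun i a => hU.contDiff_jet i a

theorem smoothPeriodic (h : DiffPoly w d F) (u : Loop n) :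
    SmoothPeriodic fun x => F (jet u x) := by
  refine ⟨h.contDiff_comp fun i a => (smoothPeriodic_jet u i a).1, fun x => ?_⟩
  simp only
  congr 1
  exact funext fun i => funext fun a => (smoothPeriodic_jet u i a).2 x

theorem exists_totalDeriv (h : DiffPoly w d F) : ∃ G, DiffPoly w (d + w) G ∧
    ∀ u x, deriv (fun y => F (jet u y)) x = G (jet u x) := by
  obtain ⟨N, p, hp⟩ := h.exists_isGrad
  refine ⟨fun z => ∑ i ∈ Finset.range N, ∑ a, p i a z * z (i + 1) a, ?_, fun u x => ?_⟩
  · exact sum fun i _ => sum fun a _ => (hp.diffPoly i a).mul' (var _ _) (by push_cast; ring)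
  · exact (hp.hasDerivAt (fun y => jet u y) (fun i a => jet u x (i + 1) a) x
      fun i a => hasDerivAt_jet u x i a).deriv

theorem exists_iteratedDeriv (h : DiffPoly w d F) (m : ℕ) : ∃ G, DiffPoly w (d + w * m) G ∧
    ∀ u x, iteratedDeriv m (fun y => F (jet u y)) x = G (jet u x) := by
  induction m with
  | zero => exact ⟨F, h.cast (by simp), fun u x => by simp⟩
  | succ m ih =>
    obtain ⟨G, hG, hG'⟩ := ih
    obtain ⟨H, hH, hH'⟩ := hG.exists_totalDeriv
    refine ⟨H, hH.cast (by push_cast; ring), fun u x => ?_⟩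
    rw [iteratedDeriv_succ, ← hH']
    exact congrArg (deriv · x) (funext fun y => hG' u y)

end DiffPoly

section HomDiffPoly

variable {n d e : ℕ} {F G : Jet n → ℝ}

theorem homDiffPoly_coeff_mem (f : (Fin n → ℝ) → ℝ) (hf : ContDiff ℝ ∞ f) :
    (fun z : Jet n => f (z 0)) ∈ homDiffPoly n 0 :=
  Submodule.subset_span ⟨f, 0, hf, by simp, by simp⟩

theorem homDiffPoly_var_mem (i : ℕ) (a : Fin n) :
    (fun z : Jet n => z i a) ∈ homDiffPoly n i := by
  cases i with
  | zero => exact homDiffPoly_coeff_mem (fun y => y a) (contDiff_apply ℝ ℝ a)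
  | succ i =>
    refine Submodule.subset_span ⟨fun _ => 1, Finsupp.single (a, i) 1, contDiff_const, ?_, ?_⟩
    · simp
    · simp

theorem homDiffPoly_mul_mem (hF : F ∈ homDiffPoly n d) (hG : G ∈ homDiffPoly n e) :
    F * G ∈ homDiffPoly n (d + e) := by
  induction hF using Submodule.span_induction with
  | zero => simp
  | add F₁ F₂ _ _ h₁ h₂ => rw [add_mul]; exact add_mem h₁ h₂
  | smul c F _ h => rw [smul_mul_assoc]; exact Submodule.smul_mem _ _ h
  | mem F hF =>
    obtain ⟨f, c, hf, hc, rfl⟩ := hF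
    induction hG using Submodule.span_induction with
    | zero => simp
    | add F₁ F₂ _ _ h₁ h₂ => rw [mul_add]; exact add_mem h₁ h₂
    | smul c F _ h => rw [mul_smul_comm]; exact Submodule.smul_mem _ _ h
    | mem G hG =>
      obtain ⟨g, c', hg, hc', rfl⟩ := hG
      refine Submodule.subset_span ⟨fun y => f y * g y, c + c', hf.mul hg, ?_, ?_⟩
      · rw [Finsupp.sum_add_index' (by simp) (by intros; ring), hc, hc']
      · funext z
        rw [Finsupp.prod_add_index' (by simp) (by intros; ring)]
        simp only [Pi.mul_apply]
        ring

theorem DiffPoly.mem_homDiffPoly {k : ℤ} (h : DiffPoly 1 k F) (hk : k = d) :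
    F ∈ homDiffPoly n d := by
  induction h generalizing d with
  | zero => exact zero_mem _
  | coeff f hf =>
    obtain rfl : d = 0 := by omega
    exact homDiffPoly_coeff_mem f hf
  | var i a =>
    obtain rfl : d = i := by omega
    exact homDiffPoly_var_mem d a
  | add _ _ hF hG => exact add_mem (hF hk) (hG hk)
  | @mul p q F G hF' hG' hF hG =>
    -- A factor of negative degree vanishes, so both degrees may be taken to be natural numbers.
    rcases lt_or_ge p 0 with h | h
    · simp only [hF'.eq_zero_of_neg h, zero_mul]; exact zero_mem _
    rcases lt_or_ge q 0 with h' | h'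
    · simp only [hG'.eq_zero_of_neg h', mul_zero]; exact zero_mem _
    obtain ⟨p, rfl⟩ := Int.eq_ofNat_of_zero_le h
    obtain ⟨q, rfl⟩ := Int.eq_ofNat_of_zero_le h'
    obtain rfl : d = p + q := by omega
    exact homDiffPoly_mul_mem (hF rfl) (hG rfl)

theorem DiffPoly.monomial (c : Fin n × ℕ →₀ ℕ) :
    DiffPoly 1 ((c.sum fun p e => e * (p.2 + 1) : ℕ) : ℤ)
      fun z : Jet n => c.prod fun p e => z (p.2 + 1) p.1 ^ e := by
  induction c using Finsupp.induction_linear with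
  | zero => simpa using DiffPoly.const 1
  | add f g hf hg =>
    rw [Finsupp.sum_add_index' (by simp) (by intros; ring)]
    refine (hf.mul' hg (by push_cast; ring)).congr ?_
    funext z
    rw [Finsupp.prod_add_index' (by simp) (by intros; ring)]
  | single p e =>
    simp only [Finsupp.sum_single_index, Finsupp.prod_single_index, zero_mul, pow_zero]
    exact ((DiffPoly.var _ _).pow e).cast (by push_cast; ring)

theorem diffPoly_of_mem_homDiffPoly (h : F ∈ homDiffPoly n d) : DiffPoly 1 d F := by
  induction h using Submodule.span_induction with
  | zero => exact .zero _
  | add F₁ F₂ _ _ h₁ h₂ => exact h₁.add h₂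
  | smul c F _ h => exact h.const_mul c
  | mem F hF =>
    obtain ⟨f, c, hf, rfl, rfl⟩ := hF
    exact (DiffPoly.coeff f hf).mul' (.monomial c) (by simp)

end HomDiffPoly

/-- Radial averages `∫₀¹ τ^m F(τ z) dτ` of a differential polynomial. -/
theorem DiffPoly.radialAverage {n : ℕ} {d : ℤ} {F : Jet n → ℝ} (h : DiffPoly 1 d F)
    (m : ℕ) : DiffPoly 1 d fun z => ∫ τ in (0 : ℝ)..1, τ ^ m * F (τ • z) := by
  rcases lt_or_ge d 0 with hd | hd
  · simpa [h.eq_zero_of_neg hd] using DiffPoly.zero d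
  obtain ⟨d, rfl⟩ := Int.eq_ofNat_of_zero_le hd
  replace h := h.mem_homDiffPoly rfl
  have hint : ∀ F ∈ homDiffPoly n d, ∀ z,
      IntervalIntegrable (fun τ : ℝ => τ ^ m * F (τ • z)) volume 0 1 := fun F hF z => by
    have : ContDiff ℝ ∞ fun τ : ℝ => F (τ • z) :=
      (diffPoly_of_mem_homDiffPoly hF).contDiff_comp fun i a => by
        simp only [Pi.smul_apply, smul_eq_mul]; fun_prop
    exact ((continuous_pow m).mul this.continuous).intervalIntegrable _ _
  induction h using Submodule.span_induction with
  | zero => simpa using DiffPoly.zero _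
  | add F₁ F₂ m₁ m₂ h₁ h₂ =>
    refine (h₁.add h₂).congr (funext fun z => ?_)
    rw [← intervalIntegral.integral_add (hint F₁ m₁ z) (hint F₂ m₂ z)]
    simp [mul_add]
  | smul c F m' h =>
    refine (h.const_mul c).congr (funext fun z => ?_)
    rw [← intervalIntegral.integral_const_mul]
    simp only [Pi.smul_apply, smul_eq_mul]
    congr 1; funext τ; ring
  | mem F hF =>
    obtain ⟨f, c, hf, rfl, rfl⟩ := hF
    -- The number of factors in the monomial: scaling the jet by τ pulls out τ^N, and the integral
    -- falls on the coefficient function alone.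
    let N := c.sum fun _ e => e
    have hf' : ContDiff ℝ ∞ fun y : Fin n → ℝ => ∫ τ in (0 : ℝ)..1, τ ^ (m + N) * f (τ • y) :=
      contDiff_parametric_integral (E := Fin n → ℝ)
        (f := fun p : (Fin n → ℝ) × ℝ => p.2 ^ (m + N) * f (p.2 • p.1))
        ((contDiff_snd.pow _).mul (hf.comp (contDiff_snd.smul contDiff_fst)))
    refine ((DiffPoly.coeff _ hf').mul' (.monomial c) (by simp)).congr (funext fun z => ?_)
    rw [← intervalIntegral.integral_mul_const]
    congr 1
    funext τ
    have : (c.prod fun p e => (τ • z) (p.2 + 1) p.1 ^ e) =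
        τ ^ N * c.prod fun p e => z (p.2 + 1) p.1 ^ e := by
      simp only [Pi.smul_apply, smul_eq_mul, mul_pow, N, Finsupp.prod, Finsupp.sum,
        Finset.prod_mul_distrib, Finset.prod_pow_eq_pow_sum]
    change _ = τ ^ m * (f ((τ • z) 0) * c.prod fun p e => (τ • z) (p.2 + 1) p.1 ^ e)
    rw [this, Pi.smul_apply, pow_add]
    ring

/-! ### The pairing of loops -/

section Pairing

variable {n : ℕ}

theorem SmoothPeriodic.intervalIntegrable {f : ℝ → ℝ} (hf : SmoothPeriodic f) (a b : ℝ) :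
    IntervalIntegrable f volume a b := hf.continuous.intervalIntegrable _ _

theorem smoothPeriodic_pairing (u v : Loop n) : SmoothPeriodic fun x => ∑ a, u.1 x a * v.1 x a :=
  .sum fun a _ => (Loop.smoothPeriodic u a).mul (Loop.smoothPeriodic v a)

/-- The pairing as a bilinear form on loops. -/
noncomputable def loopPairing : Loop n →ₗ[ℝ] Loop n →ₗ[ℝ] ℝ :=
  LinearMap.mk₂ ℝ (fun u v => pairing u.1 v.1)
    (fun u u' v => by
      simp only [pairing]
      rw [← intervalIntegral.integral_add ((smoothPeriodic_pairing u v).intervalIntegrable _ _)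
        ((smoothPeriodic_pairing u' v).intervalIntegrable _ _)]
      simp only [Loop.add_apply, add_mul, Finset.sum_add_distrib])
    (fun c u v => by
      simp only [pairing]
      rw [smul_eq_mul, ← intervalIntegral.integral_const_mul]
      simp only [Loop.smul_apply, Finset.mul_sum, mul_assoc])
    (fun u v v' => by
      simp only [pairing]
      rw [← intervalIntegral.integral_add ((smoothPeriodic_pairing u v).intervalIntegrable _ _)
        ((smoothPeriodic_pairing u v').intervalIntegrable _ _)]
      simp only [Loop.add_apply, mul_add, Finset.sum_add_distrib])
    (fun c u v => by
      simp only [pairing]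
      rw [smul_eq_mul, ← intervalIntegral.integral_const_mul]
      simp only [Loop.smul_apply, Finset.mul_sum, mul_left_comm])

theorem loopPairing_apply (u v : Loop n) : loopPairing u v = pairing u.1 v.1 := rfl

theorem loopPairing_comm (u v : Loop n) : loopPairing u v = loopPairing v u := by
  simp only [loopPairing_apply, pairing, mul_comm]

theorem eq_zero_of_loopPairing_self {u : Loop n} (h : loopPairing u u = 0) : u = 0 := by
  have hs := smoothPeriodic_pairing u u
  have hnn : ∀ x, 0 ≤ ∑ a, u.1 x a * u.1 x a := fun x =>
    Finset.sum_nonneg fun a _ => mul_self_nonneg _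
  refine Loop.ext_apply fun x a => ?_
  by_contra hx
  have hpos : 0 < ∑ a, u.1 x a * u.1 x a :=
    Finset.sum_pos' (fun a _ => mul_self_nonneg _) ⟨a, Finset.mem_univ _, mul_self_pos.2 hx⟩
  -- The period is moved to start at x, so that the point of positivity lies in the interval.
  have h1 : 0 < ∫ y in x..x + 1, ∑ a, u.1 y a * u.1 y a :=
    intervalIntegral.integral_pos (by linarith) hs.continuous.continuousOn (fun y _ => hnn y)
      ⟨x, ⟨le_rfl, by linarith⟩, hpos⟩
  rw [hs.2.intervalIntegral_add_eq x 0, zero_add] at h1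
  exact h1.ne' h

theorem loopPairing_ext {v w : Loop n} (h : ∀ z, loopPairing z v = loopPairing z w) : v = w := by
  refine sub_eq_zero.1 (eq_zero_of_loopPairing_self ?_)
  rw [map_sub, h, sub_self]

theorem loopPairing_ext_left {v w : Loop n} (h : ∀ z, loopPairing v z = loopPairing w z) :
    v = w :=
  loopPairing_ext fun z => by rw [loopPairing_comm z v, loopPairing_comm z w, h]

/-- Nondegeneracy of the pairing makes the chosen value of the adjoint the only possible one. -/
theorem adjoint_eq {T : Loop n → ℝ → Fin n → ℝ} {β γ : Loop n}
    (h : ∀ v : Loop n, pairing (T v) β.1 = loopPairing v γ) : adjoint T β = γ := by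
  have h1 : ∃ γ : Loop n, ∀ v : Loop n, pairing (T v) β.1 = pairing v.1 γ.1 := ⟨γ, h⟩
  refine loopPairing_ext fun v => ?_
  rw [← h v]
  exact (Classical.epsilon_spec h1 v).symm

theorem SmoothFamily.contDiff_loopPairing {E : Type} [NormedAddCommGroup E] [NormedSpace ℝ E]
    [FiniteDimensional ℝ E] {U : E → Loop n} (hU : SmoothFamily U) (β : Loop n) :
    ContDiff ℝ ∞ fun e => loopPairing (U e) β :=
  contDiff_parametric_integral (f := fun p : E × ℝ => ∑ a, (U p.1).1 p.2 a * β.1 p.2 a)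
    (ContDiff.sum fun a _ => (hU a).mul ((Loop.smoothPeriodic β a).1.comp contDiff_snd))

theorem SmoothFamily.hasDerivAt_loopPairing {U : ℝ → Loop n} (hU : SmoothFamily U) (β : Loop n)
    (s : ℝ) :
    HasDerivAt (fun s => loopPairing (U s) β) (loopPairing (velocity U hU s) β) s := by
  refine (hasDerivAt_parametric_integral
    (f := fun p : ℝ × ℝ => ∑ a, (U p.1).1 p.2 a * β.1 p.2 a)
    (ContDiff.sum fun a _ => (hU a).mul ((Loop.smoothPeriodic β a).1.comp contDiff_snd))
    s).congr_deriv ?_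
  refine intervalIntegral.integral_congr fun x _ => ?_
  exact (HasDerivAt.fun_sum (u := Finset.univ)
    fun a _ => (hU.hasDerivAt s x a).mul_const (β.1 x a)).deriv

end Pairing

/-! ### Derivatives, constants and means of loops -/

section Mean

variable {n : ℕ}

/-- The derivative `d/dx` of loops. -/
noncomputable def loopDeriv : Loop n →ₗ[ℝ] Loop n where
  toFun u := ⟨fun x a => jet u x 1 a, mem_loop_iff.2 fun a => smoothPeriodic_jet u 1 a⟩
  map_add' u v := Loop.ext_apply fun x a => by simp
  map_smul' c u := Loop.ext_apply fun x a => by simp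

theorem loopDeriv_apply (u : Loop n) (x : ℝ) (a : Fin n) :
    (loopDeriv u).1 x a = jet u x 1 a := rfl

theorem jet_loopDeriv (u : Loop n) (x : ℝ) (i : ℕ) (a : Fin n) :
    jet (loopDeriv u) x i a = jet u x (i + 1) a := by
  induction i generalizing x with
  | zero => rw [jet_zero]; rfl
  | succ i ih =>
    rw [← deriv_jet, ← deriv_jet u]
    exact congrArg (deriv · x) (funext fun y => ih y)

theorem integral_deriv_eq_zero {f : ℝ → ℝ} (hf : SmoothPeriodic f) :
    ∫ x in (0 : ℝ)..1, deriv f x = 0 := by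
  rw [intervalIntegral.integral_deriv_eq_sub (fun x _ => hf.differentiable x)
    (hf.deriv.intervalIntegrable _ _)]
  have := hf.2 0
  rw [zero_add] at this
  rw [this, sub_self]

theorem integral_deriv_mul {f g : ℝ → ℝ} (hf : SmoothPeriodic f) (hg : SmoothPeriodic g) :
    ∫ x in (0 : ℝ)..1, deriv f x * g x = -∫ x in (0 : ℝ)..1, f x * deriv g x := by
  have h := integral_deriv_eq_zero (hf.mul hg)
  have h1 : deriv (fun x => f x * g x) = fun x => deriv f x * g x + f x * deriv g x :=
    funext fun x => ((hf.hasDerivAt x).mul (hg.hasDerivAt x)).deriv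
  rw [h1, intervalIntegral.integral_add ((hf.deriv.mul hg).intervalIntegrable _ _)
    ((hf.mul hg.deriv).intervalIntegrable _ _)] at h
  linarith

theorem integral_iteratedDeriv_mul {f g : ℝ → ℝ} (hf : SmoothPeriodic f) (hg : SmoothPeriodic g)
    (i : ℕ) : ∫ x in (0 : ℝ)..1, iteratedDeriv i f x * g x =
      (-1) ^ i * ∫ x in (0 : ℝ)..1, f x * iteratedDeriv i g x := by
  induction i generalizing g with
  | zero => simp
  | succ i ih =>
    rw [iteratedDeriv_succ, integral_deriv_mul (hf.iteratedDeriv i) hg, ih hg.deriv,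
      ← iteratedDeriv_succ']
    ring

theorem loopPairing_eq_sum (u v : Loop n) :
    loopPairing u v = ∑ a, ∫ x in (0 : ℝ)..1, u.1 x a * v.1 x a :=
  intervalIntegral.integral_finsetSum fun a _ =>
    ((Loop.smoothPeriodic u a).mul (Loop.smoothPeriodic v a)).intervalIntegrable _ _

theorem loopPairing_loopDeriv (u v : Loop n) :
    loopPairing (loopDeriv u) v = -loopPairing u (loopDeriv v) := by
  rw [loopPairing_eq_sum, loopPairing_eq_sum, ← Finset.sum_neg_distrib]
  refine Finset.sum_congr rfl fun a _ => ?_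
  have h := integral_deriv_mul (Loop.smoothPeriodic u a) (Loop.smoothPeriodic v a)
  simpa only [loopDeriv_apply, jet, iteratedDeriv_one] using h

/-- Multiplication of loops by a constant matrix. -/
noncomputable def matrixMul (g : Matrix (Fin n) (Fin n) ℝ) : Loop n →ₗ[ℝ] Loop n where
  toFun u := ⟨fun x a => ∑ b, g a b * u.1 x b, mem_loop_iff.2 fun a =>
    .sum fun b _ => (SmoothPeriodic.const _).mul (Loop.smoothPeriodic u b)⟩
  map_add' u v := Loop.ext_apply fun x a => by simp [mul_add, Finset.sum_add_distrib]
  map_smul' c u := Loop.ext_apply fun x a => by simp [Finset.mul_sum, mul_left_comm]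

theorem matrixMul_apply (g : Matrix (Fin n) (Fin n) ℝ) (u : Loop n) (x : ℝ) (a : Fin n) :
    (matrixMul g u).1 x a = ∑ b, g a b * u.1 x b := rfl

theorem matrixMul_one (u : Loop n) : matrixMul 1 u = u :=
  Loop.ext_apply fun x a => by simp [matrixMul_apply, Matrix.one_apply]

theorem matrixMul_matrixMul (g h : Matrix (Fin n) (Fin n) ℝ) (u : Loop n) :
    matrixMul g (matrixMul h u) = matrixMul (g * h) u :=
  Loop.ext_apply fun x a => by
    simp only [matrixMul_apply, Matrix.mul_apply, Finset.mul_sum, Finset.sum_mul]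
    rw [Finset.sum_comm]
    simp only [mul_assoc]

theorem jet_matrixMul (g : Matrix (Fin n) (Fin n) ℝ) (u : Loop n) (x : ℝ) (i : ℕ) (a : Fin n) :
    jet (matrixMul g u) x i a = ∑ b, g a b * jet u x i b := by
  induction i generalizing x with
  | zero => simp only [jet_zero]; rfl
  | succ i ih =>
    rw [← deriv_jet, funext ih]
    exact (HasDerivAt.fun_sum fun b _ => (hasDerivAt_jet u x i b).const_mul _).deriv

theorem loopDeriv_matrixMul (g : Matrix (Fin n) (Fin n) ℝ) (u : Loop n) :
    loopDeriv (matrixMul g u) = matrixMul g (loopDeriv u) :=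
  Loop.ext_apply fun x a => by
    rw [loopDeriv_apply, jet_matrixMul]; rfl

theorem loopPairing_matrixMul {g : Matrix (Fin n) (Fin n) ℝ} (hg : g.IsSymm) (u v : Loop n) :
    loopPairing (matrixMul g u) v = loopPairing u (matrixMul g v) := by
  refine intervalIntegral.integral_congr fun x _ => ?_
  simp only [matrixMul_apply, Finset.sum_mul, Finset.mul_sum]
  rw [Finset.sum_comm]
  refine Finset.sum_congr rfl fun a _ => Finset.sum_congr rfl fun b _ => ?_
  rw [hg.apply a b]
  ring

/-- The operator `g^{ab} d/dx`. -/
noncomputable def hydroLinear (g : Matrix (Fin n) (Fin n) ℝ) : Loop n →ₗ[ℝ] Loop n :=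
  matrixMul g ∘ₗ loopDeriv

theorem hydroLinear_apply (g : Matrix (Fin n) (Fin n) ℝ) (α : Loop n) :
    hydroLinear g α = matrixMul g (loopDeriv α) := rfl

theorem hydro_eq (g : Matrix (Fin n) (Fin n) ℝ) (u α : Loop n) : hydro g u α = hydroLinear g α :=
  Loop.ext_apply fun x a => by
    simp only [hydro, hydroLinear_apply, matrixMul_apply, loopDeriv_apply, jet, iteratedDeriv_one]

theorem loopPairing_hydroLinear {g : Matrix (Fin n) (Fin n) ℝ} (hg : g.IsSymm) (u v : Loop n) :
    loopPairing (hydroLinear g u) v = -loopPairing u (hydroLinear g v) := by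
  rw [hydroLinear_apply, loopPairing_matrixMul hg, loopPairing_loopDeriv, loopDeriv_matrixMul]
  rfl

/-- Loops whose components have mean zero. -/
def ZeroMean (z : Loop n) : Prop := ∀ a, ∫ x in (0 : ℝ)..1, z.1 x a = 0

/-- Constant loops. -/
def constLoop (c : Fin n → ℝ) : Loop n := ⟨fun _ => c, contDiff_const, fun _ => rfl⟩

theorem constLoop_apply (c : Fin n → ℝ) (x : ℝ) : (constLoop c).1 x = c := rfl

theorem jet_constLoop (c : Fin n → ℝ) (x : ℝ) (i : ℕ) (a : Fin n) :
    jet (constLoop c) x i a = if i = 0 then c a else 0 := by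
  simp [jet, constLoop, iteratedDeriv_const]

theorem loopDeriv_constLoop (c : Fin n → ℝ) : loopDeriv (constLoop c) = 0 :=
  Loop.ext_apply fun x a => by rw [loopDeriv_apply, jet_constLoop]; simp

theorem hydroLinear_constLoop (g : Matrix (Fin n) (Fin n) ℝ) (c : Fin n → ℝ) :
    hydroLinear g (constLoop c) = 0 := by
  rw [hydroLinear_apply, loopDeriv_constLoop, map_zero]

theorem loopPairing_constLoop (z : Loop n) (c : Fin n → ℝ) :
    loopPairing z (constLoop c) = ∑ a, (∫ x in (0 : ℝ)..1, z.1 x a) * c a := by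
  rw [loopPairing_eq_sum]
  simp only [constLoop_apply, intervalIntegral.integral_mul_const]

theorem zeroMean_iff {z : Loop n} :
    ZeroMean z ↔ ∀ a, loopPairing z (constLoop (Pi.single a 1)) = 0 := by
  simp [ZeroMean, loopPairing_constLoop, Pi.single_apply]

/-- The mean is exactly the obstruction to periodicity of the primitive. -/
theorem ZeroMean.exists_loopDeriv {z : Loop n} (hz : ZeroMean z) : ∃ u, loopDeriv u = z := by
  have hd : ∀ a x, HasDerivAt (fun x => ∫ t in (0 : ℝ)..x, z.1 t a) (z.1 x a) x := fun a x =>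
    intervalIntegral.integral_hasDerivAt_right ((Loop.smoothPeriodic z a).intervalIntegrable _ _)
      (Loop.smoothPeriodic z a).continuous.aestronglyMeasurable.stronglyMeasurableAtFilter
      (Loop.smoothPeriodic z a).continuous.continuousAt
  refine ⟨⟨fun x a => ∫ t in (0 : ℝ)..x, z.1 t a, mem_loop_iff.2 fun a => ⟨?_, fun x => ?_⟩⟩, ?_⟩
  · rw [contDiff_infty_iff_deriv]
    refine ⟨fun x => (hd a x).differentiableAt, ?_⟩
    rw [funext fun x => (hd a x).deriv]
    exact (Loop.smoothPeriodic z a).1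
  · have h1 := intervalIntegral.integral_add_adjacent_intervals
      ((Loop.smoothPeriodic z a).intervalIntegrable 0 x)
      ((Loop.smoothPeriodic z a).intervalIntegrable x (x + 1))
    simp only
    rw [← h1, (Loop.smoothPeriodic z a).2.intervalIntegral_add_eq x 0, zero_add, hz a, add_zero]
  · refine Loop.ext_apply fun x a => ?_
    rw [loopDeriv_apply, jet, iteratedDeriv_one]
    exact (hd a x).deriv

/-- Invertibility of g enters here: identities tested on values of P_0 become identities tested on
loops of mean zero. -/
theorem ZeroMean.exists_hydroLinear {g : Matrix (Fin n) (Fin n) ℝ} (hg : IsUnit g.det)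
    {z : Loop n} (hz : ZeroMean z) : ∃ u, hydroLinear g u = z := by
  obtain ⟨u, rfl⟩ := hz.exists_loopDeriv
  refine ⟨matrixMul g⁻¹ u, ?_⟩
  rw [hydroLinear_apply, loopDeriv_matrixMul, matrixMul_matrixMul, Matrix.mul_nonsing_inv g hg,
    matrixMul_one]

/-- T minus its mean has mean zero, so it is orthogonal to T and to constants, hence to itself. -/
theorem eq_of_orthogonal_zeroMean {T : Loop n} (h : ∀ z, ZeroMean z → loopPairing T z = 0)
    (x y : ℝ) : T.1 x = T.1 y := by
  set c : Fin n → ℝ := fun a => ∫ x in (0 : ℝ)..1, T.1 x a with hc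
  have hz : ZeroMean (T - constLoop c) := fun a => by
    simp only [Loop.sub_apply, constLoop_apply]
    rw [intervalIntegral.integral_sub ((Loop.smoothPeriodic T a).intervalIntegrable _ _)
      intervalIntegrable_const]
    simp [hc]
  have h0 : T - constLoop c = 0 := eq_zero_of_loopPairing_self (by
    rw [map_sub, loopPairing_comm, h _ hz, loopPairing_constLoop]
    rw [zero_sub, neg_eq_zero]
    exact Finset.sum_eq_zero fun a _ => by rw [hz a, zero_mul])
  rw [sub_eq_zero.1 h0]
  rfl

end Mean

/-! ### Cutoffs and locality -/

section Locality

variable {n : ℕ}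

/-- A cutoff χ keeps v near x and kills it near the antipode; a multiple of a bump ρ, zero near both
points, corrects the mean. -/
theorem exists_zeroMean_cutoff (v : Loop n) (x : ℝ) : ∃ v' : Loop n, ZeroMean v' ∧
    v'.1 =ᶠ[𝓝 x] v.1 ∧ v'.1 =ᶠ[𝓝 (x + 1 / 2)] (0 : Loop n).1 := by
  -- The argument of the transition exceeds 1 near x, where the cosine is 1, and is negative near x
  -- + 1/2, where it is -1.
  set χ : ℝ → ℝ := fun y => Real.smoothTransition (1 / 2 + Real.cos (2 * Real.pi * (y - x)))
    with hχ
  -- At doubled frequency the cosine is 1 at both x and x + 1/2, so ρ vanishes near both; at x + 1/4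
  -- it is -1 and ρ is positive.
  set ρ : ℝ → ℝ := fun y => Real.smoothTransition (1 / 2 - Real.cos (4 * Real.pi * (y - x)))
    with hρ
  have hχs : SmoothPeriodic χ := by
    refine ⟨Real.smoothTransition.contDiff.comp (by fun_prop), fun y => ?_⟩
    simp only [hχ]
    rw [show 2 * Real.pi * (y + 1 - x) = 2 * Real.pi * (y - x) + 2 * Real.pi by ring,
      Real.cos_add_two_pi]
  have hρs : SmoothPeriodic ρ := by
    refine ⟨Real.smoothTransition.contDiff.comp (by fun_prop), fun y => ?_⟩
    simp only [hρ]
    rw [show 4 * Real.pi * (y + 1 - x) = 4 * Real.pi * (y - x) + 2 * Real.pi + 2 * Real.pi by ring,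
      Real.cos_add_two_pi, Real.cos_add_two_pi]
  have hχ1 : ∀ᶠ y in 𝓝 x, χ y = 1 := by
    have : ∀ᶠ y in 𝓝 x, 1 / 2 < Real.cos (2 * Real.pi * (y - x)) :=
      (by fun_prop : Continuous fun y => Real.cos (2 * Real.pi * (y - x))).continuousAt
        |>.eventually_const_lt (by norm_num)
    exact this.mono fun y hy => Real.smoothTransition.one_of_one_le (by linarith)
  have hχ0 : ∀ᶠ y in 𝓝 (x + 1 / 2), χ y = 0 := by
    have : ∀ᶠ y in 𝓝 (x + 1 / 2), Real.cos (2 * Real.pi * (y - x)) < -(1 / 2) :=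
      (by fun_prop : Continuous fun y => Real.cos (2 * Real.pi * (y - x))).continuousAt
        |>.eventually_lt_const (by
          simp only
          rw [show 2 * Real.pi * (x + 1 / 2 - x) = Real.pi by ring]; norm_num)
    exact this.mono fun y hy => Real.smoothTransition.zero_of_nonpos (by linarith)
  have hρ0 : ∀ᶠ y in 𝓝 x, ρ y = 0 := by
    have : ∀ᶠ y in 𝓝 x, 1 / 2 < Real.cos (4 * Real.pi * (y - x)) :=
      (by fun_prop : Continuous fun y => Real.cos (4 * Real.pi * (y - x))).continuousAt
        |>.eventually_const_lt (by norm_num)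
    exact this.mono fun y hy => Real.smoothTransition.zero_of_nonpos (by linarith)
  have hρ1 : ∀ᶠ y in 𝓝 (x + 1 / 2), ρ y = 0 := by
    have : ∀ᶠ y in 𝓝 (x + 1 / 2), 1 / 2 < Real.cos (4 * Real.pi * (y - x)) :=
      (by fun_prop : Continuous fun y => Real.cos (4 * Real.pi * (y - x))).continuousAt
        |>.eventually_const_lt (by
          simp only
          rw [show 4 * Real.pi * (x + 1 / 2 - x) = 2 * Real.pi by ring, Real.cos_two_pi]
          norm_num)
    exact this.mono fun y hy => Real.smoothTransition.zero_of_nonpos (by linarith)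
  have hρi : ∫ y in (0 : ℝ)..1, ρ y ≠ 0 := by
    have h1 : 0 < ∫ y in x..x + 1, ρ y :=
      intervalIntegral.integral_pos (by linarith) hρs.continuous.continuousOn
        (fun y _ => Real.smoothTransition.nonneg _)
        ⟨x + 1 / 4, ⟨by linarith, by linarith⟩, Real.smoothTransition.pos_of_pos (by
          rw [show 4 * Real.pi * (x + 1 / 4 - x) = Real.pi by ring]; norm_num)⟩
    rw [hρs.2.intervalIntegral_add_eq x 0, zero_add] at h1
    exact h1.ne'
  set m : Fin n → ℝ := fun a => (∫ y in (0 : ℝ)..1, χ y * v.1 y a) / ∫ y in (0 : ℝ)..1, ρ y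
    with hm
  have hs : ∀ a, SmoothPeriodic fun y => χ y * v.1 y a := fun a =>
    hχs.mul (Loop.smoothPeriodic v a)
  refine ⟨⟨fun y a => χ y * v.1 y a + (-m a) * ρ y, mem_loop_iff.2 fun a =>
    (hs a).add ((SmoothPeriodic.const _).mul hρs)⟩, fun a => ?_, ?_, ?_⟩
  · simp only
    rw [intervalIntegral.integral_add ((hs a).intervalIntegrable _ _)
      (((SmoothPeriodic.const _).mul hρs).intervalIntegrable _ _),
      intervalIntegral.integral_const_mul, hm]
    field_simp
    ring
  · filter_upwards [hχ1, hρ0] with y h1 h2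
    funext a
    simp [h1, h2]
  · filter_upwards [hχ0, hρ1] with y h1 h2
    funext a
    simp [h1, h2]

/-- A local bilinear expression whose values on loops of mean zero are orthogonal to all loops of
mean zero vanishes. -/
theorem eq_zero_of_local {B : Loop n → Loop n → Loop n}
    (hloc : ∀ v v' w w' x, v.1 =ᶠ[𝓝 x] v'.1 → w.1 =ᶠ[𝓝 x] w'.1 → (B v w).1 x = (B v' w').1 x)
    (h0 : B 0 0 = 0)
    (h : ∀ v w z, ZeroMean v → ZeroMean w → ZeroMean z → loopPairing (B v w) z = 0)
    (v w : Loop n) : B v w = 0 := by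
  refine Subtype.ext (funext fun x => ?_)
  obtain ⟨v', hv, hv1, hv2⟩ := exists_zeroMean_cutoff v x
  obtain ⟨w', hw, hw1, hw2⟩ := exists_zeroMean_cutoff w x
  -- The value on the cut-off loops is a constant loop. At x it equals the wanted value, and at the
  -- antipode, where both arguments vanish locally, it equals the value at zero.
  rw [← hloc v' v w' w x hv1 hw1,
    eq_of_orthogonal_zeroMean (fun z hz => h v' w' z hv hw hz) x (x + 1 / 2),
    hloc v' 0 w' 0 _ hv2 hw2, h0]
  rfl

end Locality

/-! ### Differential operators whose coefficients are differential polynomials -/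

section Operators

variable {n : ℕ} {w d e : ℤ}

/-- Scalar expressions `S_u(α)`, linear in the derivatives of `α`, whose coefficients are
differential polynomials in `u`; the derivative `α_i` has degree `w * i`. -/
inductive IsForm (w : ℤ) : ℤ → (Loop n → Loop n → ℝ → ℝ) → Prop
  | zero (d : ℤ) : IsForm w d fun _ _ _ => 0
  | jet (i : ℕ) (b : Fin n) : IsForm w (w * i) fun _ α x => jet α x i b
  | add {d : ℤ} {S T : Loop n → Loop n → ℝ → ℝ} (hS : IsForm w d S) (hT : IsForm w d T) :
      IsForm w d fun u α x => S u α x + T u α x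
  | mul {d e : ℤ} {F : Jet n → ℝ} {S : Loop n → Loop n → ℝ → ℝ} (hF : DiffPoly w d F)
      (hS : IsForm w e S) : IsForm w (d + e) fun u α x => F (HydroPoisson.jet u x) * S u α x

namespace IsForm

variable {S T : Loop n → Loop n → ℝ → ℝ}

theorem cast (h : IsForm w d S) (hd : d = e) : IsForm w e S := hd ▸ h

theorem congr (h : IsForm w d S) (hT : ∀ u α x, S u α x = T u α x) : IsForm w d T := by
  obtain rfl : S = T := funext fun u => funext fun α => funext fun x => hT u α x
  exact h

theorem mul' {k : ℤ} {F : Jet n → ℝ} (hF : DiffPoly w d F) (hS : IsForm w e S)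
    (h : d + e = k) : IsForm w k fun u α x => F (HydroPoisson.jet u x) * S u α x :=
  (hS.mul hF).cast h

theorem const_mul (c : ℝ) (h : IsForm w d S) : IsForm w d fun u α x => c * S u α x :=
  mul' (.const c) h (zero_add d)

theorem sum {ι : Type*} {s : Finset ι} {S : ι → Loop n → Loop n → ℝ → ℝ}
    (h : ∀ i ∈ s, IsForm w d (S i)) : IsForm w d fun u α x => ∑ i ∈ s, S i u α x := by
  classical
  induction s using Finset.induction_on with
  | empty => simpa using zero d
  | insert i s hi ih =>
    simp only [Finset.sum_insert hi]
    exact (h i (by simp)).add (ih fun j hj => h j (by simp [hj]))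

theorem zero_weight (h : IsForm w d S) : IsForm 0 0 S := by
  induction h with
  | zero => exact zero 0
  | jet i b => exact (jet i b).cast (by simp)
  | add _ _ hS hT => exact hS.add hT
  | mul hF _ hS => exact mul' hF.zero_weight hS (by simp)

theorem contDiff {E : Type} [NormedAddCommGroup E] [NormedSpace ℝ E] (h : IsForm w d S)
    {U A : E → Loop n} (hU : SmoothFamily U) (hA : SmoothFamily A) :
    ContDiff ℝ ∞ fun p : E × ℝ => S (U p.1) (A p.1) p.2 := by
  induction h with
  | zero => exact contDiff_const
  | jet i b => exact hA.contDiff_jet i b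
  | add _ _ hS hT => exact hS.add hT
  | mul hF _ hS => exact (hF.smooth_family hU).mul hS

theorem smoothPeriodic (h : IsForm w d S) (u α : Loop n) : SmoothPeriodic (S u α) := by
  induction h with
  | zero => exact .const 0
  | jet i b => exact smoothPeriodic_jet α i b
  | add _ _ hS hT => exact hS.add hT
  | mul hF _ hS => exact (hF.smoothPeriodic u).mul hS

theorem deriv (h : IsForm w d S) : IsForm w (d + w) fun u α x => deriv (S u α) x := by
  induction h with
  | zero => simpa using zero _
  | jet i b =>
    refine ((jet (i + 1) b).cast (by push_cast; ring)).congr fun u α x => ?_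
    exact (deriv_jet α x i b).symm
  | add hS' hT' hS hT =>
    refine (hS.add hT).congr fun u α x => ?_
    exact (((hS'.smoothPeriodic u α).hasDerivAt x).add
      ((hT'.smoothPeriodic u α).hasDerivAt x)).deriv.symm
  | mul hF hS' hS =>
    obtain ⟨G, hG, hG'⟩ := hF.exists_totalDeriv
    refine ((mul' hG hS' (by ring)).add (mul' hF hS (by ring))).congr fun u α x => ?_
    rw [← hG']
    exact (((hF.smoothPeriodic u).hasDerivAt x).mul
      ((hS'.smoothPeriodic u α).hasDerivAt x)).deriv.symm

theorem iteratedDeriv (h : IsForm w d S) (m : ℕ) :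
    IsForm w (d + w * m) fun u α x => iteratedDeriv m (S u α) x := by
  induction m with
  | zero => simpa using h
  | succ m ih =>
    simp only [iteratedDeriv_succ]
    exact ih.deriv.cast (by push_cast; ring)

/-- The normal form of a linear differential expression. Any longer range of summation is allowed,
so that several expressions can share one. -/
theorem exists_coeff (h : IsForm w d S) : ∃ (N : ℕ) (A : ℕ → Fin n → Jet n → ℝ),
    (∀ (i : ℕ) (b : Fin n), DiffPoly w (d - w * i) (A i b)) ∧
    ∀ M, N ≤ M → ∀ u α x, S u α x = ∑ i ∈ Finset.range M, ∑ b, A i b (HydroPoisson.jet u x) *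
      HydroPoisson.jet α x i b := by
  induction h with
  | zero => exact ⟨0, fun _ _ _ => 0, fun _ _ => .zero _, by simp⟩
  | jet i b =>
    classical
    refine ⟨i + 1, fun j c _ => if j = i ∧ c = b then 1 else 0, fun j c => ?_,
      fun M hM u α x => ?_⟩
    · by_cases hj : j = i ∧ c = b
      · exact ((DiffPoly.const 1).cast (by simp [hj])).congr (by simp [hj])
      · exact (DiffPoly.zero _).congr (by simp [hj])
    · rw [Finset.sum_eq_single i, Finset.sum_eq_single b]
      · simp
      · simp +contextual
      · simp
      · simp +contextual
      · intro hi
        simp at hi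
        omega
  | add _ _ hS hT =>
    obtain ⟨N, A, hA, hA'⟩ := hS
    obtain ⟨M, B, hB, hB'⟩ := hT
    refine ⟨max N M, fun i b z => A i b z + B i b z, fun i b => (hA i b).add (hB i b),
      fun K hK u α x => ?_⟩
    simp only [hA' K (by omega), hB' K (by omega), add_mul, Finset.sum_add_distrib]
  | mul hF _ hS =>
    obtain ⟨N, A, hA, hA'⟩ := hS
    refine ⟨N, fun i b z => _ * A i b z, fun i b => hF.mul' (hA i b) (by ring),
      fun K hK u α x => ?_⟩
    simp only [hA' K hK, Finset.mul_sum, mul_assoc]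

end IsForm

theorem DiffPoly.isForm {F : Jet n → ℝ} (hF : DiffPoly w d F) (i : ℕ) (b : Fin n) {k : ℤ}
    (h : d + w * i = k) : IsForm w k fun u α x => F (jet u x) * jet α x i b :=
  .mul' hF (.jet i b) h

/-- Matrix differential operators of degree `d` whose coefficients are differential polynomials. -/
def IsOp (w d : ℤ) (P : Loop n → Loop n → Loop n) : Prop :=
  ∀ a, IsForm w d fun u α x => (P u α).1 x a

/-- Maps whose components are differential polynomials of degree `d`. -/
def IsField (w d : ℤ) (X : Loop n → Loop n) : Prop :=
  ∀ a, ∃ F, DiffPoly w d F ∧ ∀ u x, (X u).1 x a = F (jet u x)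

theorem exists_loop_of_isForm {S : Fin n → Loop n → Loop n → ℝ → ℝ}
    (h : ∀ a, IsForm w d (S a)) :
    ∃ P : Loop n → Loop n → Loop n, IsOp w d P ∧ ∀ u α x a, (P u α).1 x a = S a u α x :=
  ⟨fun u α => ⟨fun x a => S a u α x, mem_loop_iff.2 fun a => (h a).smoothPeriodic u α⟩, h,
    fun _ _ _ _ => rfl⟩

theorem exists_loop_of_diffPoly {F : Fin n → Jet n → ℝ} (h : ∀ a, DiffPoly w d (F a)) :
    ∃ X : Loop n → Loop n, IsField w d X ∧ ∀ u x a, (X u).1 x a = F a (jet u x) :=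
  ⟨fun u => ⟨fun x a => F a (jet u x), mem_loop_iff.2 fun a => (h a).smoothPeriodic u⟩,
    fun a => ⟨F a, h a, fun _ _ => rfl⟩, fun _ _ _ => rfl⟩

namespace IsOp

variable {P Q : Loop n → Loop n → Loop n}

theorem cast (h : IsOp w d P) (hd : d = e) : IsOp w e P := hd ▸ h

theorem zero_weight (h : IsOp w d P) : IsOp 0 0 P := fun a => (h a).zero_weight

theorem add (hP : IsOp w d P) (hQ : IsOp w d Q) : IsOp w d fun u α => P u α + Q u α :=
  fun a => (hP a).add (hQ a)

theorem smul (c : ℝ) (hP : IsOp w d P) : IsOp w d fun u α => c • P u α :=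
  fun a => (hP a).const_mul c

theorem sub (hP : IsOp w d P) (hQ : IsOp w d Q) : IsOp w d fun u α => P u α - Q u α :=
  fun a => ((hP a).add ((hQ a).const_mul (-1))).congr fun u α x => by simp; ring

theorem sum {ι : Type*} {s : Finset ι} {P : ι → Loop n → Loop n → Loop n}
    (h : ∀ i ∈ s, IsOp w d (P i)) : IsOp w d fun u α => ∑ i ∈ s, P i u α :=
  fun a => (IsForm.sum fun i hi => h i hi a).congr fun u α x => by simp

theorem jet_isForm (hP : IsOp w d P) (i : ℕ) (b : Fin n) :
    IsForm w (d + w * i) fun u α x => jet (P u α) x i b :=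
  (hP b).iteratedDeriv i

theorem smoothFamily {E : Type} [NormedAddCommGroup E] [NormedSpace ℝ E] (h : IsOp w d P)
    {U A : E → Loop n} (hU : SmoothFamily U) (hA : SmoothFamily A) :
    SmoothFamily fun e => P (U e) (A e) := fun a => (h a).contDiff hU hA

theorem exists_coeff (h : IsOp w d P) : ∃ (N : ℕ) (A : ℕ → Fin n → Fin n → Jet n → ℝ),
    (∀ (i : ℕ) (a b : Fin n), DiffPoly w (d - w * i) (A i a b)) ∧
    ∀ M, N ≤ M → ∀ u α x a, (P u α).1 x a =
      ∑ i ∈ Finset.range M, ∑ b, A i a b (jet u x) * jet α x i b := by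
  choose N A hA hA' using fun a => (h a).exists_coeff
  exact ⟨Finset.univ.sup N, fun i a b => A a i b, fun i a b => hA a i b, fun M hM u α x a =>
    hA' a M ((Finset.le_sup (Finset.mem_univ a)).trans hM) u α x⟩

theorem isLinearMap (h : IsOp w d P) (u : Loop n) : IsLinearMap ℝ (P u) := by
  obtain ⟨N, A, _, hA⟩ := h.exists_coeff
  constructor
  · intro α β
    refine Loop.ext_apply fun x a => ?_
    simp only [Loop.add_apply, hA N le_rfl, jet_add, mul_add, Finset.sum_add_distrib]
  · intro c α
    refine Loop.ext_apply fun x a => ?_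
    simp only [Loop.smul_apply, hA N le_rfl, jet_smul, Finset.mul_sum, mul_left_comm]

/-- The operator at a loop as a linear map. -/
def linear (h : IsOp w d P) (u : Loop n) : Loop n →ₗ[ℝ] Loop n := (h.isLinearMap u).mk' _

theorem map_sum (h : IsOp w d P) (u : Loop n) {ι : Type*} (s : Finset ι) (α : ι → Loop n) :
    P u (∑ i ∈ s, α i) = ∑ i ∈ s, P u (α i) := _root_.map_sum (h.linear u) α s

theorem map_zero (h : IsOp w d P) (u : Loop n) : P u 0 = 0 := (h.isLinearMap u).map_zero

theorem comp (hP : IsOp w d P) (hQ : IsOp w e Q) : IsOp w (d + e) fun u α => P u (Q u α) := by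
  obtain ⟨N, A, hA, hA'⟩ := hP.exists_coeff
  refine fun a => (IsForm.sum (s := Finset.range N) fun i _ => IsForm.sum (s := Finset.univ)
    fun b _ => IsForm.mul' (hA i a b) (hQ.jet_isForm i b) (by ring)).congr fun u α x => ?_
  rw [hA' N le_rfl]

theorem local_apply (h : IsOp w d P) {u u' α α' : Loop n} {x : ℝ} (hu : u.1 =ᶠ[𝓝 x] u'.1)
    (hα : α.1 =ᶠ[𝓝 x] α'.1) : (P u α).1 x = (P u' α').1 x := by
  obtain ⟨N, A, _, hA⟩ := h.exists_coeff
  funext a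
  rw [hA N le_rfl, hA N le_rfl, jet_congr hu, jet_congr hα]

theorem loopDeriv : IsOp w w fun _ α : Loop n => loopDeriv α := fun a =>
  ((IsForm.jet 1 a).cast (by simp)).congr fun _ _ _ => rfl

theorem matrixMul (g : Matrix (Fin n) (Fin n) ℝ) :
    IsOp w 0 fun _ α : Loop n => matrixMul g α := fun a =>
  (IsForm.sum (s := Finset.univ) fun b _ => ((IsForm.jet 0 b).cast (by simp)).const_mul (g a b)).congr
    fun u α x => by simp only [jet_zero, matrixMul_apply]

theorem hydroLinear (g : Matrix (Fin n) (Fin n) ℝ) :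
    IsOp w w fun _ α : Loop n => hydroLinear g α :=
  ((matrixMul g).comp loopDeriv).cast (zero_add w)

theorem integral_sum_sum {ι : Type*} (s : Finset ι) {F : ι → Fin n → ℝ → ℝ}
    (hF : ∀ i b, SmoothPeriodic (F i b)) : ∫ x in (0 : ℝ)..1, ∑ i ∈ s, ∑ b, F i b x =
      ∑ i ∈ s, ∑ b, ∫ x in (0 : ℝ)..1, F i b x := by
  rw [intervalIntegral.integral_finsetSum fun i _ =>
    (SmoothPeriodic.sum fun b _ => hF i b).intervalIntegrable _ _]
  exact Finset.sum_congr rfl fun i _ =>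
    intervalIntegral.integral_finsetSum fun b _ => (hF i b).intervalIntegrable _ _

/-- The formal adjoint of a linear differential operator with smooth periodic coefficients. -/
theorem exists_adjoint_of_smoothPeriodic (N : ℕ) (c : ℕ → Fin n → Fin n → ℝ → ℝ)
    (hc : ∀ i a b, SmoothPeriodic (c i a b)) : ∃ T' : Loop n → Loop n,
    (∀ β x b, (T' β).1 x b = ∑ i ∈ Finset.range N, ∑ a,
      (-1) ^ i * iteratedDeriv i (fun y => c i a b y * β.1 y a) x) ∧
    ∀ T v β : Loop n, (∀ x a, T.1 x a = ∑ i ∈ Finset.range N, ∑ b, c i a b x * jet v x i b) →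
      loopPairing T β = loopPairing v (T' β) := by
  have hs : ∀ (β : Loop n) i a b, SmoothPeriodic
      (_root_.iteratedDeriv i fun y => c i a b y * β.1 y a) := fun β i a b =>
    ((hc i a b).mul (Loop.smoothPeriodic β a)).iteratedDeriv i
  refine ⟨fun β => ⟨fun x b => ∑ i ∈ Finset.range N, ∑ a,
      (-1) ^ i * iteratedDeriv i (fun y => c i a b y * β.1 y a) x, mem_loop_iff.2 fun b =>
      .sum fun i _ => .sum fun a _ => (SmoothPeriodic.const _).mul (hs β i a b)⟩,
    fun _ _ _ => rfl, fun T v β hT => ?_⟩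
  have h1 : ∀ i a b, ∫ x in (0 : ℝ)..1, (c i a b x * jet v x i b) * β.1 x a =
      ∫ x in (0 : ℝ)..1, v.1 x b * ((-1) ^ i * iteratedDeriv i (fun y => c i a b y * β.1 y a) x) := by
    intro i a b
    have h := integral_iteratedDeriv_mul (Loop.smoothPeriodic v b)
      ((hc i a b).mul (Loop.smoothPeriodic β a)) i
    rw [← intervalIntegral.integral_const_mul] at h
    calc _ = _ := intervalIntegral.integral_congr fun x _ => by simp only [jet]; ring
      _ = _ := h
      _ = _ := intervalIntegral.integral_congr fun x _ => by ring
  have hs1 : ∀ i a b, SmoothPeriodic fun x => (c i a b x * jet v x i b) * β.1 x a :=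
    fun i a b => ((hc i a b).mul (smoothPeriodic_jet v i b)).mul (Loop.smoothPeriodic β a)
  have hs2 : ∀ i a b, SmoothPeriodic fun x => v.1 x b *
      ((-1) ^ i * iteratedDeriv i (fun y => c i a b y * β.1 y a) x) := fun i a b =>
    (Loop.smoothPeriodic v b).mul ((SmoothPeriodic.const _).mul (hs β i a b))
  have hl : loopPairing T β = ∑ a, ∑ i ∈ Finset.range N, ∑ b,
      ∫ x in (0 : ℝ)..1, (c i a b x * jet v x i b) * β.1 x a := by
    rw [loopPairing_eq_sum]
    refine Finset.sum_congr rfl fun a _ => ?_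
    simp only [hT, Finset.sum_mul]
    exact integral_sum_sum _ fun i b => hs1 i a b
  rw [hl, loopPairing_eq_sum]
  simp only [Finset.mul_sum]
  have hr := fun b => integral_sum_sum (Finset.range N) fun i a => hs2 i a b
  simp only [hr, h1]
  rw [Finset.sum_comm]
  conv_rhs => rw [Finset.sum_comm]
  exact Finset.sum_congr rfl fun i _ => Finset.sum_comm

/-- Integration by parts replaces A ∂^i by (-∂)^i applied to the transpose of A times the argument,
which preserves the total degree. -/
theorem exists_adjoint (h : IsOp w d P) : ∃ P' : Loop n → Loop n → Loop n, IsOp w d P' ∧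
    ∀ u v β, loopPairing (P u v) β = loopPairing v (P' u β) := by
  obtain ⟨N, A, hA, hA'⟩ := h.exists_coeff
  choose T' hT hT' using fun u : Loop n => exists_adjoint_of_smoothPeriodic N
    (fun i a b x => A i a b (jet u x)) fun i a b => (hA i a b).smoothPeriodic u
  refine ⟨T', fun b => ?_, fun u v β => hT' u _ v β (hA' N le_rfl u v)⟩
  refine (IsForm.sum (s := Finset.range N) fun i _ => IsForm.sum (s := Finset.univ) fun a _ =>
    ((IsForm.mul (hA i a b) (.jet 0 a)).iteratedDeriv i).const_mul ((-1) ^ i) |>.cast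
      (by push_cast; ring)).congr fun u α x => ?_
  rw [hT]
  simp only [jet_zero]

end IsOp

end Operators

/-! ### Fields and their derivatives -/

section Fields

variable {n : ℕ} {w d e : ℤ}

namespace IsField

variable {X Y : Loop n → Loop n}

theorem cast (h : IsField w d X) (hd : d = e) : IsField w e X := hd ▸ h

theorem zero_weight (h : IsField w d X) : IsField 0 0 X := fun a => by
  obtain ⟨F, hF, hX⟩ := h a
  exact ⟨F, hF.zero_weight, hX⟩

theorem zero : IsField w d fun _ : Loop n => 0 := fun _ => ⟨_, .zero d, fun _ _ => rfl⟩

theorem id : IsField w 0 fun u : Loop n => u := fun a =>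
  ⟨fun z => z 0 a, (DiffPoly.var 0 a).cast (by simp), fun u x => (jet_zero u x a).symm⟩

theorem add (hX : IsField w d X) (hY : IsField w d Y) : IsField w d fun u => X u + Y u :=
  fun a => by
    obtain ⟨F, hF, hX⟩ := hX a
    obtain ⟨G, hG, hY⟩ := hY a
    exact ⟨_, hF.add hG, fun u x => by rw [Loop.add_apply, hX, hY]⟩

theorem smul (c : ℝ) (hX : IsField w d X) : IsField w d fun u => c • X u := fun a => by
  obtain ⟨F, hF, hX⟩ := hX a
  exact ⟨_, hF.const_mul c, fun u x => by rw [Loop.smul_apply, hX]⟩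

theorem sum {ι : Type*} {s : Finset ι} {X : ι → Loop n → Loop n}
    (h : ∀ i ∈ s, IsField w d (X i)) : IsField w d fun u => ∑ i ∈ s, X i u := by
  classical
  induction s using Finset.induction_on with
  | empty => simpa using zero
  | insert i s hi ih =>
    simp only [Finset.sum_insert hi]
    exact (h i (by simp)).add (ih fun j hj => h j (by simp [hj]))

theorem smoothFamily {E : Type} [NormedAddCommGroup E] [NormedSpace ℝ E] (h : IsField w d X)
    {U : E → Loop n} (hU : SmoothFamily U) : SmoothFamily fun e => X (U e) := fun a => by
  obtain ⟨F, hF, hX⟩ := h a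
  simp only [hX]
  exact hF.smooth_family hU

theorem exists_jet (h : IsField w d X) (i : ℕ) (a : Fin n) : ∃ F, DiffPoly w (d + w * i) F ∧
    ∀ u x, jet (X u) x i a = F (jet u x) := by
  obtain ⟨F, hF, hX⟩ := h a
  obtain ⟨G, hG, hG'⟩ := hF.exists_iteratedDeriv i
  refine ⟨G, hG, fun u x => ?_⟩
  rw [← hG', jet]
  exact congrArg (iteratedDeriv i · x) (funext fun y => hX u y)

theorem local_apply (h : IsField w d X) {u u' : Loop n} {x : ℝ} (hu : u.1 =ᶠ[𝓝 x] u'.1) :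
    (X u).1 x = (X u').1 x := by
  funext a
  obtain ⟨F, _, hX⟩ := h a
  rw [hX, hX, jet_congr hu]

theorem isHomogeneousField {d : ℕ} (h : IsField 1 d X) : IsHomogeneousField d X := by
  choose F hF hX using h
  exact ⟨F, fun a => (hF a).mem_homDiffPoly rfl, fun u x a => hX a u x⟩

end IsField

theorem IsOp.apply_field {P : Loop n → Loop n → Loop n} {Y : Loop n → Loop n} (hP : IsOp w d P)
    (hY : IsField w e Y) : IsField w (d + e) fun u => P u (Y u) := by
  obtain ⟨N, A, hA, hA'⟩ := hP.exists_coeff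
  choose G hG hG' using fun i b => hY.exists_jet i b
  refine fun a => ⟨fun z => ∑ i ∈ Finset.range N, ∑ b, A i a b z * G i b z,
    .sum fun i _ => .sum fun b _ => (hA i a b).mul' (hG i b) (by ring), fun u x => ?_⟩
  simp only [hA' N le_rfl, hG']

theorem IsOp.apply_const {P : Loop n → Loop n → Loop n} (hP : IsOp w d P) (c : Fin n → ℝ) :
    IsField w d fun u => P u (constLoop c) := by
  obtain ⟨N, A, hA, hA'⟩ := hP.exists_coeff
  refine fun a => ⟨fun z => ∑ b, c b * A 0 a b z, .sum fun b _ =>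
    ((hA 0 a b).cast (by simp)).const_mul (c b), fun u x => ?_⟩
  -- The range N + 1 guarantees that the term of order zero, the only one that sees constants, can
  -- be split off even if N = 0.
  rw [hA' (N + 1) (by omega), Finset.sum_range_succ']
  simp [jet_constLoop, mul_comm]

theorem IsHomogeneousOperator.isOp {d : ℕ} {P : Loop n → Loop n → Loop n}
    (h : IsHomogeneousOperator d P) : IsOp 1 d P := by
  obtain ⟨A, hA, hP⟩ := h
  refine fun a => (IsForm.sum (s := Finset.range (d + 1)) fun l hl => IsForm.sum
    (s := Finset.univ) fun b _ => (diffPoly_of_mem_homDiffPoly (hA l a b)).isForm (d - l) b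
      ?_).congr fun u α x => (hP u α x a).symm
  rw [Finset.mem_range] at hl
  push_cast [Nat.le_of_lt_succ hl]
  ring

/-- `DX` is the derivative of the map `X` of loops. -/
def IsDerivative (X : Loop n → Loop n) (DX : Loop n → Loop n → Loop n) : Prop :=
  ∀ (U : ℝ → Loop n) (hU : SmoothFamily U) (s x : ℝ) (a : Fin n),
    HasDerivAt (fun s => (X (U s)).1 x a) ((DX (U s) (velocity U hU s)).1 x a) s

theorem IsField.exists_isDerivative {X : Loop n → Loop n} (h : IsField w d X) :
    ∃ DX, IsOp w d DX ∧ IsDerivative X DX := by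
  choose F hF hX using h
  choose N p hp using fun a => (hF a).exists_isGrad
  obtain ⟨DX, hDX, hDX'⟩ := exists_loop_of_isForm (w := w) (d := d)
    (S := fun a u α x => ∑ i ∈ Finset.range (N a), ∑ b, p a i b (jet u x) * jet α x i b)
    fun a => .sum fun i _ => .sum fun b _ => ((hp a).diffPoly i b).isForm i b (by ring)
  refine ⟨DX, hDX, fun U hU s x a => ?_⟩
  simp only [hX, hDX']
  exact (hp a).hasDerivAt (fun s => jet (U s) x) _ s fun i b => hU.hasDerivAt_jet s x i b

namespace IsDerivative

variable {X : Loop n → Loop n} {DX : Loop n → Loop n → Loop n}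

theorem hasDerivAt_line (h : IsDerivative X DX) (u v : Loop n) (s x : ℝ) (a : Fin n) :
    HasDerivAt (fun s : ℝ => (X (u + s • v)).1 x a) ((DX (u + s • v) v).1 x a) s := by
  have := h _ (SmoothFamily.line u v) s x a
  rwa [velocity_line] at this

theorem frechet_eq (h : IsDerivative X DX) (u v : Loop n) : frechet X u v = (DX u v).1 := by
  funext x a
  have := (h.hasDerivAt_line u v 0 x a).deriv
  rw [zero_smul, add_zero] at this
  exact this

theorem id : IsDerivative (fun u : Loop n => u) fun _ v => v := fun _ hU s x a =>
  hU.hasDerivAt s x a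

theorem sum {ι : Type*} {s : Finset ι} {X : ι → Loop n → Loop n}
    {DX : ι → Loop n → Loop n → Loop n} (h : ∀ i ∈ s, IsDerivative (X i) (DX i)) :
    IsDerivative (fun u => ∑ i ∈ s, X i u) fun u v => ∑ i ∈ s, DX i u v := fun U hU t x a => by
  simp only [Loop.sum_apply]
  exact HasDerivAt.fun_sum fun i hi => h i hi U hU t x a

theorem smul (c : ℝ) (h : IsDerivative X DX) :
    IsDerivative (fun u => c • X u) fun u v => c • DX u v := fun U hU t x a =>
  (h U hU t x a).const_mul c

theorem add {Y : Loop n → Loop n} {DY : Loop n → Loop n → Loop n} (h : IsDerivative X DX)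
    (h' : IsDerivative Y DY) :
    IsDerivative (fun u => X u + Y u) fun u v => DX u v + DY u v := fun U hU t x a =>
  (h U hU t x a).add (h' U hU t x a)

end IsDerivative

end Fields

/-! ### Derivatives of operators -/

section OpDeriv

variable {n : ℕ} {w d e : ℤ} {P : Loop n → Loop n → Loop n}

/-- The product rule for P_u α. The part with u varying is a differential operator in the direction;
its coefficients depend on α only through its germ, as the cutoff argument will require. -/
theorem IsOp.exists_derivCoeff (hP : IsOp w d P) :
    ∃ (M : ℕ) (c : Loop n → Loop n → ℕ → Fin n → Fin n → ℝ → ℝ),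
    (∀ u α i a b, SmoothPeriodic (c u α i a b)) ∧
    (∀ u α α' x, α.1 =ᶠ[𝓝 x] α'.1 → ∀ i a b, c u α i a b =ᶠ[𝓝 x] c u α' i a b) ∧
    ∀ (U : ℝ → Loop n) (hU : SmoothFamily U) (A : ℝ → Loop n) (hA : SmoothFamily A) s x a,
      HasDerivAt (fun s => (P (U s) (A s)).1 x a)
        (∑ j ∈ Finset.range M, ∑ b, c (U s) (A s) j a b x * jet (velocity U hU s) x j b +
          (P (U s) (velocity A hA s)).1 x a) s := by
  obtain ⟨N, A, hA, hA'⟩ := hP.exists_coeff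
  choose Mf p hp using fun i a b => (hA i a b).exists_isGrad
  -- A common bound for the number of jet orders on which the finitely many coefficients depend.
  set M := (Finset.range N ×ˢ (Finset.univ : Finset (Fin n × Fin n))).sup
    fun q => Mf q.1 q.2.1 q.2.2 with hM
  have hMle : ∀ i ∈ Finset.range N, ∀ a b, Mf i a b ≤ M := fun i hi a b =>
    Finset.le_sup (s := Finset.range N ×ˢ (Finset.univ : Finset (Fin n × Fin n)))
      (f := fun q => Mf q.1 q.2.1 q.2.2) (b := (i, a, b)) (by simpa using hi)
  refine ⟨M, fun u α j a b' x => ∑ i ∈ Finset.range N, ∑ b, p i a b j b' (jet u x) * jet α x i b,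
    fun u α j a b' => .sum fun i _ => .sum fun b _ =>
      (((hp i a b).diffPoly j b').smoothPeriodic u).mul (smoothPeriodic_jet α i b), ?_, ?_⟩
  · intro u α α' x h j a b'
    filter_upwards [eventually_jet_congr h] with y hy
    rw [hy]
  · intro U hU B hB s x a
    simp only [hA' N le_rfl]
    have h1 : ∀ i ∈ Finset.range N, ∀ b, HasDerivAt
        (fun s => A i a b (jet (U s) x) * jet (B s) x i b)
        ((∑ j ∈ Finset.range M, ∑ b', p i a b j b' (jet (U s) x) * jet (velocity U hU s) x j b') *
          jet (B s) x i b + A i a b (jet (U s) x) * jet (velocity B hB s) x i b) s :=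
      fun i hi b => (((hp i a b).mono (hMle i hi a b)).hasDerivAt (fun s => jet (U s) x) _ s
        fun i b => hU.hasDerivAt_jet s x i b).mul (hB.hasDerivAt_jet s x i b)
    refine (HasDerivAt.fun_sum fun i hi => HasDerivAt.fun_sum (u := Finset.univ)
      fun b _ => h1 i hi b).congr_deriv ?_
    simp only [Finset.sum_add_distrib, Finset.sum_mul]
    congr 1
    calc _ = ∑ i ∈ Finset.range N, ∑ j ∈ Finset.range M, ∑ b, ∑ b',
          p i a b j b' (jet (U s) x) * jet (velocity U hU s) x j b' * jet (B s) x i b :=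
        Finset.sum_congr rfl fun i _ => Finset.sum_comm
      _ = ∑ j ∈ Finset.range M, ∑ i ∈ Finset.range N, ∑ b, ∑ b',
          p i a b j b' (jet (U s) x) * jet (velocity U hU s) x j b' * jet (B s) x i b :=
        Finset.sum_comm
      _ = _ := Finset.sum_congr rfl fun j _ => by
        conv_rhs => rw [Finset.sum_comm]
        refine Finset.sum_congr rfl fun i _ => ?_
        rw [Finset.sum_comm]
        exact Finset.sum_congr rfl fun b _ => Finset.sum_congr rfl fun b' _ => by ring

/-- The derivative `P'_u(α; v)` of an operator, as a loop. -/
noncomputable def IsOp.deriv (hP : IsOp w d P) (u α v : Loop n) : Loop n :=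
  velocity (fun s : ℝ => P (u + s • v) α) (hP.smoothFamily (.line u v) (.const α)) 0

namespace IsOp

theorem velocity_const (α : Loop n) (s : ℝ) :
    velocity (fun _ : ℝ => α) (.const α) s = 0 :=
  velocity_eq _ fun _ _ => hasDerivAt_const s _

theorem exists_derivCoeff' (hP : IsOp w d P) :
    ∃ (M : ℕ) (c : Loop n → Loop n → ℕ → Fin n → Fin n → ℝ → ℝ),
    (∀ u α i a b, SmoothPeriodic (c u α i a b)) ∧
    (∀ u α α' x, α.1 =ᶠ[𝓝 x] α'.1 → ∀ i a b, c u α i a b =ᶠ[𝓝 x] c u α' i a b) ∧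
    ∀ u α v x a, (hP.deriv u α v).1 x a =
      ∑ j ∈ Finset.range M, ∑ b, c u α j a b x * jet v x j b := by
  obtain ⟨M, c, h1, h2, h3⟩ := hP.exists_derivCoeff
  refine ⟨M, c, h1, h2, fun u α v x a => ?_⟩
  have h := (h3 _ (.line u v) _ (.const α) 0 x a).deriv
  rw [velocity_const, hP.map_zero, velocity_line, Loop.zero_apply, add_zero, zero_smul,
    add_zero] at h
  exact h

theorem hasDerivAt (hP : IsOp w d P) {U : ℝ → Loop n} (hU : SmoothFamily U) {A : ℝ → Loop n}
    (hA : SmoothFamily A) (s : ℝ) :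
    velocity (fun s => P (U s) (A s)) (hP.smoothFamily hU hA) s =
      hP.deriv (U s) (A s) (velocity U hU s) + P (U s) (velocity A hA s) := by
  obtain ⟨M, c, h1, h2, h3⟩ := hP.exists_derivCoeff
  refine velocity_eq _ fun x a => ?_
  have h := (h3 _ (.line (U s) (velocity U hU s)) _ (.const (A s)) 0 x a).deriv
  rw [velocity_const, hP.map_zero, velocity_line, Loop.zero_apply, add_zero, zero_smul,
    add_zero] at h
  refine (h3 U hU A hA s x a).congr_deriv ?_
  rw [← h]
  rfl

theorem deriv_isLinearMap (hP : IsOp w d P) (u α : Loop n) :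
    IsLinearMap ℝ (hP.deriv u α) := by
  obtain ⟨M, c, _, _, hc⟩ := hP.exists_derivCoeff'
  constructor
  · intro α β
    refine Loop.ext_apply fun x a => ?_
    simp only [Loop.add_apply, hc, jet_add, mul_add, Finset.sum_add_distrib]
  · intro c α
    refine Loop.ext_apply fun x a => ?_
    simp only [Loop.smul_apply, hc, jet_smul, Finset.mul_sum, mul_left_comm]

/-- The derivative of an operator as a linear map in the direction. -/
noncomputable def derivLinear (hP : IsOp w d P) (u α : Loop n) : Loop n →ₗ[ℝ] Loop n :=
  (hP.deriv_isLinearMap u α).mk' _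

theorem derivLinear_apply (hP : IsOp w d P) (u α v : Loop n) :
    hP.derivLinear u α v = hP.deriv u α v := rfl

/-- The adjoint in the direction of variation. Its explicit formula differentiates products of local
coefficients with β, so it is local in both arguments. -/
theorem exists_derivAdjoint (hP : IsOp w d P) : ∃ T : Loop n → Loop n → Loop n → Loop n,
    (∀ u α v β, loopPairing (hP.deriv u α v) β = loopPairing v (T u α β)) ∧
    (∀ u α α' β β' x, α.1 =ᶠ[𝓝 x] α'.1 → β.1 =ᶠ[𝓝 x] β'.1 →
      (T u α β).1 x = (T u α' β').1 x) ∧ ∀ u α, T u α 0 = 0 := by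
  obtain ⟨M, c, h1, h2, h3⟩ := hP.exists_derivCoeff'
  choose T hT hT' using fun u α => exists_adjoint_of_smoothPeriodic M (c u α) (h1 u α)
  refine ⟨T, fun u α v β => hT' u α _ v β (h3 u α v), fun u α α' β β' x hα hβ => ?_,
    fun u α => ?_⟩
  · funext b
    rw [hT, hT]
    refine Finset.sum_congr rfl fun i _ => Finset.sum_congr rfl fun a _ => ?_
    congr 1
    refine Filter.EventuallyEq.iteratedDeriv_eq i ?_
    filter_upwards [h2 u α α' x hα i a b, hβ] with y hy1 hy2
    rw [hy1, hy2]
  · refine Loop.ext_apply fun x b => ?_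
    rw [hT]
    simp

theorem deriv_local (hP : IsOp w d P) (u : Loop n) {α α' v v' : Loop n} {x : ℝ}
    (hα : α.1 =ᶠ[𝓝 x] α'.1) (hv : v.1 =ᶠ[𝓝 x] v'.1) :
    (hP.deriv u α v).1 x = (hP.deriv u α' v').1 x := by
  obtain ⟨M, c, h1, h2, h3⟩ := hP.exists_derivCoeff'
  funext a
  rw [h3, h3, jet_congr hv]
  exact Finset.sum_congr rfl fun i _ => Finset.sum_congr rfl fun b _ => by
    rw [(h2 u α α' x hα i a b).eq_of_nhds]

theorem smoothFamily_deriv {E : Type} [NormedAddCommGroup E] [NormedSpace ℝ E]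
    (hP : IsOp w d P) {U V : E → Loop n} (hU : SmoothFamily U) (α : Loop n)
    (hV : SmoothFamily V) : SmoothFamily fun e => hP.deriv (U e) α (V e) := by
  refine SmoothFamily.velocity_param (U := fun e (s : ℝ) => P (U e + s • V e) α) ?_ 0 _
  exact hP.smoothFamily ((hU.comp contDiff_fst).add (.smul contDiff_snd (hV.comp contDiff_fst)))
    (.const α)

end IsOp

end OpDeriv

/-! ### Total derivatives -/

section TotalDerivative

variable {n : ℕ} {w d e : ℤ}

/-- Integration by parts at the level of densities: F α_{i+1} = ∂(F α_i) - (∂F) α_i, iterated until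
no derivative falls on α. -/
theorem DiffPoly.exists_boundary {F : Jet n → ℝ} (hF : DiffPoly w d F) (i : ℕ) (b : Fin n) :
    ∃ (E : Jet n → ℝ) (C : Loop n → Loop n → ℝ → ℝ), DiffPoly w (d + w * i) E ∧
      IsForm w (d + w * i - w) C ∧
      ∀ u α x, F (jet u x) * jet α x i b = E (jet u x) * α.1 x b + deriv (C u α) x := by
  induction i generalizing d F with
  | zero =>
    refine ⟨F, fun _ _ _ => 0, hF.cast (by simp), .zero _, fun u α x => ?_⟩
    rw [jet_zero, deriv_const', add_zero]
  | succ i ih =>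
    obtain ⟨G, hG, hG'⟩ := hF.exists_totalDeriv
    obtain ⟨E, C, hE, hC, h⟩ := ih hG
    have hFj := hF.isForm i b rfl
    refine ⟨fun z => -E z, fun u α x => F (jet u x) * jet α x i b + (-1) * C u α x,
      hE.neg.cast (by push_cast; ring), (hFj.cast (by push_cast; ring)).add
        ((hC.const_mul (-1)).cast (by push_cast; ring)), fun u α x => ?_⟩
    have h1 := ((hF.smoothPeriodic u).hasDerivAt x).mul (hasDerivAt_jet α x i b)
    have h2 := (h1.add (((hC.smoothPeriodic u α).hasDerivAt x).const_mul (-1))).deriv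
    have h3 := h u α x
    rw [hG'] at h2
    refine (?_ : _ = _ + _).trans (congrArg (-E (jet u x) * α.1 x b + ·) h2.symm)
    linarith

theorem exists_boundary_of_isForm {S : Loop n → Loop n → ℝ → ℝ} (hS : IsForm w d S) :
    ∃ (E : Fin n → Jet n → ℝ) (C : Loop n → Loop n → ℝ → ℝ), (∀ b, DiffPoly w d (E b)) ∧
      IsForm w (d - w) C ∧
      ∀ u α x, S u α x = ∑ b, E b (jet u x) * α.1 x b + deriv (C u α) x := by
  obtain ⟨N, A, hA, hA'⟩ := hS.exists_coeff
  choose E C hE hC h using fun i b => (hA i b).exists_boundary i b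
  refine ⟨fun b z => ∑ i ∈ Finset.range N, E i b z, fun u α x => ∑ i ∈ Finset.range N, ∑ b,
    C i b u α x, fun b => .sum fun i _ => (hE i b).cast (by ring), .sum fun i _ => .sum fun b _ =>
      (hC i b).cast (by ring), fun u α x => ?_⟩
  have hd : deriv (fun x => ∑ i ∈ Finset.range N, ∑ b, C i b u α x) x =
      ∑ i ∈ Finset.range N, ∑ b, deriv (C i b u α) x :=
    (HasDerivAt.fun_sum fun i _ => HasDerivAt.fun_sum (u := Finset.univ) fun b _ =>
      ((hC i b).smoothPeriodic u α).hasDerivAt x).deriv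
  rw [hd, hA' N le_rfl]
  simp only [h, Finset.sum_add_distrib, Finset.sum_mul]
  congr 1
  exact Finset.sum_comm

/-- A linear expression all of whose values have mean zero is a total derivative. -/
theorem exists_primitive_of_isForm {S : Loop n → Loop n → ℝ → ℝ} (hS : IsForm w d S)
    (h : ∀ u α, ∫ x in (0 : ℝ)..1, S u α x = 0) :
    ∃ C, IsForm w (d - w) C ∧ ∀ u α x, S u α x = deriv (C u α) x := by
  obtain ⟨E, C, hE, hC, hS'⟩ := exists_boundary_of_isForm hS
  refine ⟨C, hC, fun u α x => ?_⟩
  obtain ⟨Y, hY, hYE⟩ := exists_loop_of_diffPoly hE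
  -- Modulo total derivatives the expression is the pairing of α with E; mean zero for all α forces
  -- E to vanish on jets of loops.
  have hY0 : Y u = 0 := loopPairing_ext fun v => by
    have h1 := h u v
    simp only [hS'] at h1
    rw [intervalIntegral.integral_add ((SmoothPeriodic.sum fun b _ =>
      ((hE b).smoothPeriodic u).mul (Loop.smoothPeriodic v b)).intervalIntegrable _ _)
      ((hC.smoothPeriodic u v).deriv.intervalIntegrable _ _),
      integral_deriv_eq_zero (hC.smoothPeriodic u v), add_zero] at h1
    rw [loopPairing_comm, map_zero, ← h1]
    refine intervalIntegral.integral_congr fun x _ => ?_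
    simp only [hYE]
  rw [hS', Finset.sum_eq_zero, zero_add]
  intro b _
  rw [← hYE, hY0, Loop.zero_apply, zero_mul]

theorem SmoothFamily.ray (u : Loop n) : SmoothFamily fun τ : ℝ => τ • u :=
  .smul contDiff_id (.const u)

theorem velocity_ray (u : Loop n) (τ : ℝ) : velocity _ (SmoothFamily.ray u) τ = u :=
  velocity_eq _ fun x a => by
    have := (hasDerivAt_id τ).mul_const (u.1 x a)
    rw [one_mul] at this
    exact this

theorem jet_ray (u : Loop n) (τ x : ℝ) : jet (τ • u) x = τ • jet u x :=
  funext fun i => funext fun a => by simp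

/-- The homotopy operator of the Poincaré lemma: the radial direction u is inserted and the result
is averaged along the ray. The exponent m is 0 for functionals and 1 for two-forms. -/
theorem isForm_radialAverage {C : Loop n → Loop n → ℝ → ℝ} (hC : IsForm 1 d C) (m : ℕ) :
    ∃ G, DiffPoly 1 d G ∧
      ∀ u x, G (jet u x) = ∫ τ in (0 : ℝ)..1, τ ^ m * C (τ • u) u x := by
  obtain ⟨M, B, hB, hB'⟩ := hC.exists_coeff
  refine ⟨fun z => ∑ i ∈ Finset.range M, ∑ b, (∫ τ in (0 : ℝ)..1, τ ^ m * B i b (τ • z)) * z i b,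
    .sum fun i _ => .sum fun b _ => ((hB i b).radialAverage m).mul' (.var i b) (by ring),
    fun u x => ?_⟩
  have hi : ∀ i b, Continuous fun τ : ℝ => τ ^ m * B i b (τ • jet u x) * jet u x i b := by
    intro i b
    have : ContDiff ℝ ∞ fun τ : ℝ => B i b (τ • jet u x) := (hB i b).contDiff_comp fun j a => by
      simp only [Pi.smul_apply, smul_eq_mul]; fun_prop
    exact ((continuous_pow m).mul this.continuous).mul continuous_const
  simp only [hB' M le_rfl, jet_ray, Finset.mul_sum, ← mul_assoc]
  rw [intervalIntegral.integral_finsetSum fun i _ =>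
    (continuous_finsetSum _ fun b _ => hi i b).intervalIntegrable _ _]
  refine Finset.sum_congr rfl fun i _ => ?_
  rw [intervalIntegral.integral_finsetSum fun b _ => (hi i b).intervalIntegrable _ _]
  refine Finset.sum_congr rfl fun b _ => ?_
  rw [← intervalIntegral.integral_mul_const]

theorem DiffPoly.exists_variation {F : Jet n → ℝ} (hF : DiffPoly w d F) :
    ∃ S, IsForm w d S ∧ ∀ (U : ℝ → Loop n) (hU : SmoothFamily U) (s x : ℝ),
      HasDerivAt (fun s => F (jet (U s) x)) (S (U s) (velocity U hU s) x) s := by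
  obtain ⟨N, p, hp⟩ := hF.exists_isGrad
  refine ⟨fun u α x => ∑ i ∈ Finset.range N, ∑ b, p i b (jet u x) * jet α x i b,
    .sum fun i _ => .sum fun b _ => (hp.diffPoly i b).isForm i b (by ring), fun U hU s x => ?_⟩
  exact hp.hasDerivAt (fun s => jet (U s) x) _ s fun i b => hU.hasDerivAt_jet s x i b

/-- A homogeneous differential polynomial of positive degree all of whose values have mean zero is
a total derivative. -/
theorem DiffPoly.exists_primitive {F : Jet n → ℝ} (hF : DiffPoly 1 d F) (hd : 1 ≤ d)
    (h : ∀ u, ∫ x in (0 : ℝ)..1, F (jet u x) = 0) :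
    ∃ G, DiffPoly 1 (d - 1) G ∧ ∀ u x, F (jet u x) = deriv (fun y => G (jet u y)) x := by
  obtain ⟨S, hSF, hline⟩ := hF.exists_variation
  -- The integral of F is identically zero, so its derivative in every direction is zero: the first
  -- variation is a linear expression of mean zero.
  obtain ⟨C, hC, hSC⟩ := exists_primitive_of_isForm hSF fun u v => by
    have h1 := hasDerivAt_parametric_integral (f := fun p : ℝ × ℝ => F (jet (u + p.1 • v) p.2))
      (hF.smooth_family (.line u v)) 0
    have h4 : ∀ x, deriv (fun s : ℝ => F (jet (u + s • v) x)) 0 = S u v x := fun x => by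
      have h3 := (hline _ (.line u v) 0 x).deriv
      rwa [velocity_line, zero_smul, add_zero] at h3
    simp only [h, h4] at h1
    exact h1.unique (hasDerivAt_const (0 : ℝ) (0 : ℝ))
  -- Differentiating G in x gives the integral of d/dτ F(τu) over [0, 1], that is F(u) - F(0), and
  -- F(0) = 0 because the degree is positive.
  obtain ⟨G, hG, hG'⟩ := isForm_radialAverage hC 0
  refine ⟨G, hG, fun u x => ?_⟩
  have hCs : ContDiff ℝ ∞ fun q : ℝ × ℝ => C (q.2 • u) u q.1 :=
    (hC.contDiff (.ray u) (.const u)).comp (f := fun q : ℝ × ℝ => (q.2, q.1)) (by fun_prop)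
  simp only [hG', pow_zero, one_mul]
  rw [(hasDerivAt_parametric_integral hCs x).deriv]
  have hFτ : ∀ τ, HasDerivAt (fun τ : ℝ => F (jet (τ • u) x)) (S (τ • u) u x) τ := fun τ => by
    have := hline _ (.ray u) τ x
    rwa [velocity_ray] at this
  have hcont : Continuous fun τ : ℝ => S (τ • u) u x :=
    (hSF.contDiff (.ray u) (.const u)).continuous.comp
      (by fun_prop : Continuous fun τ : ℝ => (τ, x))
  have hS : ∀ τ : ℝ, deriv (fun y => C (τ • u) u y) x = S (τ • u) u x := fun τ =>
    (hSC (τ • u) u x).symm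
  simp only [hS]
  rw [intervalIntegral.integral_eq_sub_of_hasDerivAt (fun τ _ => hFτ τ)
    (hcont.intervalIntegrable _ _), one_smul, zero_smul,
    hF.eq_zero_of_const hd (fun i a _ => jet_zero_loop x i a), sub_zero]

end TotalDerivative

/-! ### Derivatives of adjoint, composed and second derivatives -/

section Derivatives

variable {n : ℕ} {w d e w' d' : ℤ} {P Q : Loop n → Loop n → Loop n}

namespace IsOp

theorem hasDerivAt_line (hP : IsOp w d P) (u α v : Loop n) (x : ℝ) (a : Fin n) :
    HasDerivAt (fun s : ℝ => (P (u + s • v) α).1 x a) ((hP.deriv u α v).1 x a) 0 :=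
  (hP.smoothFamily (.line u v) (.const α)).hasDerivAt 0 x a

theorem deriv_eq_of_hasDerivAt (hP : IsOp w d P) {u α v y : Loop n}
    (h : ∀ x a, HasDerivAt (fun s : ℝ => (P (u + s • v) α).1 x a) (y.1 x a) 0) :
    hP.deriv u α v = y := velocity_eq _ h

theorem hasDerivAt_loopPairing (hP : IsOp w d P) (u α v β : Loop n) :
    HasDerivAt (fun s : ℝ => loopPairing (P (u + s • v) α) β)
      (loopPairing (hP.deriv u α v) β) 0 :=
  (hP.smoothFamily (.line u v) (.const α)).hasDerivAt_loopPairing β 0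

theorem deriv_adjoint (hP : IsOp w d P) (hQ : IsOp w' d' Q)
    (h : ∀ u v β, loopPairing (P u v) β = loopPairing v (Q u β)) (u v β b : Loop n) :
    loopPairing (hP.deriv u v b) β = loopPairing v (hQ.deriv u β b) := by
  have h1 := hP.hasDerivAt_loopPairing u v b β
  have h2 := hQ.hasDerivAt_loopPairing u β b v
  simp only [h] at h1
  rw [loopPairing_comm v]
  simp only [loopPairing_comm _ v] at h2 ⊢
  exact h1.unique h2

theorem deriv_skew (hP : IsOp w d P)
    (h : ∀ u v β, loopPairing (P u v) β = -loopPairing v (P u β)) (u v β b : Loop n) :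
    loopPairing (hP.deriv u v b) β = -loopPairing v (hP.deriv u β b) := by
  have h1 := hP.hasDerivAt_loopPairing u v b β
  have h2 := (hP.hasDerivAt_loopPairing u β b v).neg
  simp only [h] at h1
  rw [loopPairing_comm v]
  simp only [loopPairing_comm _ v] at h2 ⊢
  exact h1.unique h2

theorem deriv_comp (hP : IsOp w d P) (hQ : IsOp w e Q)
    (hPQ : IsOp w' d' fun u α => P u (Q u α)) (u α v : Loop n) :
    hPQ.deriv u α v = hP.deriv u (Q u α) v + P u (hQ.deriv u α v) := by
  have h := hP.hasDerivAt (.line u v) (hQ.smoothFamily (.line u v) (.const α)) 0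
  rw [velocity_line] at h
  simp only [zero_smul, add_zero] at h
  exact h

theorem deriv_add (hP : IsOp w d P) (hQ : IsOp w e Q)
    (hPQ : IsOp w' d' fun u α => P u α + Q u α) (u α v : Loop n) :
    hPQ.deriv u α v = hP.deriv u α v + hQ.deriv u α v :=
  hPQ.deriv_eq_of_hasDerivAt fun x a =>
    (hP.hasDerivAt_line u α v x a).add (hQ.hasDerivAt_line u α v x a)

theorem deriv_sub (hP : IsOp w d P) (hQ : IsOp w e Q)
    (hPQ : IsOp w' d' fun u α => P u α - Q u α) (u α v : Loop n) :
    hPQ.deriv u α v = hP.deriv u α v - hQ.deriv u α v :=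
  hPQ.deriv_eq_of_hasDerivAt fun x a =>
    (hP.hasDerivAt_line u α v x a).sub (hQ.hasDerivAt_line u α v x a)

theorem deriv_comp_linear (L : Loop n →ₗ[ℝ] Loop n)
    (hP : IsOp w d P) (hPL : IsOp w' d' fun u α => P u (L α)) (u α v : Loop n) :
    hPL.deriv u α v = hP.deriv u (L α) v := rfl

theorem deriv_linear_comp (L : Loop n →ₗ[ℝ] Loop n) (hL : IsOp w e fun _ α => L α)
    (hP : IsOp w d P) (hLP : IsOp w' d' fun u α => L (P u α)) (u α v : Loop n) :
    hLP.deriv u α v = L (hP.deriv u α v) := by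
  rw [deriv_comp hL hP hLP, show hL.deriv u (P u α) v = 0 from
    hL.deriv_eq_of_hasDerivAt fun x a => hasDerivAt_const _ _, zero_add]

end IsOp

theorem IsDerivative.deriv_comm {X : Loop n → Loop n} {DX : Loop n → Loop n → Loop n}
    (hX : IsField w d X) (h : IsDerivative X DX) (hDX : IsOp w' d' DX) (u v b : Loop n) :
    hDX.deriv u v b = hDX.deriv u b v := by
  refine hDX.deriv_eq_of_hasDerivAt fun x a => ?_
  have hs : SmoothFamily fun p : ℝ × ℝ => X (u + p.1 • b + p.2 • v) :=
    hX.smoothFamily (((SmoothFamily.const u).add (.smul contDiff_fst (.const b))).add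
      (.smul contDiff_snd (.const v)))
  have hf : ContDiff ℝ ∞ fun p : ℝ × ℝ => (X (u + p.1 • b + p.2 • v)).1 x a :=
    (hs a).comp (f := fun p : ℝ × ℝ => (p, x)) (by fun_prop)
  have h1 := deriv_deriv_comm hf 0 0
  have h2 : ∀ s : ℝ, deriv (fun t : ℝ => (X (u + s • b + t • v)).1 x a) 0 =
      (DX (u + s • b) v).1 x a := fun s => by
    have := (h.hasDerivAt_line (u + s • b) v 0 x a).deriv
    rwa [zero_smul, add_zero] at this
  have h3 : ∀ t : ℝ, deriv (fun s : ℝ => (X (u + s • b + t • v)).1 x a) 0 =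
      (DX (u + t • v) b).1 x a := fun t => by
    have := (h.hasDerivAt_line (u + t • v) b 0 x a).deriv
    rw [zero_smul, add_zero] at this
    simpa only [add_right_comm u] using this
  simp only [h2, h3] at h1
  rwa [(hDX.hasDerivAt_line u b v x a).deriv] at h1

end Derivatives

/-! ### Cocycles of the differential `[P_0, ·]` on bivectors -/

section Cocycles

variable {n : ℕ} {w d e : ℤ} {P Q : Loop n → Loop n → Loop n}

/-- `Q u` is the adjoint of `P u` for every `u`. -/
def IsAdjointPair (P Q : Loop n → Loop n → Loop n) : Prop :=
  ∀ u v β, loopPairing (P u v) β = loopPairing v (Q u β)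

theorem IsSkew.loopPairing (h : IsSkew P) (u α β : Loop n) :
    loopPairing (P u α) β = -loopPairing α (P u β) := h u α β

theorem IsAdjointPair.symm (h : IsAdjointPair P Q) (u v β : Loop n) :
    loopPairing (Q u v) β = loopPairing v (P u β) := by
  rw [loopPairing_comm, ← h, loopPairing_comm]

/-- The closedness condition `[P_0, Q] = 0`, as a condition on a trilinear form. -/
def IsCocycle (g : Matrix (Fin n) (Fin n) ℝ) (hQ : IsOp w d Q) : Prop :=
  ∀ u α β γ, loopPairing (hQ.deriv u α (hydroLinear g β)) γ +
    loopPairing (hQ.deriv u β (hydroLinear g γ)) α +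
    loopPairing (hQ.deriv u γ (hydroLinear g α)) β = 0

variable {g : Matrix (Fin n) (Fin n) ℝ} {X : Loop n → Loop n} {DX DX' : Loop n → Loop n → Loop n}

/-- The Jacobi identity for the bivector `X'_u ∘ P_0 ∘ X'_u^*`, before the change of variables
by `X`. -/
theorem jacobi_transform (hg : g.IsSymm) (hX : IsField w d X) (hDX : IsOp w d DX)
    (hDX' : IsOp w d DX') (hd : IsDerivative X DX) (had : IsAdjointPair DX DX')
    (hR : IsOp w e fun u α => DX u (hydroLinear g (DX' u α))) (u α β γ : Loop n) :
    loopPairing (hR.deriv u α (hydroLinear g (DX' u β))) γ +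
    loopPairing (hR.deriv u β (hydroLinear g (DX' u γ))) α +
    loopPairing (hR.deriv u γ (hydroLinear g (DX' u α))) β = 0 := by
  -- The product rule and adjointness express everything through the second derivative of X. By its
  -- symmetry the six terms of the cyclic sum cancel in pairs.
  have key : ∀ α b γ, loopPairing (hR.deriv u α b) γ =
      loopPairing (hDX.deriv u (hydroLinear g (DX' u α)) b) γ -
      loopPairing (hDX.deriv u (hydroLinear g (DX' u γ)) b) α := by
    intro α b γ
    rw [hDX.deriv_comp ((IsOp.hydroLinear g).comp hDX') hR,
      IsOp.deriv_linear_comp (hydroLinear g) (IsOp.hydroLinear g) hDX', map_add,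
      LinearMap.add_apply, had, loopPairing_hydroLinear hg,
      hDX.deriv_adjoint hDX' had u (hydroLinear g (DX' u γ)) α b,
      loopPairing_comm (hDX'.deriv u α b)]
    ring
  have hs := fun v b => hd.deriv_comm hX hDX u v b
  rw [key, key, key, hs (hydroLinear g (DX' u γ)) (hydroLinear g (DX' u β)),
    hs (hydroLinear g (DX' u α)) (hydroLinear g (DX' u γ)),
    hs (hydroLinear g (DX' u β)) (hydroLinear g (DX' u α))]
  ring

theorem isSkew_coboundary (hg : g.IsSymm) (had : IsAdjointPair DX DX') :
    IsSkew fun u α => DX u (hydroLinear g α) + hydroLinear g (DX' u α) := by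
  intro u α β
  change loopPairing (_ + _) β = -loopPairing α (_ + _)
  rw [map_add, map_add, LinearMap.add_apply, had, loopPairing_hydroLinear hg,
    loopPairing_hydroLinear hg, had.symm, ← neg_neg (loopPairing α (hydroLinear g (DX' u β))),
    ← loopPairing_hydroLinear hg]
  ring

/-- The infinitesimal counterpart of `jacobi_transform`, with the same cancellation by symmetry of
the second derivative of X. -/
theorem isCocycle_coboundary (hg : g.IsSymm) (hX : IsField w d X) (hDX : IsOp w d DX)
    (hDX' : IsOp w d DX') (hd : IsDerivative X DX) (had : IsAdjointPair DX DX')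
    (hR : IsOp w e fun u α => DX u (hydroLinear g α) + hydroLinear g (DX' u α)) :
    IsCocycle g hR := by
  intro u α β γ
  have key : ∀ α b γ, loopPairing (hR.deriv u α b) γ =
      loopPairing (hDX.deriv u (hydroLinear g α) b) γ -
      loopPairing (hDX.deriv u (hydroLinear g γ) b) α := by
    intro α b γ
    rw [IsOp.deriv_add (hDX.comp (IsOp.hydroLinear g)) ((IsOp.hydroLinear g).comp hDX') hR,
      IsOp.deriv_linear_comp (hydroLinear g) (IsOp.hydroLinear g) hDX',
      IsOp.deriv_comp_linear (hydroLinear g) hDX, map_add,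
      LinearMap.add_apply, loopPairing_hydroLinear hg,
      hDX.deriv_adjoint hDX' had u (hydroLinear g γ) α b,
      loopPairing_comm (hDX'.deriv u α b)]
    ring
  have hs := fun v b => hd.deriv_comm hX hDX u v b
  rw [key, key, key, hs (hydroLinear g γ) (hydroLinear g β),
    hs (hydroLinear g α) (hydroLinear g γ), hs (hydroLinear g β) (hydroLinear g α)]
  ring

theorem IsCocycle.sub {hP : IsOp w d P} {hQ : IsOp w e Q} (h : IsCocycle g hP)
    (h' : IsCocycle g hQ) (hPQ : IsOp w d fun u α => P u α - Q u α) : IsCocycle g hPQ := by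
  intro u α β γ
  simp only [hP.deriv_sub hQ hPQ, map_sub, LinearMap.sub_apply]
  linarith [h u α β γ, h' u α β γ]

theorem IsSkew.sub (h : IsSkew P) (h' : IsSkew Q) : IsSkew fun u α => P u α - Q u α := by
  intro u α β
  change HydroPoisson.loopPairing (_ - _) β = -HydroPoisson.loopPairing α (_ - _)
  rw [map_sub, map_sub, LinearMap.sub_apply, h.loopPairing, h'.loopPairing]
  ring

end Cocycles

/-! ### Radial averages and potentials -/

section Potentials

variable {n : ℕ} {w d e : ℤ}

/-- A local field whose values on loops of mean zero are orthogonal to loops of mean zero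
vanishes if it vanishes at the zero loop. -/
theorem IsField.eq_zero_of_orthogonal {X : Loop n → Loop n} (hX : IsField w d X) (h0 : X 0 = 0)
    (h : ∀ v z, ZeroMean v → ZeroMean z → loopPairing (X v) z = 0) (u : Loop n) : X u = 0 :=
  eq_zero_of_local (B := fun v _ => X v) (fun _ _ _ _ _ hv _ => hX.local_apply hv) h0
    (fun v _ z hv _ hz => h v z hv hz) u 0

/-- Here the base loop u stays fixed and only the argument of the operator is cut off. -/
theorem IsOp.eq_zero_of_orthogonal {P : Loop n → Loop n → Loop n} (hP : IsOp w d P) (u : Loop n)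
    (h : ∀ v z, ZeroMean v → ZeroMean z → loopPairing (P u v) z = 0) (v : Loop n) : P u v = 0 :=
  eq_zero_of_local (B := fun v _ => P u v)
    (fun _ _ _ _ _ hv _ => hP.local_apply (EventuallyEq.refl _ _) hv) (hP.map_zero u)
    (fun v _ z hv _ hz => h v z hv hz) v 0

theorem IsField.apply_constLoop {X : Loop n → Loop n} (hX : IsField 1 d X) (hd : 1 ≤ d)
    (c : Fin n → ℝ) : X (constLoop c) = 0 := by
  refine Loop.ext_apply fun x a => ?_
  obtain ⟨F, hF, hF'⟩ := hX a
  rw [hF', hF.eq_zero_of_const hd fun i a hi => by rw [jet_constLoop, if_neg (by omega)]]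
  rfl

theorem constLoop_eq_sum (c : Fin n → ℝ) :
    constLoop c = ∑ b, c b • constLoop (Pi.single b 1) :=
  Loop.ext_apply fun x a => by
    rw [Loop.sum_apply]
    simp [constLoop_apply, Pi.single_apply]

/-- The average `∫₀¹ V_τ dτ` of a smooth family of loops commutes with the pairing. -/
theorem loopPairing_average {V : ℝ → Loop n} (hV : SmoothFamily V) {v : Loop n}
    (h : ∀ x a, v.1 x a = ∫ τ in (0 : ℝ)..1, (V τ).1 x a) (w : Loop n) :
    loopPairing v w = ∫ τ in (0 : ℝ)..1, loopPairing (V τ) w := by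
  have hc : Continuous fun p : ℝ × ℝ => ∑ a, (V p.1).1 p.2 a * w.1 p.2 a :=
    continuous_finsetSum _ fun a _ => (hV a).continuous.mul
      ((Loop.smoothPeriodic w a).continuous.comp continuous_snd)
  have hi : ∀ x a, IntervalIntegrable (fun τ => (V τ).1 x a * w.1 x a) volume 0 1 := fun x a =>
    (((hV a).continuous.comp (by fun_prop : Continuous fun τ : ℝ => (τ, x))).mul
      continuous_const).intervalIntegrable _ _
  have h1 : loopPairing v w =
      ∫ x in (0 : ℝ)..1, ∫ τ in (0 : ℝ)..1, ∑ a, (V τ).1 x a * w.1 x a := by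
    refine intervalIntegral.integral_congr fun x _ => ?_
    simp only [h]
    rw [intervalIntegral.integral_finsetSum fun a _ => hi x a]
    simp only [intervalIntegral.integral_mul_const]
  rw [h1, ← intervalIntegral_intervalIntegral_swap]
  · rfl
  · refine (hc.continuousOn.integrableOn_compact
      (isCompact_Icc.prod isCompact_Icc : IsCompact (Set.Icc (0 : ℝ) 1 ×ˢ Set.Icc (0 : ℝ) 1))).mono_set ?_
    rw [Set.uIoc_of_le zero_le_one]
    exact Set.prod_mono Set.Ioc_subset_Icc_self Set.Ioc_subset_Icc_self

theorem continuous_loopPairing {U : ℝ → Loop n} (hU : SmoothFamily U) (β : Loop n) :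
    Continuous fun s => loopPairing (U s) β := (hU.contDiff_loopPairing β).continuous

/-- Fields with selfadjoint derivative are variational derivatives. -/
theorem IsField.exists_potential {Y : Loop n → Loop n} {DY : Loop n → Loop n → Loop n}
    (hY : IsField 1 d Y) (hDY : IsOp 1 e DY) (hd : IsDerivative Y DY)
    (hself : ∀ u v z, loopPairing (DY u v) z = loopPairing v (DY u z)) :
    ∃ F, DiffPoly 1 d F ∧ ∀ u v : Loop n,
      HasDerivAt (fun s : ℝ => ∫ x in (0 : ℝ)..1, F (jet (u + s • v) x))
        (loopPairing v (Y u)) 0 := by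
  choose F hF hYF using hY
  obtain ⟨A, hA, hA'⟩ := exists_loop_of_diffPoly fun a => (hF a).radialAverage 0
  have hYr : ∀ u : Loop n, SmoothFamily fun τ : ℝ => Y (τ • u) := fun u =>
    IsField.smoothFamily (fun a => ⟨F a, hF a, fun u x => hYF a u x⟩ : IsField 1 d Y) (.ray u)
  have hYs : ∀ {E : Type} [NormedAddCommGroup E] [NormedSpace ℝ E] {U : E → Loop n},
      SmoothFamily U → SmoothFamily fun e => Y (U e) := fun hU =>
    IsField.smoothFamily (fun a => ⟨F a, hF a, fun u x => hYF a u x⟩ : IsField 1 d Y) hU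
  -- The density of the functional ∫₀¹ ⟨Y(τu), u⟩ dτ.
  refine ⟨fun z => ∑ a, z 0 a * ∫ τ in (0 : ℝ)..1, τ ^ 0 * F a (τ • z), .sum fun a _ =>
    (DiffPoly.var 0 a).mul' ((hF a).radialAverage 0) (by simp), fun u v => ?_⟩
  have h1 : ∀ u : Loop n, ∫ x in (0 : ℝ)..1, ∑ a, jet u x 0 a *
      ∫ τ in (0 : ℝ)..1, τ ^ 0 * F a (τ • jet u x) =
      ∫ τ in (0 : ℝ)..1, loopPairing (Y (τ • u)) u := fun u => by
    rw [← loopPairing_average (v := A u) (hYr u) (fun x a => by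
      rw [hA']; simp only [hYF, jet_ray, pow_zero, one_mul]), loopPairing_comm]
    refine intervalIntegral.integral_congr fun x _ => ?_
    simp only [hA', jet_zero]
  simp only [h1]
  have hsm : SmoothFamily fun p : ℝ × ℝ => Y (p.2 • (u + p.1 • v)) := hYs
    (.smul contDiff_snd ((SmoothFamily.const u).add (.smul contDiff_fst (.const v))))
  have h2 := hasDerivAt_parametric_integral
    (f := fun p : ℝ × ℝ => loopPairing (Y (p.2 • (u + p.1 • v))) (u + p.1 • v)) (by
      simp only [map_add, map_smul, smul_eq_mul]
      exact (hsm.contDiff_loopPairing u).add (contDiff_fst.mul (hsm.contDiff_loopPairing v))) 0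
  refine h2.congr_deriv ?_
  have hvel : ∀ τ s : ℝ, velocity (fun s : ℝ => τ • (u + s • v))
      (.smul contDiff_const (.line u v)) s = τ • v := fun τ s => velocity_eq _ fun x a => by
    have := (((hasDerivAt_id s).mul_const (v.1 x a)).const_add (u.1 x a)).const_mul τ
    rw [one_mul] at this
    exact this
  have h3 : ∀ τ β, HasDerivAt (fun s : ℝ => loopPairing (Y (τ • (u + s • v))) β)
      (loopPairing (DY (τ • u) (τ • v)) β) 0 := fun τ β => by
    have hU : SmoothFamily fun s : ℝ => τ • (u + s • v) := .smul contDiff_const (.line u v)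
    refine ((hYs hU).hasDerivAt_loopPairing β 0).congr_deriv ?_
    rw [velocity_eq (hYs hU) fun x a => hd _ hU 0 x a, hvel, zero_smul, add_zero]
  have h4 : ∀ τ : ℝ, deriv (fun s : ℝ => loopPairing (Y (τ • (u + s • v))) (u + s • v)) 0 =
      τ * loopPairing (DY (τ • u) u) v + loopPairing (Y (τ • u)) v := fun τ => by
    have h5 := (h3 τ u).add ((hasDerivAt_id (0 : ℝ)).mul (h3 τ v))
    simp only [map_add, map_smul, smul_eq_mul]
    refine h5.deriv.trans ?_
    simp only [id_eq, zero_mul, add_zero, one_mul, zero_smul]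
    rw [(hDY.isLinearMap _).map_smul, map_smul, LinearMap.smul_apply, smul_eq_mul, hself,
      loopPairing_comm v]
  simp only [h4]
  -- Selfadjointness has turned the integrand of the variation into an exact τ-derivative.
  have h6 : ∀ τ : ℝ, HasDerivAt (fun τ : ℝ => τ * loopPairing (Y (τ • u)) v)
      (τ * loopPairing (DY (τ • u) u) v + loopPairing (Y (τ • u)) v) τ := fun τ => by
    have h7 := (hYr u).hasDerivAt_loopPairing v τ
    rw [velocity_eq (hYr u) fun x a => hd _ (.ray u) τ x a, velocity_ray] at h7
    refine ((hasDerivAt_id τ).mul h7).congr_deriv ?_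
    simp only [id_eq]; ring
  have hc : Continuous fun τ : ℝ => τ * loopPairing (DY (τ • u) u) v +
      loopPairing (Y (τ • u)) v :=
    (continuous_id.mul (continuous_loopPairing (hDY.smoothFamily (.ray u) (.const u)) v)).add
      (continuous_loopPairing (hYr u) v)
  rw [intervalIntegral.integral_eq_sub_of_hasDerivAt (fun τ _ => h6 τ)
    (hc.intervalIntegrable _ _)]
  simp [loopPairing_comm v]

/-- The Poincaré lemma for local `2`-forms. -/
theorem IsOp.exists_primitive {S : Loop n → Loop n → Loop n} (hS : IsOp 1 d S) (hskew : IsSkew S)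
    (hclosed : ∀ u v w z, loopPairing (hS.deriv u v w) z + loopPairing (hS.deriv u w z) v +
      loopPairing (hS.deriv u z v) w = 0) :
    ∃ θ Dθ Dθ', IsField 1 d θ ∧ IsOp 1 d Dθ ∧ IsOp 1 d Dθ' ∧ IsDerivative θ Dθ ∧
      IsAdjointPair Dθ Dθ' ∧ ∀ u v, S u v = Dθ u v - Dθ' u v := by
  -- The primitive is θ(u) = ∫₀¹ τ S_{τu}(u) dτ, the contraction of the two-form with the radial
  -- field.
  choose G hG hG' using fun a => isForm_radialAverage (hS a) 1
  obtain ⟨θ, hθ, hθ'⟩ := exists_loop_of_diffPoly hG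
  obtain ⟨Dθ, hDθ, hd⟩ := hθ.exists_isDerivative
  obtain ⟨Dθ', hDθ', had⟩ := hDθ.exists_adjoint
  refine ⟨θ, Dθ, Dθ', hθ, hDθ, hDθ', hd, had, fun u v => loopPairing_ext_left fun w => ?_⟩
  have hSr : ∀ u v : Loop n, SmoothFamily fun τ : ℝ => S (τ • u) v := fun u v =>
    hS.smoothFamily (.ray u) (.const v)
  have h1 : ∀ u w, loopPairing (θ u) w = ∫ τ in (0 : ℝ)..1, τ * loopPairing (S (τ • u) u) w :=
    fun u w => by
    rw [loopPairing_average (V := fun τ : ℝ => τ • S (τ • u) u) (.smul contDiff_id (hSr u u))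
      fun x a => by rw [hθ', hG']; simp]
    simp
  have h2 : ∀ v w, loopPairing (Dθ u v) w = ∫ τ in (0 : ℝ)..1,
      (τ ^ 2 * loopPairing (hS.deriv (τ • u) u v) w + τ * loopPairing (S (τ • u) v) w) := by
    intro v w
    have hsm : SmoothFamily fun p : ℝ × ℝ => S (p.2 • (u + p.1 • v)) (u + p.1 • v) :=
      hS.smoothFamily
        (.smul contDiff_snd ((SmoothFamily.const u).add (.smul contDiff_fst (.const v))))
        ((SmoothFamily.const u).add (.smul contDiff_fst (.const v)))
    have h3 := hasDerivAt_parametric_integral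
      (f := fun p : ℝ × ℝ => p.2 * loopPairing (S (p.2 • (u + p.1 • v)) (u + p.1 • v)) w)
      (contDiff_snd.mul (hsm.contDiff_loopPairing w)) 0
    simp only [← h1] at h3
    have h4 := ((hθ.smoothFamily (.line u v)).hasDerivAt_loopPairing w 0)
    rw [velocity_eq (hθ.smoothFamily (.line u v)) fun x a => hd _ (.line u v) 0 x a,
      velocity_line, zero_smul, add_zero] at h4
    rw [h4.unique h3]
    congr 1
    funext τ
    have hU : SmoothFamily fun s : ℝ => τ • (u + s • v) := .smul contDiff_const (.line u v)
    have hvel : velocity _ hU 0 = τ • v := velocity_eq _ fun x a => by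
      have := (((hasDerivAt_id (0 : ℝ)).mul_const (v.1 x a)).const_add (u.1 x a)).const_mul τ
      rw [one_mul] at this
      exact this
    have h5 := ((hS.smoothFamily hU (.line u v)).hasDerivAt_loopPairing w 0).const_mul τ
    rw [hS.hasDerivAt hU (.line u v), velocity_line, hvel] at h5
    simp only [zero_smul, add_zero] at h5
    rw [h5.deriv, (hS.deriv_isLinearMap _ _).map_smul, map_add, LinearMap.add_apply, map_smul,
      LinearMap.smul_apply, smul_eq_mul]
    ring
  have hdr : ∀ v w : Loop n, Continuous fun τ : ℝ => τ ^ 2 * loopPairing (hS.deriv (τ • u) u v) w +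
      τ * loopPairing (S (τ • u) v) w := fun v w =>
    ((continuous_pow 2).mul (continuous_loopPairing (hS.smoothFamily_deriv (.ray u) u (.const v))
      w)).add (continuous_id.mul (continuous_loopPairing (hSr u v) w))
  rw [map_sub, LinearMap.sub_apply, IsAdjointPair.symm had, loopPairing_comm v, h2, h2,
    ← intervalIntegral.integral_sub ((hdr v w).intervalIntegrable _ _)
    ((hdr w v).intervalIntegrable _ _)]
  -- Closedness and skewsymmetry make the antisymmetrized derivative of θ exact in τ; the endpoints
  -- contribute ⟨S_u v, w⟩ and 0.
  have h6 : ∀ τ : ℝ, HasDerivAt (fun τ : ℝ => τ ^ 2 * loopPairing (S (τ • u) v) w)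
      (τ ^ 2 * loopPairing (hS.deriv (τ • u) u v) w + τ * loopPairing (S (τ • u) v) w -
        (τ ^ 2 * loopPairing (hS.deriv (τ • u) u w) v + τ * loopPairing (S (τ • u) w) v)) τ := by
    intro τ
    have h7 := (hSr u v).hasDerivAt_loopPairing w τ
    rw [hS.hasDerivAt (.ray u) (.const v), velocity_ray, IsOp.velocity_const, hS.map_zero,
      add_zero] at h7
    refine ((hasDerivAt_pow 2 τ).mul h7).congr_deriv ?_
    have h8 := hclosed (τ • u) u v w
    have h9 := hS.deriv_skew hskew (τ • u) v u w
    have h10 := hS.deriv_skew hskew (τ • u) w v u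
    have h11 := hskew.loopPairing (τ • u) w v
    rw [loopPairing_comm w] at h10 h11
    rw [loopPairing_comm v] at h9
    push_cast
    linear_combination (-τ ^ 2) * h8 + τ ^ 2 * h9 + τ ^ 2 * h10 + τ * h11
  rw [intervalIntegral.integral_eq_sub_of_hasDerivAt (fun τ _ => h6 τ)
    (((hdr v w).sub (hdr w v)).intervalIntegrable _ _)]
  simp

end Potentials

/-! ### Triviality of homogeneous cocycles -/

section Cohomology

variable {n : ℕ} {d : ℤ} {g : Matrix (Fin n) (Fin n) ℝ} {Q : Loop n → Loop n → Loop n}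

/-- With two constant entries only one term of the cocycle condition survives, so ⟨Q_u c, c'⟩ is
constant along directions P_0 γ. One such direction leads from the mean of u to u, and at a constant
loop Q c is zero by degree. -/
theorem IsCocycle.pairing_constLoop (hdet : IsUnit g.det) {hQ : IsOp 1 d Q}
    (hcoc : IsCocycle g hQ) (hd : 1 ≤ d) (u : Loop n) (c c' : Fin n → ℝ) :
    loopPairing (Q u (constLoop c)) (constLoop c') = 0 := by
  set m : Fin n → ℝ := fun a => ∫ x in (0 : ℝ)..1, u.1 x a with hm
  have hz : ZeroMean (u - constLoop m) := fun a => by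
    simp only [Loop.sub_apply, constLoop_apply]
    rw [intervalIntegral.integral_sub ((Loop.smoothPeriodic u a).intervalIntegrable _ _)
      intervalIntegrable_const]
    simp [hm]
  obtain ⟨γ, hγ⟩ := hz.exists_hydroLinear hdet
  have hline := SmoothFamily.line (constLoop m) (hydroLinear g γ)
  have hder : ∀ s : ℝ, HasDerivAt (fun s : ℝ => loopPairing
      (Q (constLoop m + s • hydroLinear g γ) (constLoop c)) (constLoop c')) 0 s := fun s => by
    refine ((hQ.smoothFamily hline (.const _)).hasDerivAt_loopPairing _ s).congr_deriv ?_
    rw [hQ.hasDerivAt hline (.const _), velocity_line, IsOp.velocity_const, hQ.map_zero, add_zero]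
    have h := hcoc (constLoop m + s • hydroLinear g γ) (constLoop c') (constLoop c) γ
    rw [hydroLinear_constLoop, hydroLinear_constLoop, (hQ.deriv_isLinearMap _ _).map_zero,
      (hQ.deriv_isLinearMap _ _).map_zero] at h
    simpa using h
  have h01 := is_const_of_deriv_eq_zero (fun s => (hder s).differentiableAt)
    (fun s => (hder s).deriv) 1 0
  simp only [one_smul, zero_smul, add_zero, hγ] at h01
  rw [add_sub_cancel] at h01
  rw [h01, (hQ.apply_const c).apply_constLoop hd, map_zero, LinearMap.zero_apply]

/-- A field all of whose values have mean zero is a total derivative. -/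
theorem IsField.exists_hydroLinear (hdet : IsUnit g.det) {Y : Loop n → Loop n}
    (hY : IsField 1 d Y) (hd : 1 ≤ d) (h : ∀ u, ZeroMean (Y u)) :
    ∃ Z, IsField 1 (d - 1) Z ∧ ∀ u, hydroLinear g (Z u) = Y u := by
  choose F hF hYF using hY
  have h' : ∀ a u, ∫ x in (0 : ℝ)..1, F a (jet u x) = 0 := fun a u => by
    simpa only [hYF] using h u a
  choose G hG hFG using fun a => (hF a).exists_primitive hd (h' a)
  obtain ⟨W, hW, hW'⟩ := exists_loop_of_diffPoly hG
  refine ⟨fun u => matrixMul g⁻¹ (W u), ((IsOp.matrixMul g⁻¹).apply_field hW).cast (by ring),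
    fun u => ?_⟩
  rw [hydroLinear_apply, loopDeriv_matrixMul, matrixMul_matrixMul, Matrix.mul_nonsing_inv g hdet,
    matrixMul_one]
  refine Loop.ext_apply fun x a => ?_
  rw [hYF, hFG, loopDeriv_apply, ← deriv_jet]
  exact congrArg (deriv · x) (funext fun y => by rw [jet_zero, hW'])

/-- By `IsCocycle.pairing_constLoop` the loop Q_u c has mean zero, so P_0 can be stripped off; what
remains is a variational derivative. -/
theorem IsCocycle.exists_potential (hg : g.IsSymm) (hdet : IsUnit g.det) {hQ : IsOp 1 d Q}
    (hcoc : IsCocycle g hQ) (hskew : IsSkew Q) (hd : 1 ≤ d) (c : Fin n → ℝ) :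
    ∃ Y F, IsField 1 (d - 1) Y ∧ DiffPoly 1 (d - 1) F ∧
      (∀ u, hydroLinear g (Y u) = Q u (constLoop c)) ∧ ∀ u v : Loop n,
      HasDerivAt (fun s : ℝ => ∫ x in (0 : ℝ)..1, F (jet (u + s • v) x))
        (loopPairing v (Y u)) 0 := by
  obtain ⟨Y, hY, hYQ⟩ := (hQ.apply_const c).exists_hydroLinear hdet hd fun u =>
    zeroMean_iff.2 fun a => hcoc.pairing_constLoop hdet hd u c _
  obtain ⟨DY, hDY, hder⟩ := hY.exists_isDerivative
  obtain ⟨DY', hDY', had⟩ := hDY.exists_adjoint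
  have hDQ : ∀ u v, hQ.deriv u (constLoop c) v = hydroLinear g (DY u v) := fun u v =>
    hQ.deriv_eq_of_hasDerivAt fun x a => by
      simp only [← hYQ, hydroLinear_apply, matrixMul_apply, loopDeriv_apply]
      refine HasDerivAt.fun_sum fun b _ => HasDerivAt.const_mul _ ?_
      have h := (hY.smoothFamily (.line u v)).hasDerivAt_jet 0 x 1 b
      rwa [velocity_eq _ fun x a => hder _ (.line u v) 0 x a, velocity_line, zero_smul,
        add_zero] at h
  -- The cocycle condition with one constant entry is selfadjointness of the derivative of Y on
  -- loops of mean zero; locality extends it to all loops.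
  have h0 : ∀ u v, DY u v - DY' u v = 0 := fun u => by
    refine (hDY.sub hDY').eq_zero_of_orthogonal u fun v z hv hz => ?_
    obtain ⟨β, rfl⟩ := hv.exists_hydroLinear hdet
    obtain ⟨γ, rfl⟩ := hz.exists_hydroLinear hdet
    have h := hcoc u (constLoop c) β γ
    rw [hydroLinear_constLoop, (hQ.deriv_isLinearMap _ _).map_zero, map_zero,
      LinearMap.zero_apply, add_zero, hQ.deriv_skew hskew u β, hDQ, hDQ,
      loopPairing_hydroLinear hg, loopPairing_comm β, loopPairing_hydroLinear hg] at h
    rw [map_sub, LinearMap.sub_apply, IsAdjointPair.symm had, loopPairing_comm (hydroLinear g β)]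
    linarith
  obtain ⟨F, hF, hF'⟩ := hY.exists_potential hDY hder fun u v z => by
    rw [had, ← sub_eq_zero.1 (h0 u z)]
  exact ⟨Y, F, hY, hF, hYQ, hF'⟩

/-- Up to a coboundary, a cocycle annihilates constant one-forms. -/
theorem IsCocycle.exists_field (hg : g.IsSymm) (hdet : IsUnit g.det) {hQ : IsOp 1 d Q}
    (hcoc : IsCocycle g hQ) (hskew : IsSkew Q) (hd : 1 ≤ d) :
    ∃ X DX DX', IsField 1 (d - 1) X ∧ IsOp 1 (d - 1) DX ∧ IsOp 1 (d - 1) DX' ∧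
      IsDerivative X DX ∧ IsAdjointPair DX DX' ∧
      ∀ u c, hydroLinear g (DX' u (constLoop c)) = Q u (constLoop c) := by
  choose Y F hY hF hYQ hYF using fun b : Fin n =>
    hcoc.exists_potential hg hdet hskew hd (Pi.single b 1)
  -- The densities become the components of X: pairing X with the b-th basis covector gives the
  -- functional of F_b, so X'* sends that covector to Y_b.
  obtain ⟨X, hX, hXF⟩ := exists_loop_of_diffPoly hF
  obtain ⟨DX, hDX, hder⟩ := hX.exists_isDerivative
  obtain ⟨DX', hDX', had⟩ := hDX.exists_adjoint
  refine ⟨X, DX, DX', hX, hDX, hDX', hder, had, fun u c => ?_⟩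
  have h1 : ∀ b, DX' u (constLoop (Pi.single b 1)) = Y b u := fun b => by
    refine loopPairing_ext fun v => ?_
    rw [← had]
    have h2 := (hX.smoothFamily (.line u v)).hasDerivAt_loopPairing (constLoop (Pi.single b 1)) 0
    rw [velocity_eq _ fun x a => hder _ (.line u v) 0 x a, velocity_line, zero_smul,
      add_zero] at h2
    have h3 : ∀ s : ℝ, loopPairing (X (u + s • v)) (constLoop (Pi.single b 1)) =
        ∫ x in (0 : ℝ)..1, F b (jet (u + s • v) x) := fun s => by
      rw [loopPairing_constLoop, Finset.sum_eq_single b]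
      · simp [hXF]
      · intro a _ hab
        simp [hab]
      · simp
    simp only [h3] at h2
    exact h2.unique (hYF b u v)
  rw [constLoop_eq_sum, hDX'.map_sum, hQ.map_sum, map_sum]
  refine Finset.sum_congr rfl fun b _ => ?_
  rw [(hDX'.isLinearMap u).map_smul, (hQ.isLinearMap u).map_smul, map_smul, h1, hYQ]

/-- A skewsymmetric operator that annihilates constants factors as `P_0 ∘ S ∘ P_0`. -/
theorem IsSkew.exists_factor (hg : g.IsSymm) (hdet : IsUnit g.det) (hQ : IsOp 1 d Q)
    (hskew : IsSkew Q) (hd : 2 ≤ d) (h0 : ∀ u c, Q u (constLoop c) = 0) :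
    ∃ S, IsOp 1 (d - 2) S ∧ IsSkew S ∧
      ∀ u α, Q u α = hydroLinear g (S u (hydroLinear g α)) := by
  obtain ⟨N, A, hA, hQA⟩ := hQ.exists_coeff
  -- Killing constants means having no term of order zero, so a derivative splits off on the right.
  have hA0 : ∀ u x a b, A 0 a b (jet u x) = 0 := fun u x a b => by
    have h := hQA (N + 1) (by omega) u (constLoop (Pi.single b 1)) x a
    rw [h0, Loop.zero_apply, Finset.sum_range_succ'] at h
    simpa [jet_constLoop, Pi.single_apply] using h.symm
  obtain ⟨B, hB, hB'⟩ := exists_loop_of_isForm (w := 1) (d := d - 1)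
    (S := fun a u α x => ∑ i ∈ Finset.range N, ∑ b, A (i + 1) a b (jet u x) * jet α x i b)
    fun a => .sum fun i _ => .sum fun b _ => (hA (i + 1) a b).isForm i b (by push_cast; ring)
  have hQB : ∀ u α, Q u α = B u (loopDeriv α) := fun u α => Loop.ext_apply fun x a => by
    rw [hQA (N + 1) (by omega), Finset.sum_range_succ', hB']
    simp [hA0, jet_loopDeriv]
  obtain ⟨B', hB'', had⟩ := hB.exists_adjoint
  -- Skewsymmetry of Q makes B* c orthogonal to derivatives. The cutoff is applied to the base loop,
  -- and B* c must vanish at zero; this uses that its degree d - 1 is positive.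
  have hB0 : ∀ u (c : Fin n → ℝ), B' u (constLoop c) = 0 := fun u c => by
    refine (hB''.apply_const c).eq_zero_of_orthogonal
      ((hB''.apply_const c).apply_constLoop (by omega) 0) (fun v z _ hz => ?_) u
    obtain ⟨γ, rfl⟩ := hz.exists_loopDeriv
    rw [IsAdjointPair.symm had, ← hQB, loopPairing_comm, hskew.loopPairing, h0, map_zero, neg_zero]
  -- Since B* kills constants, the components of B have mean zero, and a derivative splits off on
  -- the left.
  choose C hC hBC using fun a => exists_primitive_of_isForm (hB a) fun u v => by
    have h := had u v (constLoop (Pi.single a 1))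
    rw [hB0, map_zero] at h
    rw [loopPairing_constLoop] at h
    simpa [Pi.single_apply] using h
  obtain ⟨W, hW, hW'⟩ := exists_loop_of_isForm hC
  have hWB : ∀ u v, loopDeriv (W u v) = B u v := fun u v => Loop.ext_apply fun x a => by
    rw [hBC, loopDeriv_apply, ← deriv_jet]
    exact congrArg (deriv · x) (funext fun y => by rw [jet_zero, hW'])
  have hS : IsOp 1 (d - 2) fun u α => matrixMul g⁻¹ (W u (matrixMul g⁻¹ α)) :=
    ((IsOp.matrixMul g⁻¹).comp (hW.comp (IsOp.matrixMul g⁻¹))).cast (by ring)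
  have hQS : ∀ u α, Q u α =
      hydroLinear g (matrixMul g⁻¹ (W u (matrixMul g⁻¹ (hydroLinear g α)))) := fun u α => by
    rw [hydroLinear_apply, hydroLinear_apply, loopDeriv_matrixMul, matrixMul_matrixMul,
      matrixMul_matrixMul, Matrix.mul_nonsing_inv g hdet, Matrix.nonsing_inv_mul g hdet,
      matrixMul_one, matrixMul_one, hWB, hQB]
  refine ⟨_, hS, ?_, hQS⟩
  obtain ⟨S', hS', hSad⟩ := hS.exists_adjoint
  intro u v z
  -- Skewsymmetry of Q gives that of S between loops of mean zero only; locality gives the rest.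
  have h := (hS.add hS').eq_zero_of_orthogonal u (fun v z hv hz => by
    obtain ⟨α, rfl⟩ := hv.exists_hydroLinear hdet
    obtain ⟨β, rfl⟩ := hz.exists_hydroLinear hdet
    have h := hskew.loopPairing u α β
    rw [hQS, hQS, loopPairing_hydroLinear hg, loopPairing_comm α, loopPairing_hydroLinear hg] at h
    rw [map_add, LinearMap.add_apply, IsAdjointPair.symm hSad,
      loopPairing_comm (hydroLinear g α)]
    linarith) z
  change HydroPoisson.loopPairing _ _ = -HydroPoisson.loopPairing _ _
  rw [hSad, ← map_neg]
  congr 1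
  exact eq_neg_of_add_eq_zero_right h

/-- The two-form of a cocycle of the form `P_0 ∘ S ∘ P_0` is closed. -/
theorem closed_of_isCocycle (hg : g.IsSymm) (hdet : IsUnit g.det) (hQ : IsOp 1 d Q)
    (hcoc : IsCocycle g hQ) {S : Loop n → Loop n → Loop n} {e : ℤ} (hS : IsOp 1 e S)
    (hskew : IsSkew S) (hQS : ∀ u α, Q u α = hydroLinear g (S u (hydroLinear g α)))
    (u v w z : Loop n) : loopPairing (hS.deriv u v w) z + loopPairing (hS.deriv u w z) v +
      loopPairing (hS.deriv u z v) w = 0 := by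
  obtain rfl : Q = fun u α => hydroLinear g (S u (hydroLinear g α)) :=
    funext fun u => funext fun α => hQS u α
  obtain ⟨T, hT, hTl, hT0⟩ := hS.exists_derivAdjoint
  -- The cyclic sum is written as the pairing of z with a loop local in v and w, which puts it in
  -- reach of `eq_zero_of_local`.
  have hB : ∀ v w z, loopPairing (hS.deriv u v w - hS.deriv u w v + T u w v) z =
      loopPairing (hS.deriv u v w) z + loopPairing (hS.deriv u w z) v +
      loopPairing (hS.deriv u z v) w := fun v w z => by
    rw [map_add, map_sub, LinearMap.add_apply, LinearMap.sub_apply, loopPairing_comm (T u w v),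
      ← hT, hS.deriv_skew hskew u z w v, loopPairing_comm z]
    ring
  have h0 := eq_zero_of_local (B := fun v w => hS.deriv u v w - hS.deriv u w v + T u w v)
    (fun v v' w w' x hv hw => by
      funext a
      simp only [Loop.add_apply, Loop.sub_apply]
      rw [hS.deriv_local u hv hw, hS.deriv_local u hw hv, hTl u w w' v v' x hw hv])
    (by rw [hT0, sub_self, add_zero]) (fun v w z hv hw hz => by
      obtain ⟨α, rfl⟩ := hv.exists_hydroLinear hdet
      obtain ⟨β, rfl⟩ := hw.exists_hydroLinear hdet
      obtain ⟨γ, rfl⟩ := hz.exists_hydroLinear hdet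
      have hd : ∀ α b, hQ.deriv u α b = hydroLinear g (hS.deriv u (hydroLinear g α) b) :=
        fun α b => IsOp.deriv_linear_comp (hydroLinear g) (IsOp.hydroLinear g)
          (hS.comp (IsOp.hydroLinear g)) hQ u α b
      have h := hcoc u α β γ
      rw [hd, hd, hd, loopPairing_hydroLinear hg, loopPairing_hydroLinear hg,
        loopPairing_hydroLinear hg] at h
      rw [hB]
      linarith) v w
  rw [← hB, h0, map_zero, LinearMap.zero_apply]

/-- Every skewsymmetric homogeneous cocycle of degree at least two is the coboundary of a
homogeneous vector field. -/
theorem IsCocycle.exists_coboundary (hg : g.IsSymm) (hdet : IsUnit g.det) {hQ : IsOp 1 d Q}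
    (hcoc : IsCocycle g hQ) (hskew : IsSkew Q) (hd : 2 ≤ d) :
    ∃ X DX DX', IsField 1 (d - 1) X ∧ IsOp 1 (d - 1) DX ∧ IsOp 1 (d - 1) DX' ∧
      IsDerivative X DX ∧ IsAdjointPair DX DX' ∧
      ∀ u α, Q u α = DX u (hydroLinear g α) + hydroLinear g (DX' u α) := by
  obtain ⟨X, DX, DX', hX, hDX, hDX', hder, had, hc⟩ :=
    hcoc.exists_field hg hdet hskew (by omega)
  have hR : IsOp 1 d fun u α => DX u (hydroLinear g α) + hydroLinear g (DX' u α) :=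
    ((hDX.comp (IsOp.hydroLinear g)).cast (by ring)).add
      (((IsOp.hydroLinear g).comp hDX').cast (by ring))
  have hR' := isCocycle_coboundary hg hX hDX hDX' hder had hR
  have hQ₁ := hQ.sub hR
  have hcoc₁ := hcoc.sub hR' hQ₁
  have hskew₁ := hskew.sub (isSkew_coboundary hg had)
  -- On constants the coboundary of X reduces to P_0 X'* c, which is Q_u c by the choice of X.
  obtain ⟨S, hS, hSskew, hQS⟩ := hskew₁.exists_factor hg hdet hQ₁ hd fun u c => by
    rw [hydroLinear_constLoop, hDX.map_zero, hc, zero_add, sub_self]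
  obtain ⟨θ, Dθ, Dθ', hθ, hDθ, hDθ', hθd, hθad, hSθ⟩ := hS.exists_primitive hSskew
    (closed_of_isCocycle hg hdet hQ₁ hcoc₁ hS hSskew hQS)
  -- The adjoint of P_0 θ' is -θ'* P_0, so the coboundary of P_0 θ is P_0 (θ' - θ'*) P_0, the
  -- remaining part of Q.
  refine ⟨fun u => X u + hydroLinear g (θ u), fun u v => DX u v + hydroLinear g (Dθ u v),
    fun u v => DX' u v - Dθ' u (hydroLinear g v),
    hX.add (((IsOp.hydroLinear g).apply_field hθ).cast (by ring)),
    hDX.add (((IsOp.hydroLinear g).comp hDθ).cast (by ring)),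
    hDX'.sub ((hDθ'.comp (IsOp.hydroLinear g)).cast (by ring)), hder.add ?_, ?_, ?_⟩
  · intro U hU s x a
    simp only [hydroLinear_apply, matrixMul_apply, loopDeriv_apply]
    refine HasDerivAt.fun_sum fun b _ => HasDerivAt.const_mul _ ?_
    have h := (hθ.smoothFamily hU).hasDerivAt_jet s x 1 b
    rwa [velocity_eq _ fun x a => hθd _ hU s x a] at h
  · intro u v β
    rw [map_add, map_sub, LinearMap.add_apply, had, loopPairing_hydroLinear hg, hθad]
    ring
  · intro u α
    have h := hQS u α
    rw [hSθ, sub_eq_iff_eq_add] at h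
    rw [h, map_sub, map_sub]
    refine Loop.ext_apply fun x a => ?_
    simp only [Loop.add_apply, Loop.sub_apply]
    ring

end Cohomology

/-! ### Taylor coefficients -/

section Taylor

/-- The coefficient of `t ^ k` in the Taylor expansion of `f` at `0`. -/
noncomputable def tcoeff (k : ℕ) (f : ℝ → ℝ) : ℝ := iteratedDeriv k f 0 / (k.factorial : ℝ)

variable {f g : ℝ → ℝ} {k : ℕ}

theorem tcoeff_zero (f : ℝ → ℝ) : tcoeff 0 f = f 0 := by simp [tcoeff]

theorem tcoeff_const (c : ℝ) (k : ℕ) : tcoeff k (fun _ => c) = if k = 0 then c else 0 := by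
  rw [tcoeff, iteratedDeriv_const]
  split_ifs with h <;> simp [h]

theorem tcoeff_succ (k : ℕ) (f : ℝ → ℝ) :
    ((k + 1 : ℕ) : ℝ) * tcoeff (k + 1) f = tcoeff k (deriv f) := by
  have h : ((k + 1 : ℕ) : ℝ) ≠ 0 := by positivity
  have h' : (k.factorial : ℝ) ≠ 0 := by positivity
  rw [tcoeff, tcoeff, iteratedDeriv_succ', Nat.factorial_succ]
  push_cast at h ⊢
  field_simp

theorem tcoeff_mul (hf : ContDiff ℝ ∞ f) (hg : ContDiff ℝ ∞ g) :
    tcoeff k (fun t => f t * g t) =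
      ∑ p ∈ Finset.HasAntidiagonal.antidiagonal k, tcoeff p.1 f * tcoeff p.2 g := by
  rw [tcoeff, iteratedDeriv_fun_mul (hf.of_le (by exact_mod_cast le_top)).contDiffAt
    (hg.of_le (by exact_mod_cast le_top)).contDiffAt,
    Finset.Nat.sum_antidiagonal_eq_sum_range_succ fun i j => tcoeff i f * tcoeff j g,
    Finset.sum_div]
  refine Finset.sum_congr rfl fun i hi => ?_
  have hi : i ≤ k := by simpa [Nat.lt_succ_iff] using hi
  have h1 : (i.factorial : ℝ) ≠ 0 := by positivity
  have h2 : ((k - i).factorial : ℝ) ≠ 0 := by positivity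
  have h3 : (k.factorial : ℝ) ≠ 0 := by positivity
  rw [tcoeff, tcoeff, Nat.cast_choose ℝ hi]
  field_simp

theorem tcoeff_add (hf : ContDiff ℝ ∞ f) (hg : ContDiff ℝ ∞ g) :
    tcoeff k (fun t => f t + g t) = tcoeff k f + tcoeff k g := by
  rw [tcoeff, iteratedDeriv_fun_add (hf.of_le (by exact_mod_cast le_top)).contDiffAt
    (hg.of_le (by exact_mod_cast le_top)).contDiffAt, add_div]
  rfl

theorem tcoeff_sum {ι : Type*} {s : Finset ι} {f : ι → ℝ → ℝ}
    (h : ∀ i ∈ s, ContDiff ℝ ∞ (f i)) :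
    tcoeff k (fun t => ∑ i ∈ s, f i t) = ∑ i ∈ s, tcoeff k (f i) := by
  classical
  induction s using Finset.induction_on with
  | empty => simp [tcoeff_const]
  | insert i s hi ih =>
    simp only [Finset.sum_insert hi]
    rw [tcoeff_add (h i (by simp)) (ContDiff.sum fun j hj => h j (by simp [hj])),
      ih fun j hj => h j (by simp [hj])]

theorem tcoeff_mul_const (f : ℝ → ℝ) (c : ℝ) : tcoeff k (fun t => f t * c) = tcoeff k f * c := by
  rw [tcoeff, iteratedDeriv_mul_const_field, tcoeff, div_mul_eq_mul_div]

theorem tcoeff_sub (hf : ContDiff ℝ ∞ f) (hg : ContDiff ℝ ∞ g) :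
    tcoeff k (fun t => f t - g t) = tcoeff k f - tcoeff k g := by
  have h := tcoeff_add (k := k) hf (hg.mul (contDiff_const (c := (-1 : ℝ))))
  rw [tcoeff_mul_const] at h
  simpa [sub_eq_add_neg] using h

theorem tcoeff_pow (m k : ℕ) : tcoeff k (fun t => t ^ m) = if k = m then 1 else 0 := by
  rw [tcoeff, iteratedDeriv_fun_pow_zero]
  split_ifs with h
  · rw [h]
    exact div_self (by positivity)
  · simp

theorem tcoeff_pow_mul (hf : ContDiff ℝ ∞ f) (m k : ℕ) :
    tcoeff k (fun t => t ^ m * f t) = if m ≤ k then tcoeff (k - m) f else 0 := by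
  rw [tcoeff_mul (by fun_prop) hf]
  simp only [tcoeff_pow, ite_mul, one_mul, zero_mul]
  split_ifs with h
  · rw [Finset.sum_eq_single (m, k - m)]
    · simp
    · rintro ⟨p, q⟩ hp hne
      rw [Finset.HasAntidiagonal.mem_antidiagonal] at hp
      refine if_neg fun h' => hne ?_
      simp only at h' hp
      ext <;> simp <;> omega
    · intro h'
      exact absurd (Finset.HasAntidiagonal.mem_antidiagonal.2 (by omega)) h'
  · refine Finset.sum_eq_zero fun p hp => if_neg fun h' => h ?_
    rw [Finset.HasAntidiagonal.mem_antidiagonal] at hp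
    omega

/-- Taylor coefficients of power series with smooth coefficients. -/
theorem tcoeff_sum_pow_mul {N : ℕ} (hk : k ≤ N) {f : ℕ → ℝ → ℝ} (hf : ∀ i, ContDiff ℝ ∞ (f i)) :
    tcoeff k (fun t => ∑ i ∈ Finset.range (N + 1), t ^ i * f i t) =
      ∑ p ∈ Finset.HasAntidiagonal.antidiagonal k, tcoeff p.2 (f p.1) := by
  rw [tcoeff_sum (f := fun i t => t ^ i * f i t) fun i _ => (contDiff_id.pow i).mul (hf i),
    Finset.Nat.sum_antidiagonal_eq_sum_range_succ fun i j => tcoeff j (f i)]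
  simp only [tcoeff_pow_mul (hf _)]
  rw [← Finset.sum_filter]
  refine Finset.sum_congr ?_ fun _ _ => rfl
  ext i
  simp only [Finset.mem_filter, Finset.mem_range]
  omega

theorem tcoeff_sum_pow_mul_const {N : ℕ} (c : ℕ → ℝ) :
    tcoeff k (fun t => ∑ i ∈ Finset.range (N + 1), t ^ i * c i) = if k ≤ N then c k else 0 := by
  rw [tcoeff_sum fun i _ => by fun_prop]
  simp only [tcoeff_mul_const, tcoeff_pow, ite_mul, one_mul, zero_mul]
  rw [Finset.sum_ite_eq]
  simp

end Taylor

section Curves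

variable {n : ℕ} {w d e : ℤ} {F : Jet n → ℝ}

/-- The chain rule read coefficientwise. It is a recursion to lower orders of the partial
derivatives, and it replaces any explicit formula for higher derivatives of a composition. -/
theorem IsGrad.tcoeff_succ {N : ℕ} {p : ℕ → Fin n → Jet n → ℝ} (h : DiffPoly.IsGrad w d F N p)
    {z : ℝ → Jet n} (hz : ∀ i a, ContDiff ℝ ∞ fun t => z t i a) (k : ℕ) :
    ((k + 1 : ℕ) : ℝ) * tcoeff (k + 1) (fun t => F (z t)) =
      ∑ i ∈ Finset.range N, ∑ a, ∑ q ∈ Finset.HasAntidiagonal.antidiagonal k,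
        tcoeff q.1 (fun t => p i a (z t)) *
          (((q.2 + 1 : ℕ) : ℝ) * tcoeff (q.2 + 1) fun t => z t i a) := by
  have hd : ∀ i a, ContDiff ℝ ∞ (deriv fun t => z t i a) := fun i a =>
    (contDiff_infty_iff_deriv.1 (hz i a)).2
  have hp : ∀ i a, ContDiff ℝ ∞ fun t => p i a (z t) := fun i a =>
    (h.diffPoly i a).contDiff_comp hz
  rw [HydroPoisson.tcoeff_succ]
  have h1 : deriv (fun t => F (z t)) = fun t => ∑ i ∈ Finset.range N, ∑ a,
      p i a (z t) * deriv (fun t => z t i a) t := funext fun t =>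
    (h.hasDerivAt z (fun i a => deriv (fun t => z t i a) t) t fun i a =>
      ((hz i a).differentiable (by simp) t).hasDerivAt).deriv
  rw [h1, tcoeff_sum fun i _ => ContDiff.sum fun a _ => (hp i a).mul (hd i a)]
  refine Finset.sum_congr rfl fun i _ => ?_
  rw [tcoeff_sum fun a _ => (hp i a).mul (hd i a)]
  refine Finset.sum_congr rfl fun a _ => ?_
  rw [tcoeff_mul (hp i a) (hd i a)]
  exact Finset.sum_congr rfl fun q _ => by rw [HydroPoisson.tcoeff_succ]

/-- The recursion passes from F to its partial derivatives at strictly lower order, whence strong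
induction with F generalized. -/
theorem DiffPoly.tcoeff_congr (hF : DiffPoly w d F) {z z' : ℝ → Jet n}
    (hz : ∀ i a, ContDiff ℝ ∞ fun t => z t i a) (hz' : ∀ i a, ContDiff ℝ ∞ fun t => z' t i a)
    {k : ℕ} (h : ∀ j ≤ k, ∀ i a, tcoeff j (fun t => z t i a) = tcoeff j fun t => z' t i a) :
    tcoeff k (fun t => F (z t)) = tcoeff k fun t => F (z' t) := by
  induction k using Nat.strong_induction_on generalizing d F with
  | _ k ih =>
    cases k with
    | zero =>
      have h0 : z 0 = z' 0 := funext fun i => funext fun a => by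
        simpa only [tcoeff_zero] using h 0 le_rfl i a
      rw [tcoeff_zero, tcoeff_zero, h0]
    | succ k =>
      obtain ⟨N, p, hp⟩ := hF.exists_isGrad
      have hk : ((k + 1 : ℕ) : ℝ) ≠ 0 := by positivity
      refine mul_left_cancel₀ hk ?_
      rw [IsGrad.tcoeff_succ hp hz, IsGrad.tcoeff_succ hp hz']
      refine Finset.sum_congr rfl fun i _ => Finset.sum_congr rfl fun a _ =>
        Finset.sum_congr rfl fun q hq => ?_
      rw [Finset.HasAntidiagonal.mem_antidiagonal] at hq
      rw [ih q.1 (by omega) (hp.diffPoly i a) fun j hj => h j (by omega),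
        h (q.2 + 1) (by omega) i a]

/-- The Taylor coefficients of a differential polynomial along a curve of maps whose Taylor
coefficients are differential polynomials. -/
theorem DiffPoly.exists_tcoeff (hF : DiffPoly w d F) {r : ℤ} {U : Loop n → ℝ → Loop n}
    (hU : ∀ u, SmoothFamily (U u)) (hU0 : ∀ u, U u 0 = u)
    (h : ∀ (j i : ℕ) (a : Fin n), ∃ G, DiffPoly w (w * i + r * j) G ∧
      ∀ u x, tcoeff j (fun t => jet (U u t) x i a) = G (jet u x)) (k : ℕ) :
    ∃ G, DiffPoly w (d + r * k) G ∧
      ∀ u x, tcoeff k (fun t => F (jet (U u t) x)) = G (jet u x) := by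
  have hz : ∀ u x i a, ContDiff ℝ ∞ fun t => jet (U u t) x i a := fun u x i a =>
    ((hU u).contDiff_jet i a).comp (f := fun t : ℝ => (t, x)) (by fun_prop)
  choose Z hZ hZ' using h
  induction k using Nat.strong_induction_on generalizing d F with
  | _ k ih =>
    cases k with
    | zero => exact ⟨F, hF.cast (by simp), fun u x => by rw [tcoeff_zero, hU0]⟩
    | succ k =>
      obtain ⟨N, p, hp⟩ := hF.exists_isGrad
      have hG : ∀ (q i : ℕ) (a : Fin n), ∃ G, q ≤ k → DiffPoly w (d - w * i + r * q) G ∧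
          ∀ u x, tcoeff q (fun t => p i a (jet (U u t) x)) = G (jet u x) := fun q i a => by
        by_cases hq : q ≤ k
        · obtain ⟨G, hG⟩ := ih q (by omega) (hp.diffPoly i a)
          exact ⟨G, fun _ => hG⟩
        -- A dummy value, outside the range where the induction hypothesis is available or needed.
        · exact ⟨F, fun h => absurd h hq⟩
      choose G hG using hG
      refine ⟨fun z => ((k + 1 : ℕ) : ℝ)⁻¹ * ∑ i ∈ Finset.range N, ∑ a,
        ∑ q ∈ Finset.HasAntidiagonal.antidiagonal k,
          G q.1 i a z * (((q.2 + 1 : ℕ) : ℝ) * Z (q.2 + 1) i a z), ?_, fun u x => ?_⟩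
      · refine .const_mul _ (.sum fun i _ => .sum fun a _ => .sum fun q hq => ?_)
        rw [Finset.HasAntidiagonal.mem_antidiagonal] at hq
        refine (hG q.1 i a (by omega)).1.mul' ((hZ (q.2 + 1) i a).const_mul _) ?_
        rw [← hq]
        push_cast
        ring
      · have hk : ((k + 1 : ℕ) : ℝ) ≠ 0 := by positivity
        rw [eq_inv_mul_iff_mul_eq₀ hk, IsGrad.tcoeff_succ hp (hz u x)]
        refine Finset.sum_congr rfl fun i _ => Finset.sum_congr rfl fun a _ =>
          Finset.sum_congr rfl fun q hq => ?_
        rw [Finset.HasAntidiagonal.mem_antidiagonal] at hq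
        rw [(hG q.1 i a (by omega)).2, hZ']

end Curves

/-! ### Substitution of formal series of maps into fields and operators. -/

section FormalMaps

variable {n : ℕ} {w d r : ℤ} {X : Loop n → Loop n} {P : Loop n → Loop n → Loop n}
  {φ φ' : FormalMap n} {k N : ℕ}

/-- The partial sum `φ_0 + t φ_1 + ⋯ + t^N φ_N`. -/
noncomputable def FormalMap.partialSum (φ : FormalMap n) (N : ℕ) (t : ℝ) (u : Loop n) : Loop n :=
  ∑ j ∈ Finset.range (N + 1), t ^ j • φ j u

theorem FormalMap.partialSum_zero (φ : FormalMap n) (N : ℕ) (u : Loop n) :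
    φ.partialSum N 0 u = φ 0 u := by
  rw [FormalMap.partialSum, Finset.sum_range_succ']
  simp

theorem smoothFamily_partialSum (φ : FormalMap n) (N : ℕ) (u : Loop n) :
    SmoothFamily fun t => φ.partialSum N t u :=
  .sum fun j _ => .smul (contDiff_id.pow j) (.const _)

theorem contDiff_jet_partialSum (φ : FormalMap n) (N : ℕ) (u : Loop n) (x : ℝ) (i : ℕ)
    (a : Fin n) : ContDiff ℝ ∞ fun t => jet (φ.partialSum N t u) x i a :=
  ((smoothFamily_partialSum φ N u).contDiff_jet i a).comp (f := fun t : ℝ => (t, x)) (by fun_prop)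

theorem tcoeff_jet_partialSum (φ : FormalMap n) (N : ℕ) (u : Loop n) (x : ℝ) (i : ℕ)
    (a : Fin n) (k : ℕ) : tcoeff k (fun t => jet (φ.partialSum N t u) x i a) =
      if k ≤ N then jet (φ k u) x i a else 0 := by
  simp only [FormalMap.partialSum, jet_sum, jet_smul]
  exact tcoeff_sum_pow_mul_const _

theorem taylorCoeff_apply (X : Loop n → Loop n) (φ : FormalMap n) (k : ℕ) (u : Loop n) (x : ℝ)
    (a : Fin n) :
    taylorCoeff X φ k u x a = tcoeff k fun t => (X (φ.partialSum k t u)).1 x a := rfl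

theorem taylorCoeff_congr (h : ∀ j ≤ k, φ j = φ' j) : taylorCoeff X φ k = taylorCoeff X φ' k := by
  funext u x a
  simp only [taylorCoeff]
  congr 2
  funext t
  rw [Finset.sum_congr rfl fun j hj => by rw [h j (by simpa [Nat.lt_succ_iff] using hj)]]

theorem taylorCoeff_order_zero (X : Loop n → Loop n) (φ : FormalMap n) (u : Loop n) :
    taylorCoeff X φ 0 u = (X (φ 0 u)).1 := by
  funext x a
  rw [taylorCoeff_apply, tcoeff_zero, FormalMap.partialSum_zero]

theorem taylorCoeff_id (φ : FormalMap n) (k : ℕ) (u : Loop n) :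
    taylorCoeff (fun u => u) φ k u = (φ k u).1 := by
  funext x a
  rw [taylorCoeff_apply]
  simp only [← jet_zero]
  rw [tcoeff_jet_partialSum, if_pos le_rfl]

theorem taylorCoeff_const (v : Loop n) (φ : FormalMap n) (k : ℕ) (u : Loop n) :
    taylorCoeff (fun _ => v) φ k u = if k = 0 then v.1 else 0 := by
  funext x a
  rw [taylorCoeff_apply, tcoeff_const]
  split_ifs <;> rfl

/-- `taylorCoeff` truncates at its own order; this permits one common truncation N for all orders up
to N. -/
theorem DiffPoly.tcoeff_partialSum {F : Jet n → ℝ} (hF : DiffPoly w d F) (φ : FormalMap n)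
    (hk : k ≤ N) (u : Loop n) (x : ℝ) :
    tcoeff k (fun t => F (jet (φ.partialSum N t u) x)) =
      tcoeff k fun t => F (jet (φ.partialSum k t u) x) :=
  hF.tcoeff_congr (contDiff_jet_partialSum φ N u x) (contDiff_jet_partialSum φ k u x)
    fun j hj i a => by
      rw [tcoeff_jet_partialSum, tcoeff_jet_partialSum, if_pos (by omega), if_pos (by omega)]

theorem DiffPoly.exists_tcoeff_partialSum {F : Jet n → ℝ} (hF : DiffPoly w d F)
    (h0 : ∀ u, φ 0 u = u) (hφ : ∀ j : ℕ, IsField w (r * j) (φ j)) (N k : ℕ) :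
    ∃ G, DiffPoly w (d + r * k) G ∧
      ∀ u x, tcoeff k (fun t => F (jet (φ.partialSum N t u) x)) = G (jet u x) := by
  refine hF.exists_tcoeff (fun u => smoothFamily_partialSum φ N u)
    (fun u => by rw [FormalMap.partialSum_zero, h0]) (fun j i a => ?_) k
  obtain ⟨G, hG, hG'⟩ := (hφ j).exists_jet i a
  by_cases hj : j ≤ N
  · exact ⟨G, hG.cast (by ring), fun u x => by rw [tcoeff_jet_partialSum, if_pos hj, hG']⟩
  · exact ⟨_, .zero _, fun u x => by rw [tcoeff_jet_partialSum, if_neg hj]⟩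

/-- The rate r is the degree gained per order of the series: 1 for series in ε, and the degree of
the vector field for a flow in its own time. -/
theorem IsField.exists_taylorCoeff (hX : IsField w d X) (h0 : ∀ u, φ 0 u = u)
    (hφ : ∀ j : ℕ, IsField w (r * j) (φ j)) (k : ℕ) :
    ∃ Y, IsField w (d + r * k) Y ∧ ∀ u, taylorCoeff X φ k u = (Y u).1 := by
  choose F hF hXF using hX
  choose G hG hG' using fun a => (hF a).exists_tcoeff_partialSum h0 hφ k k
  obtain ⟨Y, hY, hY'⟩ := exists_loop_of_diffPoly hG
  refine ⟨Y, hY, fun u => funext fun x => funext fun a => ?_⟩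
  rw [taylorCoeff_apply, hY', ← hG']
  simp only [hXF]

theorem IsOp.tcoeff_partialSum (hP : IsOp w d P) (φ : FormalMap n) (hk : k ≤ N)
    (u α : Loop n) (x : ℝ) (a : Fin n) :
    tcoeff k (fun t => (P (φ.partialSum N t u) α).1 x a) =
      taylorCoeff (fun w => P w α) φ k u x a := by
  obtain ⟨M, A, hA, hA'⟩ := hP.exists_coeff
  have hs : ∀ N i b, ContDiff ℝ ∞ fun t =>
      A i a b (jet (φ.partialSum N t u) x) * jet α x i b := fun N i b =>
    ((hA i a b).contDiff_comp (contDiff_jet_partialSum φ N u x)).mul contDiff_const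
  rw [taylorCoeff_apply]
  simp only [hA' M le_rfl]
  rw [tcoeff_sum fun i _ => ContDiff.sum fun b _ => hs N i b,
    tcoeff_sum fun i _ => ContDiff.sum fun b _ => hs k i b]
  refine Finset.sum_congr rfl fun i _ => ?_
  rw [tcoeff_sum fun b _ => hs N i b, tcoeff_sum fun b _ => hs k i b]
  refine Finset.sum_congr rfl fun b _ => ?_
  rw [tcoeff_mul_const, tcoeff_mul_const, (hA i a b).tcoeff_partialSum φ hk]

theorem IsOp.exists_taylorCoeff (hP : IsOp w d P) (h0 : ∀ u, φ 0 u = u)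
    (hφ : ∀ j : ℕ, IsField w (r * j) (φ j)) (k : ℕ) :
    ∃ Q, IsOp w (d + r * k) Q ∧ ∀ u α, taylorCoeff (fun w => P w α) φ k u = (Q u α).1 := by
  obtain ⟨M, A, hA, hA'⟩ := hP.exists_coeff
  choose G hG hG' using fun i a b => (hA i a b).exists_tcoeff_partialSum h0 hφ k k
  obtain ⟨Q, hQ, hQ'⟩ := exists_loop_of_isForm (w := w) (d := d + r * k)
    (S := fun a u α x => ∑ i ∈ Finset.range M, ∑ b, G i a b (jet u x) * jet α x i b)
    fun a => .sum fun i _ => .sum fun b _ => (hG i a b).isForm i b (by ring)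
  refine ⟨Q, hQ, fun u α => funext fun x => funext fun a => ?_⟩
  have hs : ∀ i b, ContDiff ℝ ∞ fun t =>
      A i a b (jet (φ.partialSum k t u) x) * jet α x i b := fun i b =>
    ((hA i a b).contDiff_comp (contDiff_jet_partialSum φ k u x)).mul contDiff_const
  rw [taylorCoeff_apply, hQ']
  simp only [hA' M le_rfl]
  rw [tcoeff_sum fun i _ => ContDiff.sum fun b _ => hs i b]
  refine Finset.sum_congr rfl fun i _ => ?_
  rw [tcoeff_sum fun b _ => hs i b]
  refine Finset.sum_congr rfl fun b _ => ?_
  rw [tcoeff_mul_const, hG']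

end FormalMaps

/-! ### Division by powers of the deformation parameter -/

section Hadamard

variable {n : ℕ} {E : Type} [NormedAddCommGroup E] [NormedSpace ℝ E]

/-- Hadamard's lemma for smooth families of loops. -/
theorem SmoothFamily.exists_eq_smul [FiniteDimensional ℝ E] {U : ℝ × E → Loop n} (hU : SmoothFamily U)
    (h0 : ∀ e, U (0, e) = 0) :
    ∃ H : ℝ × E → Loop n, SmoothFamily H ∧ ∀ t e, U (t, e) = t • H (t, e) := by
  have hG : ∀ a, ContDiff ℝ ∞ fun p : (ℝ × E) × ℝ =>
      deriv (fun s => (U (s, p.1.2)).1 p.2 a) p.1.1 := fun a => by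
    have h := contDiff_deriv_fst (f := fun q : ℝ × (E × ℝ) => (U (q.1, q.2.1)).1 q.2.2 a)
      ((hU a).comp (f := fun q : ℝ × (E × ℝ) => ((q.1, q.2.1), q.2.2)) (by fun_prop))
    exact h.comp (f := fun p : (ℝ × E) × ℝ => (p.1.1, (p.1.2, p.2))) (by fun_prop)
  have hs : ∀ a, ContDiff ℝ ∞ fun p : (ℝ × E) × ℝ => ∫ σ in (0 : ℝ)..1,
      deriv (fun s => (U (s, p.1.2)).1 p.2 a) (σ * p.1.1) := fun a =>
    contDiff_parametric_integral (f := fun q : ((ℝ × E) × ℝ) × ℝ =>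
      deriv (fun s => (U (s, q.1.1.2)).1 q.1.2 a) (q.2 * q.1.1.1))
      ((hG a).comp (f := fun q : ((ℝ × E) × ℝ) × ℝ => ((q.2 * q.1.1.1, q.1.1.2), q.1.2))
        (by fun_prop))
  refine ⟨fun e => ⟨fun x a => ∫ σ in (0 : ℝ)..1, deriv (fun s => (U (s, e.2)).1 x a) (σ * e.1),
    mem_loop_iff.2 fun a => ⟨(hs a).comp (f := fun x : ℝ => (e, x)) (by fun_prop), fun x => ?_⟩⟩,
    hs, fun t e => Loop.ext_apply fun x a => ?_⟩
  · simp only [(Loop.smoothPeriodic (U _) a).2 x]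
  · have hf : ContDiff ℝ ∞ fun s => (U (s, e)).1 x a :=
      (hU a).comp (f := fun s : ℝ => ((s, e), x)) (by fun_prop)
    have hd : ∀ σ, HasDerivAt (fun σ => (U (σ * t, e)).1 x a)
        (deriv (fun s => (U (s, e)).1 x a) (σ * t) * t) σ := fun σ => by
      have h2 : HasDerivAt (fun σ : ℝ => σ * t) t σ := by
        simpa using (hasDerivAt_id σ).mul_const t
      exact HasDerivAt.comp (h₂ := fun s => (U (s, e)).1 x a) σ
        (hf.differentiable (by simp) (σ * t)).hasDerivAt h2
    have hc : Continuous fun σ => deriv (fun s => (U (s, e)).1 x a) (σ * t) * t :=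
      (((contDiff_infty_iff_deriv.1 hf).2.continuous).comp (by fun_prop)).mul continuous_const
    have h := intervalIntegral.integral_eq_sub_of_hasDerivAt (fun σ _ => hd σ)
      (hc.intervalIntegrable 0 1)
    rw [intervalIntegral.integral_mul_const] at h
    simp only [one_mul, zero_mul, h0, Loop.zero_apply, sub_zero] at h
    rw [Loop.smul_apply, ← h, mul_comm]

theorem SmoothFamily.contDiff_fst {U : ℝ × E → Loop n} (hU : SmoothFamily U) (e : E) (x : ℝ)
    (a : Fin n) : ContDiff ℝ ∞ fun t => (U (t, e)).1 x a :=
  (hU a).comp (f := fun t : ℝ => ((t, e), x)) (by fun_prop)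

/-- Hadamard's lemma iterated: vanishing of the next Taylor coefficient means that the current
quotient vanishes at t = 0. -/
theorem SmoothFamily.exists_eq_pow_smul [FiniteDimensional ℝ E] {U : ℝ × E → Loop n} (hU : SmoothFamily U) (N : ℕ)
    (h : ∀ j < N, ∀ e x a, tcoeff j (fun t => (U (t, e)).1 x a) = 0) :
    ∃ H : ℝ × E → Loop n, SmoothFamily H ∧ (∀ t e, U (t, e) = t ^ N • H (t, e)) ∧
      ∀ e x a, (H (0, e)).1 x a = tcoeff N fun t => (U (t, e)).1 x a := by
  suffices ∃ H : ℝ × E → Loop n, SmoothFamily H ∧ ∀ t e, U (t, e) = t ^ N • H (t, e) by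
    obtain ⟨H, hH, hUH⟩ := this
    refine ⟨H, hH, hUH, fun e x a => ?_⟩
    simp only [hUH, Loop.smul_apply]
    rw [tcoeff_pow_mul (hH.contDiff_fst e x a), if_pos le_rfl, Nat.sub_self, tcoeff_zero]
  induction N with
  | zero => exact ⟨U, hU, fun t e => by simp⟩
  | succ N ih =>
    obtain ⟨H, hH, hUH⟩ := ih fun j hj => h j (by omega)
    have h0 : ∀ e, H (0, e) = 0 := fun e => Loop.ext_apply fun x a => by
      have h1 := h N (by omega) e x a
      simp only [hUH, Loop.smul_apply] at h1
      rwa [tcoeff_pow_mul (hH.contDiff_fst e x a), if_pos le_rfl, Nat.sub_self, tcoeff_zero] at h1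
    obtain ⟨H', hH', hHH'⟩ := hH.exists_eq_smul h0
    exact ⟨H', hH', fun t e => by rw [hUH, hHH', smul_smul, pow_succ]⟩

/-- Division by t^N away from 0, then continuity. It serves to extract the leading term of
identities in t. -/
theorem eq_zero_of_pow_mul_eq_zero {f : ℝ → ℝ} (hf : Continuous f) {N : ℕ}
    (h : ∀ t, t ^ N * f t = 0) : f 0 = 0 := by
  refine congrFun (Continuous.ext_on (dense_compl_singleton (0 : ℝ)) hf continuous_const
    fun t ht => ?_) 0
  exact (mul_eq_zero.1 (h t)).resolve_left (pow_ne_zero N ht)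

/-- Terms with i + j ≤ N cancel along antidiagonals; the others keep a positive power of t after t^N
is removed. This is pointwise in t, so J may itself depend on t. -/
theorem sum_sum_pow_eq {N : ℕ} {J : ℕ → ℕ → ℝ}
    (hJ : ∀ m ≤ N, ∑ p ∈ Finset.HasAntidiagonal.antidiagonal m, J p.1 p.2 = 0) (t : ℝ) :
    ∑ i ∈ Finset.range (N + 1), ∑ j ∈ Finset.range (N + 1), t ^ i * (t ^ j * J i j) =
      t ^ N * ∑ i ∈ Finset.range (N + 1), ∑ j ∈ Finset.range (N + 1),
        if N < i + j then t ^ (i + j - N) * J i j else 0 := by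
  have h1 : ∑ p ∈ (Finset.range (N + 1) ×ˢ Finset.range (N + 1)).filter fun p => p.1 + p.2 ≤ N,
      t ^ (p.1 + p.2) * J p.1 p.2 = 0 := by
    rw [← Finset.sum_fiberwise_of_maps_to (t := Finset.range (N + 1)) (g := fun p => p.1 + p.2)
      fun p hp => by simp at hp ⊢; omega]
    refine Finset.sum_eq_zero fun m hm => ?_
    have hm : m ≤ N := by simpa [Nat.lt_succ_iff] using hm
    rw [Finset.sum_congr (s₂ := Finset.HasAntidiagonal.antidiagonal m)
      (g := fun p => t ^ m * J p.1 p.2), ← Finset.mul_sum, hJ m hm, mul_zero]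
    · ext p
      simp only [Finset.mem_filter, Finset.mem_product, Finset.mem_range,
        Finset.HasAntidiagonal.mem_antidiagonal]
      omega
    · intro p hp
      rw [Finset.HasAntidiagonal.mem_antidiagonal.1 hp]
  rw [← Finset.sum_product', ← Finset.sum_product', Finset.mul_sum,
    ← Finset.sum_filter_add_sum_filter_not _ fun p : ℕ × ℕ => p.1 + p.2 ≤ N]
  simp only [← mul_assoc, ← pow_add]
  rw [h1, zero_add, Finset.sum_filter]
  refine Finset.sum_congr rfl fun p _ => ?_
  simp only [not_le]
  split_ifs with h
  · rw [← mul_assoc, ← pow_add, Nat.add_sub_cancel' h.le]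
  · rw [mul_zero]

end Hadamard

/-! ### The Jacobi identity -/

section Jacobi

variable {n : ℕ} {w w' d e : ℤ} {P Q : Loop n → Loop n → Loop n}

/-- The cyclic sum of `⟨P'_u(α; Q_u β), γ⟩`. -/
noncomputable def jacobiator (hP : IsOp w d P) (Q : Loop n → Loop n → Loop n)
    (u α β γ : Loop n) : ℝ :=
  loopPairing (hP.deriv u α (Q u β)) γ + loopPairing (hP.deriv u β (Q u γ)) α +
    loopPairing (hP.deriv u γ (Q u α)) β

/-- After pairing with γ, skewsymmetry moves the outer operator onto γ and the adjoint disappears,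
leaving cyclic sums. -/
theorem exists_twoSchouten (hP : IsOp w d P) (hQ : IsOp w' e Q) (hPs : IsSkew P) (hQs : IsSkew Q)
    (u α β : Loop n) : ∃ L : Loop n, twoSchouten P Q u α β = L.1 ∧
      ∀ γ, loopPairing L γ = jacobiator hP Q u α β γ + jacobiator hQ P u α β γ := by
  obtain ⟨S, hS, -⟩ := hP.exists_derivAdjoint
  obtain ⟨T, hT, -⟩ := hQ.exists_derivAdjoint
  have hS' : opDerivAdj P u α β = S u α β := adjoint_eq fun v => hS u α v β
  have hT' : opDerivAdj Q u α β = T u α β := adjoint_eq fun v => hT u α v β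
  refine ⟨hP.deriv u α (Q u β) - hP.deriv u β (Q u α) + Q u (S u α β) +
    (hQ.deriv u α (P u β) - hQ.deriv u β (P u α) + P u (T u α β)), ?_, fun γ => ?_⟩
  · rw [twoSchouten, hS', hT']
    rfl
  · simp only [map_add, map_sub, LinearMap.add_apply, LinearMap.sub_apply, jacobiator]
    have h1 := hP.deriv_skew hPs u α β (Q u γ)
    have h2 := hP.deriv_skew hPs u β γ (Q u α)
    have h3 := hQ.deriv_skew hQs u α β (P u γ)
    have h4 := hQ.deriv_skew hQs u β γ (P u α)
    rw [loopPairing_comm α] at h1 h3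
    rw [loopPairing_comm β] at h2 h4
    rw [hQs.loopPairing, hPs.loopPairing u (T u α β), loopPairing_comm (S u α β),
      loopPairing_comm (T u α β), ← hS, ← hT, h1, h2, h3, h4]
    ring

/-- The antidiagonal is symmetric under exchange of indices, so the Schouten condition is twice this
sum. -/
theorem sum_jacobiator_eq_zero {P : ℕ → Loop n → Loop n → Loop n} {d : ℕ → ℤ}
    (hP : ∀ i, IsOp w (d i) (P i)) (hskew : ∀ i, IsSkew (P i)) {m : ℕ} {u α β : Loop n}
    (h : ∑ p ∈ Finset.HasAntidiagonal.antidiagonal m, twoSchouten (P p.1) (P p.2) u α β = 0)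
    (γ : Loop n) : ∑ p ∈ Finset.HasAntidiagonal.antidiagonal m,
      jacobiator (hP p.1) (P p.2) u α β γ = 0 := by
  choose L hL hL' using fun i j => exists_twoSchouten (hP i) (hP j) (hskew i) (hskew j) u α β
  have h0 : ∑ p ∈ Finset.HasAntidiagonal.antidiagonal m, L p.1 p.2 = 0 := by
    refine Subtype.ext ?_
    rw [AddSubmonoidClass.coe_finsetSum]
    simp only [hL] at h
    exact h
  have h1 : ∑ p ∈ Finset.HasAntidiagonal.antidiagonal m,
      (jacobiator (hP p.1) (P p.2) u α β γ + jacobiator (hP p.2) (P p.1) u α β γ) = 0 := by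
    simp only [← hL']
    rw [← LinearMap.sum_apply, ← map_sum, h0, map_zero, LinearMap.zero_apply]
  rw [Finset.sum_add_distrib,
    ← Finset.Nat.sum_antidiagonal_swap (f := fun p : ℕ × ℕ => jacobiator (hP p.2) (P p.1) u α β γ)]
    at h1
  simp only [Prod.fst_swap, Prod.snd_swap] at h1
  linarith

end Jacobi

/-! ### The first obstruction to being a push-forward -/

section Obstruction

variable {n : ℕ} {g : Matrix (Fin n) (Fin n) ℝ} {P : ℕ → Loop n → Loop n → Loop n}
  {Ψ : FormalMap n} {DΨ DΨ' : ℕ → Loop n → Loop n → Loop n} {N : ℕ}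

/-- Homogeneous formal maps tangent to the identity, with their derivatives and the adjoints of
these. -/
structure IsFormalDifferential (Ψ : FormalMap n) (DΨ DΨ' : ℕ → Loop n → Loop n → Loop n) :
    Prop where
  zero : ∀ u, Ψ 0 u = u
  isField : ∀ j : ℕ, IsField 1 j (Ψ j)
  isOp : ∀ j : ℕ, IsOp 1 j (DΨ j)
  isOp' : ∀ j : ℕ, IsOp 1 j (DΨ' j)
  isDerivative : ∀ j, IsDerivative (Ψ j) (DΨ j)
  isAdjointPair : ∀ j, IsAdjointPair (DΨ j) (DΨ' j)

theorem exists_isFormalDifferential (h0 : ∀ u, Ψ 0 u = u) (hΨ : ∀ j : ℕ, IsField 1 j (Ψ j)) :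
    ∃ DΨ DΨ', IsFormalDifferential Ψ DΨ DΨ' := by
  choose DΨ hDΨ hd using fun j => (hΨ j).exists_isDerivative
  choose DΨ' hDΨ' had using fun j => (hDΨ j).exists_adjoint
  exact ⟨DΨ, DΨ', h0, hΨ, hDΨ, hDΨ', hd, had⟩

/-- Partial sums of formal series of operators. -/
noncomputable def partialSumOp (D : ℕ → Loop n → Loop n → Loop n) (N : ℕ) (t : ℝ)
    (u α : Loop n) : Loop n :=
  ∑ j ∈ Finset.range (N + 1), t ^ j • D j u α

theorem isOp_partialSumOp {D : ℕ → Loop n → Loop n → Loop n} {d : ℕ → ℤ}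
    (hD : ∀ j, IsOp 1 (d j) (D j)) (N : ℕ) (t : ℝ) : IsOp 0 0 (partialSumOp D N t) :=
  .sum fun j _ => (hD j).zero_weight.smul (t ^ j)

theorem isAdjointPair_partialSumOp (h : ∀ j, IsAdjointPair (DΨ j) (DΨ' j)) (N : ℕ) (t : ℝ) :
    IsAdjointPair (partialSumOp DΨ N t) (partialSumOp DΨ' N t) := fun u v β => by
  simp only [partialSumOp, map_sum, map_smul, LinearMap.sum_apply, LinearMap.smul_apply, h _ u v β]

theorem smoothFamily_partialSumOp {E : Type} [NormedAddCommGroup E] [NormedSpace ℝ E]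
    {D : ℕ → Loop n → Loop n → Loop n} {d : ℕ → ℤ} (hD : ∀ j, IsOp 1 (d j) (D j)) (N : ℕ)
    {τ : E → ℝ} (hτ : ContDiff ℝ ∞ τ) {U A : E → Loop n} (hU : SmoothFamily U)
    (hA : SmoothFamily A) : SmoothFamily fun e => partialSumOp D N (τ e) (U e) (A e) :=
  .sum fun j _ => .smul (hτ.pow j) ((hD j).smoothFamily hU hA)

theorem smoothFamily_partialSum' {E : Type} [NormedAddCommGroup E] [NormedSpace ℝ E]
    (hΨ : ∀ j : ℕ, IsField 1 j (Ψ j)) (N : ℕ) {τ : E → ℝ} (hτ : ContDiff ℝ ∞ τ)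
    {U : E → Loop n} (hU : SmoothFamily U) :
    SmoothFamily fun e => Ψ.partialSum N (τ e) (U e) :=
  .sum fun j _ => .smul (hτ.pow j) ((hΨ j).smoothFamily hU)

/-- The push-forward of `P_0` by a partial sum of a formal map. -/
noncomputable def pushOp (g : Matrix (Fin n) (Fin n) ℝ) (DΨ DΨ' : ℕ → Loop n → Loop n → Loop n)
    (N : ℕ) (t : ℝ) (u α : Loop n) : Loop n :=
  partialSumOp DΨ N t u (hydroLinear g (partialSumOp DΨ' N t u α))

/-- The term of order `N` of the difference between `P_ε` and the push-forward of `P_0`. -/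
noncomputable def pushDefect (g : Matrix (Fin n) (Fin n) ℝ) (P : ℕ → Loop n → Loop n → Loop n)
    (Ψ : FormalMap n) (DΨ DΨ' : ℕ → Loop n → Loop n → Loop n) (N : ℕ) (u α : Loop n) :
    ℝ → Fin n → ℝ :=
  ∑ p ∈ Finset.HasAntidiagonal.antidiagonal N, taylorCoeff (fun w => P p.1 w α) Ψ p.2 u -
    ∑ p ∈ Finset.HasAntidiagonal.antidiagonal N, (DΨ p.1 u (hydroLinear g (DΨ' p.2 u α))).1

namespace IsFormalDifferential

variable (h : IsFormalDifferential Ψ DΨ DΨ')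

include h

theorem isOp_pushOp (g : Matrix (Fin n) (Fin n) ℝ) (N : ℕ) (t : ℝ) :
    IsOp 0 0 (pushOp g DΨ DΨ' N t) :=
  ((isOp_partialSumOp h.isOp N t).comp ((IsOp.hydroLinear g).comp
    (isOp_partialSumOp h.isOp' N t))).cast (by simp)

theorem exists_pushDefect (g : Matrix (Fin n) (Fin n) ℝ) (hP : ∀ i : ℕ, IsOp 1 (i + 1) (P i))
    (N : ℕ) :
    ∃ Q, IsOp 1 (N + 1) Q ∧ ∀ u α, pushDefect g P Ψ DΨ DΨ' N u α = (Q u α).1 := by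
  choose T hT hT' using fun i q => (hP i).exists_taylorCoeff (r := 1) h.zero
    (fun j => (h.isField j).cast (by simp)) q
  refine ⟨fun u α => ∑ p ∈ Finset.HasAntidiagonal.antidiagonal N, T p.1 p.2 u α -
    ∑ p ∈ Finset.HasAntidiagonal.antidiagonal N, DΨ p.1 u (hydroLinear g (DΨ' p.2 u α)),
    .sub (.sum fun p hp => (hT p.1 p.2).cast ?_) (.sum fun p hp =>
      ((h.isOp p.1).comp ((IsOp.hydroLinear g).comp (h.isOp' p.2))).cast ?_), fun u α => ?_⟩
  · rw [← Finset.HasAntidiagonal.mem_antidiagonal.1 hp]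
    push_cast
    ring
  · rw [← Finset.HasAntidiagonal.mem_antidiagonal.1 hp]
    push_cast
    ring
  · simp only [pushDefect, hT']
    rw [Submodule.coe_sub, AddSubmonoidClass.coe_finsetSum, AddSubmonoidClass.coe_finsetSum]

theorem tcoeff_pushOp (g : Matrix (Fin n) (Fin n) ℝ) {k : ℕ} (hk : k ≤ N) (u α : Loop n) (x : ℝ)
    (a : Fin n) : tcoeff k (fun t => (pushOp g DΨ DΨ' N t u α).1 x a) =
      ∑ p ∈ Finset.HasAntidiagonal.antidiagonal k,
        (DΨ p.1 u (hydroLinear g (DΨ' p.2 u α))).1 x a := by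
  simp only [pushOp, partialSumOp, map_sum, map_smul, (h.isOp _).map_sum,
    ((h.isOp _).isLinearMap u).map_smul, Loop.sum_apply, Loop.smul_apply]
  rw [tcoeff_sum_pow_mul hk fun i => ContDiff.sum fun j _ => by fun_prop]
  refine Finset.sum_congr rfl fun p hp => ?_
  have hp := Finset.HasAntidiagonal.mem_antidiagonal.1 hp
  rw [tcoeff_sum_pow_mul_const, if_pos (by omega)]

theorem tcoeff_defect (g : Matrix (Fin n) (Fin n) ℝ) (hP : ∀ i : ℕ, IsOp 1 (i + 1) (P i))
    {k : ℕ} (hk : k ≤ N) (u α : Loop n) (x : ℝ) (a : Fin n) :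
    tcoeff k (fun t => (pushOp g DΨ DΨ' N t u α - partialSumOp P N t (Ψ.partialSum N t u) α).1 x a)
      = -pushDefect g P Ψ DΨ DΨ' k u α x a := by
  have hs : ∀ i, ContDiff ℝ ∞ fun t => (P i (Ψ.partialSum N t u) α).1 x a := fun i =>
    ((hP i).smoothFamily (smoothFamily_partialSum Ψ N u) (.const α) a).comp
      (f := fun t : ℝ => (t, x)) (by fun_prop)
  have hs' : ContDiff ℝ ∞ fun t => (pushOp g DΨ DΨ' N t u α).1 x a := by
    simp only [pushOp, partialSumOp, map_sum, map_smul, (h.isOp _).map_sum,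
      ((h.isOp _).isLinearMap u).map_smul, Loop.sum_apply, Loop.smul_apply]
    fun_prop
  simp only [Loop.sub_apply]
  rw [tcoeff_sub hs' ?_, h.tcoeff_pushOp g hk]
  · simp only [partialSumOp, Loop.sum_apply, Loop.smul_apply]
    rw [tcoeff_sum_pow_mul hk hs, pushDefect, Pi.sub_apply, Pi.sub_apply, neg_sub,
      Finset.sum_apply, Finset.sum_apply, Finset.sum_apply, Finset.sum_apply]
    congr 1
    refine Finset.sum_congr rfl fun p hp => ?_
    have hp := Finset.HasAntidiagonal.mem_antidiagonal.1 hp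
    rw [(hP p.1).tcoeff_partialSum Ψ (by omega)]
  · simp only [partialSumOp, Loop.sum_apply, Loop.smul_apply]
    exact ContDiff.sum fun i _ => (contDiff_id.pow i).mul (hs i)

/-- If the push-forward of `P_0` agrees with `P_ε` below the order `N`, their difference is
divisible by `ε^N`. -/
theorem exists_defect {E : Type} [NormedAddCommGroup E] [NormedSpace ℝ E] [FiniteDimensional ℝ E]
    (hP : ∀ i : ℕ, IsOp 1 (i + 1) (P i))
    (hpush : ∀ k < N, ∀ u α, pushDefect g P Ψ DΨ DΨ' k u α = 0) {Q : Loop n → Loop n → Loop n}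
    (hQ : ∀ u α, pushDefect g P Ψ DΨ DΨ' N u α = (Q u α).1) {W : E → Loop n}
    (hW : SmoothFamily W) (α : Loop n) :
    ∃ K : ℝ × E → Loop n, SmoothFamily K ∧
      (∀ t e, pushOp g DΨ DΨ' N t (W e) α =
        partialSumOp P N t (Ψ.partialSum N t (W e)) α + t ^ N • K (t, e)) ∧
      ∀ e, K (0, e) = -Q (W e) α := by
  have hW' : SmoothFamily fun p : ℝ × E => W p.2 := hW.comp contDiff_snd
  have hs : SmoothFamily fun p : ℝ × E => pushOp g DΨ DΨ' N p.1 (W p.2) α -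
      partialSumOp P N p.1 (Ψ.partialSum N p.1 (W p.2)) α := by
    refine .sub (smoothFamily_partialSumOp h.isOp N contDiff_fst hW'
      ((IsOp.hydroLinear (w := 1) g).smoothFamily (.const 0)
        (smoothFamily_partialSumOp h.isOp' N contDiff_fst hW' (.const α)))) ?_
    exact smoothFamily_partialSumOp hP N contDiff_fst
      (smoothFamily_partialSum' h.isField N contDiff_fst hW') (.const α)
  -- The base point is kept as a smooth parameter, so that the remainder can later be differentiated
  -- in it.
  obtain ⟨K, hK, hK1, hK2⟩ := hs.exists_eq_pow_smul N fun j hj e x a => by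
    refine (h.tcoeff_defect g hP hj.le (W e) α x a).trans ?_
    simp [hpush j hj]
  refine ⟨K, hK, fun t e => ?_, fun e => Loop.ext_apply fun x a => ?_⟩
  · rw [← hK1, add_sub_cancel]
  · rw [hK2]
    refine (h.tcoeff_defect g hP le_rfl (W e) α x a).trans ?_
    rw [hQ]
    rfl

end IsFormalDifferential

end Obstruction

/-! ### The first obstruction is a skewsymmetric cocycle. -/

section ObstructionCocycle

variable {n : ℕ} {g : Matrix (Fin n) (Fin n) ℝ} {P : ℕ → Loop n → Loop n → Loop n}
  {Ψ : FormalMap n} {DΨ DΨ' : ℕ → Loop n → Loop n → Loop n} {N : ℕ}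
  {Q : Loop n → Loop n → Loop n}

theorem partialSumOp_zero (D : ℕ → Loop n → Loop n → Loop n) (N : ℕ) (u α : Loop n) :
    partialSumOp D N 0 u α = D 0 u α := by
  rw [partialSumOp, Finset.sum_range_succ']
  simp

namespace IsFormalDifferential

theorem deriv_zero (h : IsFormalDifferential Ψ DΨ DΨ') (u v : Loop n) : DΨ 0 u v = v := by
  refine Subtype.ext ?_
  rw [← (h.isDerivative 0).frechet_eq, show Ψ 0 = fun u => u from funext h.zero,
    IsDerivative.id.frechet_eq]

theorem adjoint_zero (h : IsFormalDifferential Ψ DΨ DΨ') (u v : Loop n) : DΨ' 0 u v = v :=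
  loopPairing_ext fun z => by rw [← h.isAdjointPair, h.deriv_zero]

theorem velocity_partialSum (h : IsFormalDifferential Ψ DΨ DΨ') (N : ℕ) (t : ℝ) (u b : Loop n) :
    velocity (fun s : ℝ => Ψ.partialSum N t (u + s • b))
      (smoothFamily_partialSum' h.isField N contDiff_const (.line u b)) 0 =
      partialSumOp DΨ N t u b := by
  refine velocity_eq _ fun x a => ?_
  simp only [FormalMap.partialSum, partialSumOp, Loop.sum_apply, Loop.smul_apply]
  refine HasDerivAt.fun_sum fun j _ => HasDerivAt.const_mul _ ?_
  have := (h.isDerivative j).hasDerivAt_line u b 0 x a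
  rwa [zero_smul, add_zero] at this

theorem isSkew_pushOp (h : IsFormalDifferential Ψ DΨ DΨ') (hg : g.IsSymm) (N : ℕ) (t : ℝ) :
    IsSkew (pushOp g DΨ DΨ' N t) := fun u α β => by
  have had := isAdjointPair_partialSumOp h.isAdjointPair N t
  change loopPairing (pushOp g DΨ DΨ' N t u α) β = -loopPairing α (pushOp g DΨ DΨ' N t u β)
  rw [pushOp, pushOp, had, loopPairing_hydroLinear hg, IsAdjointPair.symm had]

/-- Both the push-forward and P_t are skewsymmetric for every t, hence so is t^N K_t; division by
t^N and t = 0 give the claim for -Q. -/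
theorem isSkew_defect (h : IsFormalDifferential Ψ DΨ DΨ') (hg : g.IsSymm)
    (hP : ∀ i : ℕ, IsOp 1 (i + 1) (P i)) (hskew : ∀ i, IsSkew (P i))
    (hpush : ∀ k < N, ∀ u α, pushDefect g P Ψ DΨ DΨ' k u α = 0)
    (hQ : ∀ u α, pushDefect g P Ψ DΨ DΨ' N u α = (Q u α).1) : IsSkew Q := fun u α β => by
  change loopPairing (Q u α) β = -loopPairing α (Q u β)
  choose K hK hK1 hK2 using h.exists_defect hP hpush hQ (SmoothFamily.const (E := ℝ) u)
  have hKt : ∀ α, SmoothFamily fun t : ℝ => K α (t, 0) := fun α =>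
    (hK α).comp (g := fun t : ℝ => (t, (0 : ℝ))) (by fun_prop)
  have h0 := eq_zero_of_pow_mul_eq_zero (f := fun t => loopPairing (K α (t, 0)) β +
      loopPairing (K β (t, 0)) α) ((continuous_loopPairing (hKt α) β).add
      (continuous_loopPairing (hKt β) α)) (N := N) fun t => by
    have h1 := (h.isSkew_pushOp hg N t).loopPairing u α β
    have h2 : loopPairing (partialSumOp P N t (Ψ.partialSum N t u) α) β =
        -loopPairing α (partialSumOp P N t (Ψ.partialSum N t u) β) := by
      simp only [partialSumOp, map_sum, map_smul, LinearMap.sum_apply, LinearMap.smul_apply,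
        (hskew _).loopPairing _ α β, smul_neg, Finset.sum_neg_distrib]
    rw [hK1 α t 0, hK1 β t 0, map_add, map_add, LinearMap.add_apply, h2, map_smul, map_smul,
      LinearMap.smul_apply, smul_eq_mul, smul_eq_mul, loopPairing_comm α (K β _)] at h1
    linarith
  simp only [hK2, map_neg, LinearMap.neg_apply] at h0
  rw [loopPairing_comm α]
  linarith

/-- One term of the Jacobi identity for the push-forward, expanded through P_t up to t^N B(t). The
value B(0) is the corresponding term of the cocycle condition, with a minus sign because the defect
is P_ε minus the push-forward. -/
theorem exists_remainder (h : IsFormalDifferential Ψ DΨ DΨ')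
    (hP : ∀ i : ℕ, IsOp 1 (i + 1) (P i)) (hP0 : P 0 = hydro g)
    (hpush : ∀ k < N, ∀ u α, pushDefect g P Ψ DΨ DΨ' k u α = 0) {e : ℤ} (hQ' : IsOp 1 e Q)
    (hQ : ∀ u α, pushDefect g P Ψ DΨ DΨ' N u α = (Q u α).1) (u α β γ : Loop n) :
    ∃ B : ℝ → ℝ, Continuous B ∧ B 0 = -loopPairing (hQ'.deriv u α (hydroLinear g β)) γ ∧
      ∀ t, loopPairing ((h.isOp_pushOp g N t).deriv u α
          (hydroLinear g (partialSumOp DΨ' N t u β))) γ =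
        ∑ i ∈ Finset.range (N + 1), ∑ j ∈ Finset.range (N + 1), t ^ i * (t ^ j *
          loopPairing ((hP i).deriv (Ψ.partialSum N t u) α (P j (Ψ.partialSum N t u) β)) γ) +
        t ^ N * B t := by
  set b : ℝ → Loop n := fun t => hydroLinear g (partialSumOp DΨ' N t u β) with hb
  have hbs : SmoothFamily b := (IsOp.hydroLinear (w := 1) g).smoothFamily (.const 0)
    (smoothFamily_partialSumOp h.isOp' N contDiff_id (.const u) (.const β))
  have hb0 : b 0 = hydroLinear g β := by
    rw [hb]
    simp only
    rw [partialSumOp_zero, h.adjoint_zero]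
  obtain ⟨M, hM, hM1, -⟩ := h.exists_defect hP hpush hQ (SmoothFamily.const (E := ℝ) u) β
  -- The direction of differentiation depends on t itself, so the line parameter and t enter as
  -- separate parameters and are put on the diagonal later.
  have hW : SmoothFamily fun e : ℝ × ℝ => u + e.1 • b e.2 :=
    (SmoothFamily.const u).add (.smul contDiff_fst (hbs.comp contDiff_snd))
  obtain ⟨K, hK, hK1, hK2⟩ := h.exists_defect hP hpush hQ hW α
  have hψ : SmoothFamily fun t => Ψ.partialSum N t u := smoothFamily_partialSum Ψ N u
  have hMt : SmoothFamily fun t : ℝ => M (t, 0) :=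
    hM.comp (g := fun t : ℝ => (t, (0 : ℝ))) (by fun_prop)
  have hKt : SmoothFamily fun p : ℝ × ℝ => K (p.1, (p.2, p.1)) :=
    hK.comp (g := fun p : ℝ × ℝ => (p.1, (p.2, p.1))) (by fun_prop)
  have hKs : ∀ t, SmoothFamily fun s : ℝ => K (t, (s, t)) := fun t =>
    hK.comp (g := fun s : ℝ => (t, (s, t))) (by fun_prop)
  have hV : SmoothFamily fun t => velocity (fun s : ℝ => K (t, (s, t))) (hKs t) 0 :=
    SmoothFamily.velocity_param (U := fun t s => K (t, (s, t))) hKt 0 hKs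
  refine ⟨fun t => ∑ i ∈ Finset.range (N + 1), t ^ i *
      loopPairing ((hP i).deriv (Ψ.partialSum N t u) α (M (t, 0))) γ +
    loopPairing (velocity (fun s : ℝ => K (t, (s, t))) (hKs t) 0) γ, ?_, ?_, fun t => ?_⟩
  · exact (continuous_finsetSum _ fun i _ => (continuous_pow i).mul
      (continuous_loopPairing ((hP i).smoothFamily_deriv hψ α hMt) γ)).add
      (continuous_loopPairing hV γ)
  · have h1 : velocity (fun s : ℝ => K (0, (s, 0))) (hKs 0) 0 =
        -hQ'.deriv u α (hydroLinear g β) := velocity_eq _ fun x a => by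
      simp only [hK2, Loop.neg_apply, hb0]
      exact (hQ'.hasDerivAt_line u α _ x a).neg
    -- At t = 0 only the summand i = 0 survives, and it vanishes because P_0 does not depend on u.
    have h2 : ∀ w v, (hP 0).deriv w α v = 0 := fun w v =>
      (hP 0).deriv_eq_of_hasDerivAt fun x a => by
        simp only [hP0, hydro_eq]
        exact hasDerivAt_const _ _
    beta_reduce
    rw [h1, Finset.sum_range_succ', h2]
    simp
  · have h1 : (h.isOp_pushOp g N t).deriv u α (b t) =
        ∑ i ∈ Finset.range (N + 1), t ^ i • (hP i).deriv (Ψ.partialSum N t u) α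
          (partialSumOp DΨ N t u (b t)) +
        t ^ N • velocity (fun s : ℝ => K (t, (s, t))) (hKs t) 0 := by
      refine IsOp.deriv_eq_of_hasDerivAt _ fun x a => ?_
      simp only [hK1 t (_, t), partialSumOp, Loop.add_apply, Loop.smul_apply, Loop.sum_apply]
      refine HasDerivAt.add (HasDerivAt.fun_sum fun i _ => HasDerivAt.const_mul _ ?_)
        (HasDerivAt.const_mul _ ((hKs t).hasDerivAt 0 x a))
      have hl := smoothFamily_partialSum' h.isField N (contDiff_const (c := t)) (.line u (b t))
      have h2 := ((hP i).smoothFamily hl (.const α)).hasDerivAt 0 x a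
      rw [(hP i).hasDerivAt hl (.const α), h.velocity_partialSum, IsOp.velocity_const,
        (hP i).map_zero, add_zero, zero_smul, add_zero] at h2
      exact h2
    -- The image of b_t under Ψ_t' is the push-forward operator applied to β, so the defect
    -- expansion applies a second time.
    have h3 : partialSumOp DΨ N t u (b t) =
        partialSumOp P N t (Ψ.partialSum N t u) β + t ^ N • M (t, 0) := hM1 t 0
    rw [h1, h3]
    have h4 : ∀ i, (hP i).deriv (Ψ.partialSum N t u) α
        (partialSumOp P N t (Ψ.partialSum N t u) β + t ^ N • M (t, 0)) =
        ∑ j ∈ Finset.range (N + 1), t ^ j •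
          (hP i).deriv (Ψ.partialSum N t u) α (P j (Ψ.partialSum N t u) β) +
        t ^ N • (hP i).deriv (Ψ.partialSum N t u) α (M (t, 0)) := fun i => by
      simp only [partialSumOp, ← IsOp.derivLinear_apply, map_add, map_sum, map_smul]
    simp only [h4, map_add, map_sum, map_smul, LinearMap.add_apply, LinearMap.sum_apply,
      LinearMap.smul_apply, smul_eq_mul, mul_add, Finset.mul_sum, Finset.sum_add_distrib]
    rw [add_assoc]
    congr 2
    exact Finset.sum_congr rfl fun i _ => by ring

/-- The exact identity `jacobi_transform` for the truncated map is expanded by `exists_remainder`.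
The Jacobi identities of P_ε remove all orders up to N, and the coefficient of t^N at t = 0 is what
remains. -/
theorem isCocycle_defect (h : IsFormalDifferential Ψ DΨ DΨ') (hg : g.IsSymm)
    (hP : ∀ i : ℕ, IsOp 1 (i + 1) (P i)) (hP0 : P 0 = hydro g)
    (hJ : ∀ m u α β γ, ∑ p ∈ Finset.HasAntidiagonal.antidiagonal m,
      jacobiator (hP p.1) (P p.2) u α β γ = 0)
    (hpush : ∀ k < N, ∀ u α, pushDefect g P Ψ DΨ DΨ' k u α = 0) {e : ℤ} (hQ' : IsOp 1 e Q)
    (hQ : ∀ u α, pushDefect g P Ψ DΨ DΨ' N u α = (Q u α).1) : IsCocycle g hQ' := by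
  intro u α β γ
  obtain ⟨B₁, hc₁, h0₁, hB₁⟩ := h.exists_remainder hP hP0 hpush hQ' hQ u α β γ
  obtain ⟨B₂, hc₂, h0₂, hB₂⟩ := h.exists_remainder hP hP0 hpush hQ' hQ u β γ α
  obtain ⟨B₃, hc₃, h0₃, hB₃⟩ := h.exists_remainder hP hP0 hpush hQ' hQ u γ α β
  have hψ : SmoothFamily fun t => Ψ.partialSum N t u := smoothFamily_partialSum Ψ N u
  have hc : ∀ i j α β γ, Continuous fun t => loopPairing ((hP i).deriv (Ψ.partialSum N t u) α
      (P j (Ψ.partialSum N t u) β)) γ := fun i j α β γ =>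
    continuous_loopPairing ((hP i).smoothFamily_deriv hψ α ((hP j).smoothFamily hψ (.const β))) γ
  set J : ℝ → ℕ → ℕ → ℝ := fun t i j => jacobiator (hP i) (P j) (Ψ.partialSum N t u) α β γ with hJd
  have hcJ : ∀ i j, Continuous fun t => J t i j := fun i j =>
    ((hc i j α β γ).add (hc i j β γ α)).add (hc i j γ α β)
  have h0 := eq_zero_of_pow_mul_eq_zero (N := N) (f := fun t => ∑ i ∈ Finset.range (N + 1),
      ∑ j ∈ Finset.range (N + 1), (if N < i + j then t ^ (i + j - N) * J t i j else 0) +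
      (B₁ t + B₂ t + B₃ t)) ?_ fun t => ?_
  · simp only [h0₁, h0₂, h0₃] at h0
    rw [Finset.sum_eq_zero fun i _ => Finset.sum_eq_zero fun j _ => ?_, zero_add] at h0
    · linarith
    · split_ifs with hij
      · rw [zero_pow (by omega), zero_mul]
      · rfl
  · refine (continuous_finsetSum _ fun i _ => continuous_finsetSum _ fun j _ => ?_).add
      ((hc₁.add hc₂).add hc₃)
    split_ifs
    · exact (continuous_pow _).mul (hcJ i j)
    · exact continuous_const
  · rw [mul_add, ← sum_sum_pow_eq (fun m _ => hJ m _ α β γ) t]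
    have h1 := jacobi_transform hg (IsField.sum fun j _ => ((h.isField j).zero_weight).smul (t ^ j))
      (isOp_partialSumOp h.isOp N t) (isOp_partialSumOp h.isOp' N t)
      (IsDerivative.sum fun j _ => (h.isDerivative j).smul (t ^ j))
      (isAdjointPair_partialSumOp h.isAdjointPair N t) (h.isOp_pushOp g N t) u α β γ
    have h2 := (congrArg₂ (· + ·) (congrArg₂ (· + ·) (hB₁ t) (hB₂ t)) (hB₃ t)).symm.trans h1
    beta_reduce at h2
    simp only [hJd, jacobiator, mul_add, Finset.sum_add_distrib]
    linarith

end IsFormalDifferential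

end ObstructionCocycle

/-! ### Formal flows and their products -/

section Flows

variable {n : ℕ} {X : Loop n → Loop n} {φ φ' Ψ : FormalMap n} {k : ℕ}

theorem exists_seq_of_step {α : Type*} {I : ℕ → α → Prop} {R : ℕ → α → α → Prop} {a : α}
    (h0 : I 0 a) (step : ∀ k a, I k a → ∃ b, I (k + 1) b ∧ R k a b) :
    ∃ f : ℕ → α, f 0 = a ∧ ∀ k, I k (f k) ∧ R k (f k) (f (k + 1)) := by
  choose s hs hR using step
  let f : (k : ℕ) → {a // I k a} := Nat.rec ⟨a, h0⟩ fun k b => ⟨s k b.1 b.2, hs k b.1 b.2⟩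
  exact ⟨fun k => (f k).1, rfl, fun k => ⟨(f k).2, hR k _ (f k).2⟩⟩

/-- The j-th coefficient is final from stage j on, so coefficientwise limits are diagonals. -/
theorem eq_diagonal {α : Type*} {f : ℕ → ℕ → α} (h : ∀ k, ∀ j ≤ k, f (k + 1) j = f k j) {j k : ℕ}
    (hjk : j ≤ k) : f k j = f j j := by
  induction k, hjk using Nat.le_induction with
  | base => rfl
  | succ k hk ih => rw [h k j hk, ih]

/-- Homogeneous vector fields have homogeneous formal flows. -/
theorem IsField.exists_isFormalFlow {d : ℤ} (hX : IsField 1 d X) :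
    ∃ φ : FormalMap n, IsFormalFlow X φ ∧ ∀ j : ℕ, IsField 1 (d * j) (φ j) := by
  have step : ∀ (k : ℕ) (φ : FormalMap n), ((∀ u, φ 0 u = u) ∧
      (∀ j : ℕ, IsField 1 (d * j) (φ j)) ∧
      ∀ i < k, ∀ u, ((i + 1 : ℕ) : ℝ) • (φ (i + 1) u).1 = taylorCoeff X φ i u) →
      ∃ φ' : FormalMap n, ((∀ u, φ' 0 u = u) ∧ (∀ j : ℕ, IsField 1 (d * j) (φ' j)) ∧
        ∀ i < k + 1, ∀ u, ((i + 1 : ℕ) : ℝ) • (φ' (i + 1) u).1 = taylorCoeff X φ' i u) ∧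
        ∀ j ≤ k, φ' j = φ j := by
    rintro k φ ⟨h0, hφ, hflow⟩
    -- The order k coefficient of X along φ involves only φ_0, …, φ_k, so the flow equation
    -- determines φ_{k+1} and leaves earlier equations intact.
    obtain ⟨Y, hY, hXY⟩ := hX.exists_taylorCoeff h0 hφ k
    have hne : ∀ j ≤ k, Function.update φ (k + 1) (fun u => ((k + 1 : ℕ) : ℝ)⁻¹ • Y u) j = φ j :=
      fun j hj => Function.update_of_ne (by omega) _ _
    refine ⟨Function.update φ (k + 1) fun u => ((k + 1 : ℕ) : ℝ)⁻¹ • Y u,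
      ⟨fun u => ?_, fun j => ?_, fun i hi u => ?_⟩, hne⟩
    · rw [hne 0 (Nat.zero_le k), h0]
    · by_cases hj : j = k + 1
      · rw [hj, Function.update_self]
        exact (hY.smul _).cast (by push_cast; ring)
      · rw [Function.update_of_ne hj]
        exact hφ j
    · rw [taylorCoeff_congr (φ' := φ) fun j hj => hne j (by omega)]
      by_cases hik : i = k
      · rw [hik, Function.update_self, hXY, Submodule.coe_smul, smul_smul, mul_inv_cancel₀
          (by positivity), one_smul]
      · rw [Function.update_of_ne (by omega)]
        exact hflow i (by omega) u
  obtain ⟨f, -, hf⟩ := exists_seq_of_step (a := FormalMap.ident n) ⟨fun u => rfl,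
    fun j => by
      cases j with
      | zero => exact IsField.id.cast (by simp)
      | succ j => exact IsField.zero,
    fun i hi => absurd hi (Nat.not_lt_zero i)⟩ step
  have hR : ∀ {j k}, j ≤ k → f k j = f j j := fun hjk => eq_diagonal (fun k => (hf k).2) hjk
  refine ⟨fun m => f m m, ⟨(hf 0).1.1, fun k u => ?_⟩, fun j => (hf j).1.2.1 j⟩
  rw [taylorCoeff_congr (φ' := f (k + 1)) fun j hj => (hR (by omega)).symm]
  exact (hf (k + 1)).1.2.2 k (by omega) u

theorem atPower_zero (hk : φ 0 = fun u => u) : φ.atPower k 0 = fun u => u := by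
  funext u
  simp [FormalMap.atPower, hk]

theorem IsField.atPower {d : ℕ} (hφ : ∀ j : ℕ, IsField 1 ((d : ℤ) * j) (φ j)) (m : ℕ) :
    IsField 1 m (φ.atPower d m) := by
  unfold FormalMap.atPower
  split_ifs with h
  · exact (hφ (m / d)).cast (by exact_mod_cast Nat.mul_div_cancel' h)
  · exact .zero

/-- The composition of the flow of a vector field of degree `k + 1` with a homogeneous formal
map. -/
theorem exists_isComposition_flow {Φ : FormalMap n} (hflow : IsFormalFlow X Φ)
    (hΦ : ∀ j : ℕ, IsField 1 (((k + 1 : ℕ) : ℤ) * j) (Φ j)) (h0 : ∀ u, Ψ 0 u = u)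
    (hΨ : ∀ j : ℕ, IsField 1 j (Ψ j)) :
    ∃ Ψ' : FormalMap n, IsComposition Ψ' (Φ.atPower (k + 1)) Ψ ∧ (∀ j : ℕ, IsField 1 j (Ψ' j)) ∧
      (∀ j ≤ k, Ψ' j = Ψ j) ∧ ∀ u, Ψ' (k + 1) u = Ψ (k + 1) u + X u := by
  have hpow := IsField.atPower hΦ
  have hid : Φ.atPower (k + 1) 0 = fun u => u := atPower_zero (funext hflow.1)
  have hX : ∀ u, Φ.atPower (k + 1) (k + 1) u = X u := fun u => by
    have h1 := hflow.2 0 u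
    rw [taylorCoeff_order_zero, hflow.1] at h1
    refine Subtype.ext ?_
    simpa [FormalMap.atPower, Nat.div_self (Nat.succ_pos k)] using h1
  -- After the substitution t = ε^(k+1) the flow is id + ε^(k+1) X up to higher order.
  have hz : ∀ p, p ≠ 0 → p < k + 1 → Φ.atPower (k + 1) p = fun _ => 0 := fun p hp hpk => by
    funext u
    exact if_neg fun h => absurd (Nat.le_of_dvd (Nat.pos_of_ne_zero hp) h) (by omega)
  choose Z hZ hZ' using fun p q => (hpow p).exists_taylorCoeff (r := 1) h0
    (fun j => (hΨ j).cast (by simp)) q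
  have hZid : ∀ q u, Z 0 q u = Ψ q u := fun q u => Subtype.ext (by
    rw [← hZ', hid, taylorCoeff_id])
  have hZ0 : ∀ p q u, p ≠ 0 → p < k + 1 → Z p q u = 0 := fun p q u hp hpk => Subtype.ext (by
    rw [← hZ', hz p hp hpk, taylorCoeff_const]
    split_ifs <;> rfl)
  refine ⟨fun m u => ∑ p ∈ Finset.HasAntidiagonal.antidiagonal m, Z p.1 p.2 u, fun m u => ?_,
    fun m => .sum fun p hp => (hZ p.1 p.2).cast ?_, fun m hm => funext fun u => ?_, fun u => ?_⟩
  · rw [AddSubmonoidClass.coe_finsetSum]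
    simp only [hZ']
  · rw [← Finset.HasAntidiagonal.mem_antidiagonal.1 hp]
    push_cast
    ring
  · beta_reduce
    rw [Finset.sum_eq_single (0, m), hZid]
    · rintro ⟨p, q⟩ hp hne
      have hp := Finset.HasAntidiagonal.mem_antidiagonal.1 hp
      refine hZ0 p q u (fun h => hne ?_) ?_
      · ext <;> simp at hp ⊢ <;> omega
      · simp at hp
        omega
    · intro h
      exact absurd (Finset.HasAntidiagonal.mem_antidiagonal.2 (by simp)) h
  · beta_reduce
    rw [Finset.Nat.sum_antidiagonal_succ]
    simp only
    rw [hZid, Finset.sum_eq_single (k, 0)]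
    · congr 1
      refine Subtype.ext ?_
      rw [← hZ', taylorCoeff_order_zero, h0, hX]
    · rintro ⟨p, q⟩ hp hne
      have hp := Finset.HasAntidiagonal.mem_antidiagonal.1 hp
      refine hZ0 (p + 1) q u (by omega) ?_
      simp at hp hne
      omega
    · intro h
      exact absurd (Finset.HasAntidiagonal.mem_antidiagonal.2 (by simp)) h

end Flows

/-! ### Triviality of homogeneous deformations -/

section Main

variable {n : ℕ} {g : Matrix (Fin n) (Fin n) ℝ} {P : ℕ → Loop n → Loop n → Loop n}
  {Ψ Ψ' : FormalMap n} {DΨ DΨ' EΨ EΨ' : ℕ → Loop n → Loop n → Loop n} {k : ℕ}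
  {X : Loop n → Loop n} {DX DX' : Loop n → Loop n → Loop n}

/-- The transformation law of bivectors at the order `k` of the deformation parameter. -/
def IsPushforwardAt (φ : FormalMap n) (P₀ : Loop n → Loop n → Loop n)
    (P : ℕ → Loop n → Loop n → Loop n) (k : ℕ) : Prop :=
  ∀ u α,
    ∑ p ∈ Finset.HasAntidiagonal.antidiagonal k, taylorCoeff (fun w => P p.1 w α) φ p.2 u =
    ∑ p ∈ Finset.HasAntidiagonal.antidiagonal k,
      frechet (φ p.1) u (P₀ u (adjoint (frechet (φ p.2) u) α))

theorem IsPushforwardAt.congr {P₀ : Loop n → Loop n → Loop n} (h : IsPushforwardAt Ψ P₀ P k)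
    (hΨ : ∀ j ≤ k, Ψ' j = Ψ j) : IsPushforwardAt Ψ' P₀ P k := fun u α => by
  have h1 : ∀ p ∈ Finset.HasAntidiagonal.antidiagonal k, p.1 ≤ k ∧ p.2 ≤ k := fun p hp => by
    have := Finset.HasAntidiagonal.mem_antidiagonal.1 hp
    omega
  rw [Finset.sum_congr rfl fun p hp => by
    rw [taylorCoeff_congr fun j hj => hΨ j (hj.trans (h1 p hp).2)], h u α]
  exact Finset.sum_congr rfl fun p hp => by rw [hΨ p.1 (h1 p hp).1, hΨ p.2 (h1 p hp).2]

theorem IsFormalDifferential.isPushforwardAt_iff (h : IsFormalDifferential Ψ DΨ DΨ') :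
    IsPushforwardAt Ψ (hydro g) P k ↔ ∀ u α, pushDefect g P Ψ DΨ DΨ' k u α = 0 := by
  have h1 : ∀ u α i j, frechet (Ψ i) u (hydro g u (adjoint (frechet (Ψ j) u) α)) =
      (DΨ i u (hydroLinear g (DΨ' j u α))).1 := fun u α i j => by
    rw [(h.isDerivative i).frechet_eq, hydro_eq, adjoint_eq (γ := DΨ' j u α) fun v => by
      rw [(h.isDerivative j).frechet_eq]
      exact h.isAdjointPair j u v α]
  simp only [IsPushforwardAt, pushDefect, sub_eq_zero, h1]

theorem IsDerivative.unique (h : IsDerivative X DX) (h' : IsDerivative X DX') (u v : Loop n) :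
    DX u v = DX' u v :=
  Subtype.ext (by rw [← h.frechet_eq, h'.frechet_eq])

theorem IsAdjointPair.unique {D D' T T' : Loop n → Loop n → Loop n} (h : IsAdjointPair D T)
    (h' : IsAdjointPair D' T') {u : Loop n} (hD : ∀ v, D u v = D' u v) (α : Loop n) :
    T u α = T' u α :=
  loopPairing_ext fun z => by rw [← h, ← h', hD]

/-- Composition with the flow of a vector field of degree `k + 1` changes the push-forward of `P_0`
at order `k + 1` by a coboundary. -/
theorem pushDefect_succ (hP0 : P 0 = hydro g) (h : IsFormalDifferential Ψ DΨ DΨ')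
    (h' : IsFormalDifferential Ψ' EΨ EΨ') (hX : IsDerivative X DX) (had : IsAdjointPair DX DX')
    (hΨ : ∀ j ≤ k, Ψ' j = Ψ j) (hΨX : ∀ u, Ψ' (k + 1) u = Ψ (k + 1) u + X u) (u α : Loop n) :
    pushDefect g P Ψ' EΨ EΨ' (k + 1) u α = pushDefect g P Ψ DΨ DΨ' (k + 1) u α -
      (DX u (hydroLinear g α) + hydroLinear g (DX' u α)).1 := by
  have hE : ∀ j ≤ k, ∀ v, EΨ j u v = DΨ j u v := fun j hj v =>
    (h'.isDerivative j).unique (hΨ j hj ▸ h.isDerivative j) u v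
  have hE' : ∀ j ≤ k, ∀ v, EΨ' j u v = DΨ' j u v := fun j hj v =>
    (h'.isAdjointPair j).unique (h.isAdjointPair j) (hE j hj) v
  have hs : IsDerivative (Ψ' (k + 1)) fun u v => DΨ (k + 1) u v + DX u v := by
    rw [funext hΨX]
    exact (h.isDerivative (k + 1)).add hX
  have hsad : IsAdjointPair (fun u v => DΨ (k + 1) u v + DX u v)
      fun u v => DΨ' (k + 1) u v + DX' u v := fun u v β => by
    rw [map_add, map_add, LinearMap.add_apply, h.isAdjointPair, had]
  have hEs : ∀ v, EΨ (k + 1) u v = DΨ (k + 1) u v + DX u v :=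
    (h'.isDerivative (k + 1)).unique hs u
  have hEs' : ∀ v, EΨ' (k + 1) u v = DΨ' (k + 1) u v + DX' u v :=
    (h'.isAdjointPair (k + 1)).unique hsad hEs
  have h1 : ∀ p ∈ Finset.HasAntidiagonal.antidiagonal (k + 1),
      taylorCoeff (fun w => P p.1 w α) Ψ' p.2 u = taylorCoeff (fun w => P p.1 w α) Ψ p.2 u :=
    fun p hp => by
      have hp := Finset.HasAntidiagonal.mem_antidiagonal.1 hp
      -- The changed coefficient of order k + 1 could enter only through P_0, which is independent
      -- of the base point.
      by_cases hp1 : p.1 = 0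
      · simp only [hp1, hP0, hydro_eq, taylorCoeff_const]
      · rw [taylorCoeff_congr fun j hj => hΨ j (by omega)]
  have h2 : ∑ p ∈ Finset.HasAntidiagonal.antidiagonal (k + 1),
      (EΨ p.1 u (hydroLinear g (EΨ' p.2 u α))).1 =
      ∑ p ∈ Finset.HasAntidiagonal.antidiagonal (k + 1),
        (DΨ p.1 u (hydroLinear g (DΨ' p.2 u α))).1 +
      (DX u (hydroLinear g α) + hydroLinear g (DX' u α)).1 := by
    -- Only the two ends of the antidiagonal involve the new coefficient; there the other factor is
    -- the identity.
    have h3 : ∀ p ∈ Finset.HasAntidiagonal.antidiagonal (k + 1),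
        EΨ p.1 u (hydroLinear g (EΨ' p.2 u α)) = DΨ p.1 u (hydroLinear g (DΨ' p.2 u α)) +
        ((if p = (k + 1, 0) then DX u (hydroLinear g α) else 0) +
          if p = (0, k + 1) then hydroLinear g (DX' u α) else 0) := by
      rintro ⟨i, j⟩ hp
      have hp := Finset.HasAntidiagonal.mem_antidiagonal.1 hp
      simp only [Prod.mk.injEq] at hp ⊢
      by_cases hi : i = 0
      · obtain rfl : j = k + 1 := by omega
        subst hi
        simp [h'.deriv_zero, h.deriv_zero, hEs', map_add]
      · by_cases hj : j = 0
        · obtain rfl : i = k + 1 := by omega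
          subst hj
          simp [h'.adjoint_zero, h.adjoint_zero, hEs]
        · rw [hE i (by omega), hE' j (by omega)]
          simp [hi, hj]
    rw [← AddSubmonoidClass.coe_finsetSum, Finset.sum_congr rfl h3, Finset.sum_add_distrib,
      Finset.sum_add_distrib, Finset.sum_ite_eq', Finset.sum_ite_eq',
      if_pos (Finset.HasAntidiagonal.mem_antidiagonal.2 (by simp)),
      if_pos (Finset.HasAntidiagonal.mem_antidiagonal.2 (by simp)), Submodule.coe_add,
      AddSubmonoidClass.coe_finsetSum]
  rw [pushDefect, pushDefect, Finset.sum_congr rfl h1, h2, sub_add_eq_sub_sub]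

/-- The inductive step: the defect at order k + 1 has degree k + 2 ≥ 2, so it is a coboundary, and
the flow of its potential X removes it. -/
theorem exists_flow_step (hg : g.IsSymm) (hdet : IsUnit g.det)
    (hP : ∀ i : ℕ, IsOp 1 (i + 1) (P i)) (hP0 : P 0 = hydro g) (hskew : ∀ i, IsSkew (P i))
    (hJ : ∀ m u α β γ, ∑ p ∈ Finset.HasAntidiagonal.antidiagonal m,
      jacobiator (hP p.1) (P p.2) u α β γ = 0)
    (h0 : ∀ u, Ψ 0 u = u) (hΨ : ∀ j : ℕ, IsField 1 j (Ψ j))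
    (hpush : ∀ j ≤ k, IsPushforwardAt Ψ (hydro g) P j) :
    ∃ (X : Loop n → Loop n) (Φ Ψ' : FormalMap n), IsField 1 ((k + 1 : ℕ) : ℤ) X ∧
      IsFormalFlow X Φ ∧ IsComposition Ψ' (Φ.atPower (k + 1)) Ψ ∧
      (∀ j : ℕ, IsField 1 j (Ψ' j)) ∧ (∀ j ≤ k, Ψ' j = Ψ j) ∧
      ∀ j ≤ k + 1, IsPushforwardAt Ψ' (hydro g) P j := by
  obtain ⟨DΨ, DΨ', h⟩ := exists_isFormalDifferential h0 hΨ
  obtain ⟨Q, hQ, hQ'⟩ := h.exists_pushDefect g hP (k + 1)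
  have hlow : ∀ j < k + 1, ∀ u α, pushDefect g P Ψ DΨ DΨ' j u α = 0 := fun j hj =>
    h.isPushforwardAt_iff.1 (hpush j (by omega))
  obtain ⟨X, DX, DX', hX, -, -, hd, had, hQX⟩ :=
    (h.isCocycle_defect hg hP hP0 hJ hlow hQ hQ').exists_coboundary hg hdet
      (h.isSkew_defect hg hP hskew hlow hQ') (by push_cast; omega)
  replace hX : IsField 1 ((k + 1 : ℕ) : ℤ) X := hX.cast (by push_cast; ring)
  obtain ⟨Φ, hflow, hΦ⟩ := hX.exists_isFormalFlow
  obtain ⟨Ψ', hcomp, hΨ', hlow', hsucc⟩ := exists_isComposition_flow hflow hΦ h0 hΨ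
  refine ⟨X, Φ, Ψ', hX, hflow, hcomp, hΨ', hlow', fun j hj => ?_⟩
  rcases Nat.le_succ_iff.1 hj with hj | rfl
  · exact (hpush j hj).congr fun i hi => hlow' i (hi.trans hj)
  · obtain ⟨EΨ, EΨ', h'⟩ := exists_isFormalDifferential
      (fun u => by rw [hlow' 0 (Nat.zero_le k), h0]) hΨ'
    refine h'.isPushforwardAt_iff.2 fun u α => ?_
    rw [pushDefect_succ hP0 h h' hd had hlow' hsucc, hQ', hQX, sub_self]

theorem isSkew_hydro (hg : g.IsSymm) : IsSkew (hydro g) := fun u α β => by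
  rw [hydro_eq, hydro_eq]
  exact loopPairing_hydroLinear hg α β

theorem isPushforwardAt_ident (hP0 : P 0 = hydro g) :
    IsPushforwardAt (FormalMap.ident n) (hydro g) P 0 := by
  have hz : ∀ u, FormalMap.ident n 0 u = u := fun u => rfl
  obtain ⟨D, D', h⟩ := exists_isFormalDifferential (Ψ := FormalMap.ident n) hz fun j => by
    cases j with
    | zero => exact IsField.id
    | succ j => exact IsField.zero
  refine h.isPushforwardAt_iff.2 fun u α => ?_
  rw [pushDefect, Finset.Nat.antidiagonal_zero, Finset.sum_singleton, Finset.sum_singleton,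
    taylorCoeff_order_zero, h.deriv_zero, h.adjoint_zero, hz, hP0, hydro_eq, sub_self]

end Main

end HydroPoisson

/-! ### Assembly of the infinite product of flows. -/

theorem mainTheorem4 {n : ℕ} (g : Matrix (Fin n) (Fin n) ℝ) (hsymm : g.IsSymm)
    (hreg : IsUnit g.det) (P : ℕ → HydroPoisson.Loop n → HydroPoisson.Loop n → HydroPoisson.Loop n)
    (hP : HydroPoisson.IsHomogeneousDeformation g P) :
    ∃ (X : ℕ → HydroPoisson.Loop n → HydroPoisson.Loop n) (φ : HydroPoisson.FormalMap n),
      (∀ k, 1 ≤ k → HydroPoisson.IsHomogeneousField k (X k)) ∧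
      HydroPoisson.IsOrderedProductOfFlows X φ ∧
      (∀ u, φ 0 u = u) ∧
      (∀ m, HydroPoisson.IsHomogeneousField m (φ m)) ∧
      HydroPoisson.IsPushforward φ (HydroPoisson.hydro g) P := by
  open HydroPoisson in
  have hop : ∀ i : ℕ, IsOp 1 (i + 1) (P i) := fun i => by
    rcases Nat.eq_zero_or_pos i with rfl | hi
    · rw [hP.zero, show hydro g = fun _ α => hydroLinear g α from
        funext fun u => funext fun α => hydro_eq g u α]
      exact IsOp.hydroLinear g
    · exact_mod_cast (hP.homogeneous i hi).isOp
  have hskew : ∀ i, IsSkew (P i) := fun i => by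
    rcases Nat.eq_zero_or_pos i with rfl | hi
    · rw [hP.zero]
      exact isSkew_hydro hsymm
    · exact hP.skew i hi
  have hJ : ∀ m u α β γ, ∑ p ∈ Finset.HasAntidiagonal.antidiagonal m,
      jacobiator (hop p.1) (P p.2) u α β γ = 0 := fun m u α β γ =>
    sum_jacobiator_eq_zero hop hskew (hP.jacobi m u α β) γ
  have step : ∀ (k : ℕ) (Ψ : FormalMap n), ((∀ u, Ψ 0 u = u) ∧ (∀ j : ℕ, IsField 1 j (Ψ j)) ∧
      ∀ j ≤ k, IsPushforwardAt Ψ (hydro g) P j) →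
      ∃ Ψ' : FormalMap n, ((∀ u, Ψ' 0 u = u) ∧ (∀ j : ℕ, IsField 1 j (Ψ' j)) ∧
        ∀ j ≤ k + 1, IsPushforwardAt Ψ' (hydro g) P j) ∧ (∀ j ≤ k, Ψ' j = Ψ j) ∧
        ∃ (X : Loop n → Loop n) (Φ : FormalMap n), IsField 1 ((k + 1 : ℕ) : ℤ) X ∧
          IsFormalFlow X Φ ∧ IsComposition Ψ' (Φ.atPower (k + 1)) Ψ := by
    rintro k Ψ ⟨h0, hΨ, hpush⟩
    obtain ⟨X, Φ, Ψ', hX, hΦ, hcomp, hΨ', hlow, hpush'⟩ :=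
      exists_flow_step hsymm hreg hop hP.zero hskew hJ h0 hΨ hpush
    exact ⟨Ψ', ⟨fun u => by rw [hlow 0 (Nat.zero_le k), h0], hΨ', hpush'⟩, hlow, X, Φ, hX, hΦ,
      hcomp⟩
  obtain ⟨Ψ, hΨ0, hΨ⟩ := exists_seq_of_step (a := FormalMap.ident n) ⟨fun u => rfl,
    fun j => by
      cases j with
      | zero => exact IsField.id
      | succ j => exact IsField.zero,
    fun j hj => by
      obtain rfl : j = 0 := by omega
      exact isPushforwardAt_ident hP.zero⟩ step
  choose hlow X Φ hX hΦ hcomp using fun k => (hΨ k).2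
  have hdiag : ∀ {j k}, j ≤ k → Ψ k j = Ψ j j := fun hjk => eq_diagonal hlow hjk
  -- Step k of the recursion produces the field of degree k + 1, hence the shift; the value at k = 0
  -- is irrelevant.
  refine ⟨fun k => X (k - 1), fun m => Ψ m m, fun k hk => ?_,
    ⟨fun k => Φ (k - 1), Ψ, fun k _ => hΦ (k - 1), hΨ0, hcomp, fun m k hmk => (hdiag hmk).symm⟩,
    (hΨ 0).1.1, fun m => ((hΨ m).1.2.1 m).isHomogeneousField, fun k => ?_⟩
  · obtain ⟨k, rfl⟩ := Nat.exists_eq_add_of_le' hk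
    exact (hX k).isHomogeneousField
  · exact ((hΨ k).1.2.2 k le_rfl).congr fun j hj => (hdiag hj).symm
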